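/- Let $\zeta(s_1,s_2)$ be the double zeta function, i.e. the analytic continuation of $\sum_{0<m_1<m_2} m_1^{-s_1}m_2^{-s_2}$ (absolutely convergent for $\Re s_2>1$, $\Re(s_1+s_2)>2$) to a holomorphic function on the complement in $\mathbb{C}^2$ of the complex lines $s_2=1$ and $s_1+s_2\in\{1\}\cup\{2,0,-2,-4,\dots\}$; this continuation exists. Put $f(s)=2^s\pi^{s-1}\Gamma(1-s)$, let $(s)_j=s(s+1)\cdots(s+j-1)$ be the Pochhammer symbol, $\cot^{(j)}$ the $j$-th derivative of the cotangent, and for $s_1+s_2\neq 0$ put $r_j=\frac{s_j}{s_1+s_2}$ ($j=1,2$) and let $c_j$ ($j\ge 0$) be the coefficient of $x^j$ in the Taylor expansion of $(1+xr_2)^{-s_1}(1-xr_1)^{-s_2}$ at $x=0$ (principal powers). Fix a real number $\epsilon>0$ and an integer $N\ge 0$. There are constants $C,R$ depending only on $\epsilon$ and $N$ such that, for all $s_1,s_2\in\mathbb{C}$ with $|\Im s_1|<\frac1\epsilon$, $|\Im s_2|<\frac1\epsilon$, $\epsilon<\frac{\Re s_1}{\Re(s_1+s_2)}<1-\epsilon$,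 $s_1+s_2\notin 2\mathbb{Z}$, $\Re s_1<-R$ and $\Re s_2<-R$, $$\frac{\zeta(s_1,s_2)}{f(s_1+s_2)}=-\frac12\sin\Bigl(\frac{\pi}{2}(s_1+s_2)\Bigr)+\frac12\cos\Bigl(\frac{\pi}{2}(s_1+s_2)\Bigr)\sum_{j=0}^{2N}\frac{\pi^j\cot^{(j)}(\pi r_2)}{(s_1+s_2)_j}\,c_j+\frac{\sin(\pi s_2)\,\Gamma(1-s_1)\,\Gamma(1-s_2)\,\zeta(2-s_1-s_2)}{4\pi\,\Gamma(1-s_1-s_2)\sin\bigl(\frac{\pi}{2}(s_1+s_2)\bigr)}+E(s_1,s_2),$$ where $|E(s_1,s_2)|\le C\,|s_1+s_2|^{-N-1}$ and $\zeta(\cdot)$ of one variable is the Riemann zeta function. Moreover, for all $s_1,s_2\in\mathbb{C}$ with $s_1+s_2\ne0$ and all $j\ge 0$, $$c_j=\sum_{2l_2+3l_3+\cdots+jl_j=j}(s_1+s_2)^{l_2+\cdots+l_j}\prod_{k=2}^{j}\frac{1}{l_k!}\left(\frac{r_1(-r_2)^k+r_2r_1^k}{k}\right)^{l_k},$$ the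 sum being over families $(l_2,\dots,l_j)$ of nonnegative integers. -/

import Mathlib

/-- The polar set of the Euler–Zagier double zeta function: the complex lines `s₂ = 1` and
`s₁ + s₂ = 1, 2, 0, -2, -4, -6, …`. -/
def doubleZetaPolarSet : Set (ℂ × ℂ) :=
  {s | s.2 = 1 ∨ s.1 + s.2 = 1 ∨ ∃ k : ℕ, s.1 + s.2 = 2 - 2 * (k : ℂ)}

/-- `Z` is an analytic continuation of the double series `∑_{0 < m₁ < m₂} m₁^(-s₁) m₂^(-s₂)`:
it is holomorphic off the polar set (a connected open set), and it is the sum of the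
series on the region of absolute convergence. -/
structure IsDoubleZeta (Z : ℂ × ℂ → ℂ) : Prop where
  differentiableOn : DifferentiableOn ℂ Z doubleZetaPolarSetᶜ
  hasSum : ∀ s : ℂ × ℂ, 1 < s.2.re → 2 < (s.1 + s.2).re →
    HasSum (fun m : {m : ℕ × ℕ // 0 < m.1 ∧ m.1 < m.2} =>
      1 / ((m.1.1 : ℂ) ^ s.1 * (m.1.2 : ℂ) ^ s.2)) (Z s)

theorem isClosed_doubleZetaPolarSet : IsClosed doubleZetaPolarSet := by
  have hcl : Topology.IsClosedEmbedding (fun n : ℤ => (n : ℂ)) := by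
    have := Complex.isometry_ofReal.isClosedEmbedding.comp Int.isClosedEmbedding_coe_real
    simpa [Function.comp_def] using this
  have h1 : IsClosed (Set.range fun k : ℕ => (2 - 2 * (k : ℂ))) := by
    have : (Set.range fun k : ℕ => (2 - 2 * (k : ℂ)))
        = (fun n : ℤ => (n : ℂ)) '' (Set.range fun k : ℕ => (2 - 2 * (k : ℤ))) := by
      ext z
      simp
    rw [this]
    exact hcl.isClosedMap _ (isClosed_discrete _)
  have hadd : Continuous fun s : ℂ × ℂ => s.1 + s.2 := by fun_prop
  have e : doubleZetaPolarSet = {s : ℂ × ℂ | s.2 = 1} ∪ ({s : ℂ × ℂ | s.1 + s.2 = 1} ∪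
      (fun s : ℂ × ℂ => s.1 + s.2) ⁻¹' (Set.range fun k : ℕ => (2 - 2 * (k : ℂ)))) := by
    ext s
    simp [doubleZetaPolarSet, eq_comm]
  rw [e]
  exact (isClosed_eq continuous_snd continuous_const).union
    ((isClosed_eq hadd continuous_const).union (h1.preimage hadd))

theorem countable_setOf_add_mul_eq {α β c : ℂ} (h : α ≠ c) :
    {t : ℂ | α + t * β = c}.Countable := by
  refine Set.Subsingleton.countable fun x hx y hy => ?_
  simp only [Set.mem_ofPred_eq] at hx hy
  have hβ : β ≠ 0 := by
    rintro rfl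
    exact h (by simpa using hx)
  exact mul_right_cancel₀ hβ (add_left_cancel (hx.trans hy.symm))

/-- The analytic continuation is unique off the polar set. -/
theorem IsDoubleZeta.eqOn {Z W : ℂ × ℂ → ℂ} (hZ : IsDoubleZeta Z) (hW : IsDoubleZeta W) :
    Set.EqOn Z W doubleZetaPolarSetᶜ := by
  intro b hb
  have hD : IsOpen doubleZetaPolarSetᶜ := isClosed_doubleZetaPolarSet.isOpen_compl
  let L : ℂ → ℂ × ℂ := fun t => (3 + t * (b.1 - 3), 3 + t * (b.2 - 3))
  have hL : Differentiable ℂ L := by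
    intro t
    fun_prop
  have hU : IsOpen (L ⁻¹' doubleZetaPolarSetᶜ) := hD.preimage hL.continuous
  have hc : (L ⁻¹' doubleZetaPolarSet).Countable := by
    have hs : L ⁻¹' doubleZetaPolarSet ⊆ {t | (3 : ℂ) + t * (b.2 - 3) = 1} ∪
        ({t | (6 : ℂ) + t * (b.1 + b.2 - 6) = 1} ∪
          ⋃ k : ℕ, {t | (6 : ℂ) + t * (b.1 + b.2 - 6) = 2 - 2 * (k : ℂ)}) := by
      intro t ht
      rcases ht with h | h | ⟨k, h⟩
      · exact Or.inl h
      · refine Or.inr (Or.inl ?_)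
        simp only [L] at h
        simp only [Set.mem_ofPred_eq]
        linear_combination h
      · refine Or.inr (Or.inr (Set.mem_iUnion.2 ⟨k, ?_⟩))
        simp only [L] at h
        simp only [Set.mem_ofPred_eq]
        linear_combination h
    refine Set.Countable.mono hs ((countable_setOf_add_mul_eq (by norm_num)).union
      ((countable_setOf_add_mul_eq (by norm_num)).union
        (Set.countable_iUnion fun k => countable_setOf_add_mul_eq ?_)))
    intro h
    have h' := congrArg Complex.re h
    simp at h'
    have : (0 : ℝ) ≤ k := Nat.cast_nonneg k
    linarith
  have hconn : IsPreconnected (L ⁻¹' doubleZetaPolarSetᶜ) :=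
    (hc.isConnected_compl_of_one_lt_rank (by simp)).isPreconnected
  have h0 : (0 : ℂ) ∈ L ⁻¹' doubleZetaPolarSetᶜ := by
    rintro (h | h | ⟨k, h⟩)
    · simp [L] at h
    · simp only [L] at h
      norm_num at h
    · have h' := congrArg Complex.re h
      simp [L] at h'
      have : (0 : ℝ) ≤ k := Nat.cast_nonneg k
      linarith
  have hdiff : ∀ {V : ℂ × ℂ → ℂ}, IsDoubleZeta V →
      AnalyticOnNhd ℂ (V ∘ L) (L ⁻¹' doubleZetaPolarSetᶜ) := fun hV =>
    (hV.differentiableOn.comp hL.differentiableOn (Set.mapsTo_preimage _ _)).analyticOnNhd hU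
  have hev : Z ∘ L =ᶠ[nhds 0] W ∘ L := by
    have h1 : ∀ᶠ t in nhds (0 : ℂ), 1 < (L t).2.re :=
      ContinuousAt.eventually_lt (f := fun _ => (1 : ℝ)) (by fun_prop)
        (Complex.continuous_re.comp (continuous_snd.comp hL.continuous)).continuousAt
        (by simp [L])
    have h2 : ∀ᶠ t in nhds (0 : ℂ), 2 < ((L t).1 + (L t).2).re :=
      ContinuousAt.eventually_lt (f := fun _ => (2 : ℝ)) (by fun_prop)
        (Complex.continuous_re.comp ((continuous_fst.comp hL.continuous).add
          (continuous_snd.comp hL.continuous))).continuousAt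
        (by simp [L]; norm_num)
    filter_upwards [h1, h2] with t ht1 ht2
    exact (hZ.hasSum _ ht1 ht2).unique (hW.hasSum _ ht1 ht2)
  have hL1 : L 1 = b := by simp [L]
  have := (hdiff hZ).eqOn_of_preconnected_of_eventuallyEq (hdiff hW) hconn h0 hev
    (x := 1) (by simpa [hL1] using hb)
  simpa [hL1] using this

/-- The double zeta function `ζ(s₁, s₂)`: the analytic continuation of the double series. -/
noncomputable def doubleZeta (s₁ s₂ : ℂ) : ℂ :=
  Classical.epsilon IsDoubleZeta (s₁, s₂)

/-- `f(s) = 2^s π^(s-1) Γ(1-s)`. -/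
noncomputable def zetaFactor (s : ℂ) : ℂ :=
  2 ^ s * (Real.pi : ℂ) ^ (s - 1) * Complex.Gamma (1 - s)

/-- `Coeff(p(x), x^j)`: the coefficient of `x^j` in the Taylor expansion of `p` at `0`. -/
noncomputable def taylorCoeff (p : ℂ → ℂ) (j : ℕ) : ℂ :=
  iteratedDeriv j p 0 / (j.factorial : ℂ)

/-- `c_j = Coeff((1 + x r₂)^(-s₁) (1 - x r₁)^(-s₂), x^j)` with `r_i = s_i / (s₁ + s₂)`. -/
noncomputable def cCoeff (s₁ s₂ : ℂ) (j : ℕ) : ℂ :=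
  taylorCoeff (fun x => (1 + x * (s₂ / (s₁ + s₂))) ^ (-s₁) *
    (1 - x * (s₁ / (s₁ + s₂))) ^ (-s₂)) j

/-- The families `(l_k)`, `2 ≤ k ≤ j`, of nonnegative integers with `2 l₂ + 3 l₃ + ⋯ + j l_j = j`
(each such `l_k` is at most `j`). -/
def weightedFamilies (j : ℕ) : Finset (Finset.Icc 2 j → ℕ) :=
  (Fintype.piFinset fun _ => Finset.range (j + 1)).filter fun l =>
    ∑ k : Finset.Icc 2 j, (k : ℕ) * l k = j

theorem mem_weightedFamilies {j : ℕ} {l : Finset.Icc 2 j → ℕ} :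
    l ∈ weightedFamilies j ↔ ∑ k : Finset.Icc 2 j, (k : ℕ) * l k = j := by
  refine ⟨fun h => (Finset.mem_filter.1 h).2, fun h => Finset.mem_filter.2 ⟨?_, h⟩⟩
  refine Fintype.mem_piFinset.2 fun k => Finset.mem_range.2 (Nat.lt_succ_of_le ?_)
  have h1 : (k : ℕ) * l k ≤ j := by
    refine le_trans ?_ h.le
    exact Finset.single_le_sum (f := fun k : Finset.Icc 2 j => (k : ℕ) * l k)
      (fun _ _ => Nat.zero_le _) (Finset.mem_univ k)
  have h2 : 2 ≤ (k : ℕ) := (Finset.mem_Icc.1 k.2).1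
  nlinarith [Nat.zero_le (l k)]

/-! ### Holomorphy of parameter integrals, and integration against counting measure times a measure
-/

section

open MeasureTheory Filter Topology

/-! Write s = s₁ + s₂ and r = s₂/s. Where the double series converges, Γ(s₂) ζ(s₁,s₂) is ∑_m m^(-s₁)
∫ x^(s₂-1) e^(-mx)/(e^x-1) dx. Splitting 1/(e^x-1) into 1/x - 1/2, p odd Taylor terms and the
remainder `bernTail p` gives `eulerMaclaurinZeta p`: explicit values of the one-variable zeta
function plus one convergent integral. Different p agree where both are defined, so they glue to the
continuation (`isDoubleZeta_eulerMaclaurinZeta`).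

To reach far to the left, the sum over m is carried out inside the remainder integral. For Re s₁ <
0, Lipschitz's formula replaces ∑ m^(-s₁) e^(-mx) by Γ(1-s₁) ∑_n (x+2πin)^(s₁-1). The frequency n =
0 gives a Mellin transform of `bernTail p`, which is the term with ζ(2-s)/sin(πs/2). The other
frequencies form `freqInt`, which needs no lower bound on Re s, so the identity theorem in s₁
extends the formula (`doubleZeta_eq_lipschitzZeta`). The functional equation of ζ turns it into an
exact formula for the quotient by f(s) (`doubleZeta_div_zetaFactor`), and a Beta integral shows that
`freqInt` contributes an exponentially small amount (`norm_freqInt_div_zetaFactor_le`).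

Once the remaining zeta values are replaced by 1, cos(πs/2)/(2π) multiplies (s-1)/(s₂-1) - 2∑ ζ(j+1)
(s₂)_j/(s)_j over odd j < 2p. Since π cot(πz) = 1/z - 2∑ ζ(j+1) z^j over odd j, this is formally the
mean of π cot(πX) for X with a Beta law of parameters s₂, s₁, whose moments are (s₂)_j/(s)_j and
whose mean is r. Expanding the cotangent at r produces the sum in the theorem. Stein's identity for
the Beta law gives a three-term recurrence for the central moments. It agrees with the recurrence of
j! c_j/(s)_j, which comes from the differential equation of the generating function
(`betaFunctional_sub_C_pow_eq`), and it shows that the q-th central moment is O(|s|^(-⌈q/2⌉)).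
Stopping after order 2N therefore costs O(|s|^(-N-1)).

The parameters have negative real part, so there is no actual Beta law. The mean is replaced by a
linear functional on polynomials, and the moments are used only for j < 2p, with 2p close to -Re s₂,
where they decay geometrically. The closed form of c_j is separate: it is the exponential of the
power series of the logarithm of the generating function (`cCoeff_eq_sum`). -/

theorem exp_half_mul_norm_le (a : ℂ) {δ : ℝ} (hδ : 0 < δ) :
    Real.exp (‖a‖ * δ / 2) ≤ ∑ d ∈ ({1, -1, Complex.I, -Complex.I} : Finset ℂ),
      ‖Complex.exp (a * (δ * d))‖ := by
  have h1 : ‖a‖ ≤ |a.re| + |a.im| := Complex.norm_le_abs_re_add_abs_im a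
  -- The larger of |Re a| and |Im a| is at least ‖a‖/2, and a fourth root of unity turns it into a
  -- positive real part.
  have key : ∃ d ∈ ({1, -1, Complex.I, -Complex.I} : Finset ℂ),
      ‖a‖ * δ / 2 ≤ (a * (δ * d)).re := by
    rcases le_total |a.re| |a.im| with h | h
    · rcases le_total 0 a.im with h' | h'
      · refine ⟨-Complex.I, by simp, ?_⟩
        rw [abs_of_nonneg h'] at h h1
        simp
        nlinarith
      · refine ⟨Complex.I, by simp, ?_⟩
        rw [abs_of_nonpos h'] at h h1
        simp
        nlinarith
    · rcases le_total 0 a.re with h' | h'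
      · refine ⟨1, by simp, ?_⟩
        rw [abs_of_nonneg h'] at h h1
        simp
        nlinarith
      · refine ⟨-1, by simp, ?_⟩
        rw [abs_of_nonpos h'] at h h1
        simp
        nlinarith
  obtain ⟨d, hd, hle⟩ := key
  refine le_trans ?_ (Finset.single_le_sum (f := fun d => ‖Complex.exp (a * (δ * d))‖)
    (fun _ _ => norm_nonneg _) hd)
  simp only [Complex.norm_exp]
  exact Real.exp_le_exp.2 hle

/-- Holomorphy of an exponential integral with two complex parameters. -/
theorem differentiableOn_integral_exp {α : Type*} [MeasurableSpace α] {μ : Measure α}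
    {a b w : α → ℂ} (ha : AEStronglyMeasurable a μ) (hb : AEStronglyMeasurable b μ)
    {U : Set (ℂ × ℂ)} (hU : IsOpen U)
    (hint : ∀ s ∈ U, Integrable (fun ω => Complex.exp (a ω * s.1 + b ω * s.2) * w ω) μ) :
    DifferentiableOn ℂ (fun s : ℂ × ℂ => ∫ ω, Complex.exp (a ω * s.1 + b ω * s.2) * w ω ∂μ) U := by
  intro s₀ hs₀
  obtain ⟨r, hr, hball⟩ := Metric.isOpen_iff.1 hU s₀ hs₀
  set δ := r / 2 with hδdef
  have hδ : 0 < δ := by positivity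
  set D : Finset ℂ := {1, -1, Complex.I, -Complex.I} with hD
  have hDn : ∀ d ∈ D, ‖d‖ = 1 := by
    intro d hd
    simp only [hD, Finset.mem_insert, Finset.mem_singleton] at hd
    rcases hd with rfl | rfl | rfl | rfl <;> simp
  have hcorner : ∀ d₁ ∈ D, ∀ d₂ ∈ D, (s₀.1 + δ * d₁, s₀.2 + δ * d₂) ∈ U := by
    intro d₁ h₁ d₂ h₂
    refine hball ?_
    have hn : ∀ d ∈ D, ‖(δ : ℂ) * d‖ < r := by
      intro d hd
      rw [norm_mul, hDn d hd, Complex.norm_real, Real.norm_of_nonneg hδ.le]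
      linarith
    rw [Metric.mem_ball, Prod.dist_eq]
    simpa [dist_eq_norm] using ⟨by simpa using hn d₁ h₁, by simpa using hn d₂ h₂⟩
  let F' : ℂ × ℂ → α → (ℂ × ℂ →L[ℂ] ℂ) := fun s ω =>
    (Complex.exp (a ω * s.1 + b ω * s.2) * w ω) •
      (a ω • ContinuousLinearMap.fst ℂ ℂ ℂ + b ω • ContinuousLinearMap.snd ℂ ℂ ℂ)
  have hF' : ∀ s ω, HasFDerivAt (fun s : ℂ × ℂ => Complex.exp (a ω * s.1 + b ω * s.2) * w ω)
      (F' s ω) s := by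
    intro s ω
    have h1 : HasFDerivAt (fun s : ℂ × ℂ => a ω * s.1 + b ω * s.2)
        (a ω • ContinuousLinearMap.fst ℂ ℂ ℂ + b ω • ContinuousLinearMap.snd ℂ ℂ ℂ) s :=
      (hasFDerivAt_fst.const_mul (a ω)).add (hasFDerivAt_snd.const_mul (b ω))
    convert! (h1.cexp).mul_const (w ω) using 1
    simp only [F', smul_smul]
    ring_nf
  -- On a ball of radius δ/4 the exponential grows by at most exp((‖a‖+‖b‖)δ/4), and a second such
  -- factor absorbs the ‖a‖+‖b‖ coming from the derivative. Their product is dominated by the values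
  -- at the sixteen corners, where integrability is assumed. Pointwise integrability on `U` is thus
  -- enough.
  have hbound : ∀ ω, ∀ s ∈ Metric.ball s₀ (δ / 4), ‖F' s ω‖ ≤
      4 / δ * ∑ d₁ ∈ D, ∑ d₂ ∈ D,
        ‖Complex.exp (a ω * (s₀.1 + δ * d₁) + b ω * (s₀.2 + δ * d₂)) * w ω‖ := by
    intro ω s hs
    have hs1 : ‖s.1 - s₀.1‖ ≤ δ / 4 := by
      rw [← dist_eq_norm]; exact (le_max_left _ _).trans (Metric.mem_ball.1 hs).le
    have hs2 : ‖s.2 - s₀.2‖ ≤ δ / 4 := by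
      rw [← dist_eq_norm]; exact (le_max_right _ _).trans (Metric.mem_ball.1 hs).le
    have hn : ‖a ω • ContinuousLinearMap.fst ℂ ℂ ℂ + b ω • ContinuousLinearMap.snd ℂ ℂ ℂ‖ ≤
        ‖a ω‖ + ‖b ω‖ := by
      refine (norm_add_le _ _).trans ?_
      rw [norm_smul, norm_smul]
      gcongr
      · exact mul_le_of_le_one_right (norm_nonneg _) (ContinuousLinearMap.norm_fst_le ..)
      · exact mul_le_of_le_one_right (norm_nonneg _) (ContinuousLinearMap.norm_snd_le ..)
    have he : Complex.exp (a ω * s.1 + b ω * s.2) = Complex.exp (a ω * s₀.1 + b ω * s₀.2) *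
        Complex.exp (a ω * (s.1 - s₀.1) + b ω * (s.2 - s₀.2)) := by
      rw [← Complex.exp_add]; ring_nf
    have he2 : ‖Complex.exp (a ω * (s.1 - s₀.1) + b ω * (s.2 - s₀.2))‖ ≤
        Real.exp (‖a ω‖ * δ / 4) * Real.exp (‖b ω‖ * δ / 4) := by
      rw [← Real.exp_add]
      refine (Complex.norm_exp_le_exp_norm _).trans (Real.exp_le_exp.2 ?_)
      refine (norm_add_le _ _).trans ?_
      rw [norm_mul, norm_mul]
      nlinarith [mul_le_mul_of_nonneg_left hs1 (norm_nonneg (a ω)),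
        mul_le_mul_of_nonneg_left hs2 (norm_nonneg (b ω))]
    have hx : ‖a ω‖ + ‖b ω‖ ≤ 4 / δ * (Real.exp (‖a ω‖ * δ / 4) * Real.exp (‖b ω‖ * δ / 4)) := by
      rw [← Real.exp_add, div_mul_eq_mul_div, le_div_iff₀ hδ]
      have := Real.add_one_le_exp (‖a ω‖ * δ / 4 + ‖b ω‖ * δ / 4)
      nlinarith
    have hsum : (∑ d₁ ∈ D, ∑ d₂ ∈ D,
        ‖Complex.exp (a ω * (s₀.1 + δ * d₁) + b ω * (s₀.2 + δ * d₂)) * w ω‖) =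
        ‖Complex.exp (a ω * s₀.1 + b ω * s₀.2) * w ω‖ *
          ((∑ d ∈ D, ‖Complex.exp (a ω * (δ * d))‖) *
            ∑ d ∈ D, ‖Complex.exp (b ω * (δ * d))‖) := by
      rw [Finset.sum_mul_sum, Finset.mul_sum]
      refine Finset.sum_congr rfl fun d₁ _ => ?_
      rw [Finset.mul_sum]
      refine Finset.sum_congr rfl fun d₂ _ => ?_
      rw [← norm_mul, ← norm_mul]
      congr 1
      rw [mul_right_comm, ← Complex.exp_add, ← Complex.exp_add]
      ring_nf
    have hA := exp_half_mul_norm_le (a ω) hδ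
    have hB := exp_half_mul_norm_le (b ω) hδ
    have hA' : Real.exp (‖a ω‖ * δ / 4) * Real.exp (‖a ω‖ * δ / 4) = Real.exp (‖a ω‖ * δ / 2) := by
      rw [← Real.exp_add]; ring_nf
    have hB' : Real.exp (‖b ω‖ * δ / 4) * Real.exp (‖b ω‖ * δ / 4) = Real.exp (‖b ω‖ * δ / 2) := by
      rw [← Real.exp_add]; ring_nf
    calc ‖F' s ω‖ ≤ ‖Complex.exp (a ω * s.1 + b ω * s.2) * w ω‖ * (‖a ω‖ + ‖b ω‖) := by
          rw [norm_smul]; gcongr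
      _ = ‖Complex.exp (a ω * s₀.1 + b ω * s₀.2) * w ω‖ *
          ‖Complex.exp (a ω * (s.1 - s₀.1) + b ω * (s.2 - s₀.2))‖ * (‖a ω‖ + ‖b ω‖) := by
          rw [he, norm_mul, norm_mul, norm_mul]; ring
      _ ≤ ‖Complex.exp (a ω * s₀.1 + b ω * s₀.2) * w ω‖ *
          (Real.exp (‖a ω‖ * δ / 4) * Real.exp (‖b ω‖ * δ / 4)) *
          (4 / δ * (Real.exp (‖a ω‖ * δ / 4) * Real.exp (‖b ω‖ * δ / 4))) := by gcongr
      _ = 4 / δ * (‖Complex.exp (a ω * s₀.1 + b ω * s₀.2) * w ω‖ *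
          (Real.exp (‖a ω‖ * δ / 2) * Real.exp (‖b ω‖ * δ / 2))) := by
          rw [← hA', ← hB']; ring
      _ ≤ _ := by rw [hsum]; gcongr
  have hmain := hasFDerivAt_integral_of_dominated_of_fderiv_le (μ := μ) (𝕜 := ℂ) (F' := F')
    (F := fun s ω => Complex.exp (a ω * s.1 + b ω * s.2) * w ω) (x₀ := s₀)
    (s := Metric.ball s₀ (δ / 4))
    (bound := fun ω => 4 / δ * ∑ d₁ ∈ D, ∑ d₂ ∈ D,
        ‖Complex.exp (a ω * (s₀.1 + δ * d₁) + b ω * (s₀.2 + δ * d₂)) * w ω‖)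
    (Metric.ball_mem_nhds _ (by positivity))
    (by filter_upwards [hU.mem_nhds hs₀] with s hs using (hint s hs).aestronglyMeasurable)
    (hint s₀ hs₀)
    ((hint s₀ hs₀).aestronglyMeasurable.smul
      ((ha.smul_const _).add (hb.smul_const _)))
    (Eventually.of_forall hbound)
    ((integrable_finsetSum _ fun d₁ h₁ => integrable_finsetSum _ fun d₂ h₂ =>
      (hint _ (hcorner d₁ h₁ d₂ h₂)).norm).const_mul _)
    (Eventually.of_forall fun ω s _ => hF' s ω)
  exact hmain.differentiableAt.differentiableWithinAt

/-- Treating a sum of integrals as one integral over a product with counting measure makes Fubini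
and the holomorphy theorem available for the sums over m and over the frequencies. -/
theorem integrable_count_prod {ι α E : Type*} [Countable ι] [MeasurableSpace ι]
    [MeasurableSingletonClass ι] [MeasurableSpace α] [NormedAddCommGroup E]
    {μ : Measure α} [SFinite μ] {f : ι → α → E}
    (hf : ∀ i, Integrable (f i) μ) (hs : Summable fun i => ∫ x, ‖f i x‖ ∂μ) :
    Integrable (fun p : ι × α => f p.1 p.2) (Measure.count.prod μ) := by
  have hm : AEStronglyMeasurable (fun p : ι × α => f p.1 p.2) (Measure.count.prod μ) := by
    rw [Measure.count, Measure.prod_sum_left, aestronglyMeasurable_sum_measure_iff]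
    intro i
    rw [Measure.dirac_prod, (measurableEmbedding_prodMk_left i).aestronglyMeasurable_map_iff]
    exact (hf i).aestronglyMeasurable
  rw [integrable_prod_iff hm]
  refine ⟨Eventually.of_forall hf, ?_⟩
  rw [integrable_count_iff]
  exact hs.norm

theorem integral_count_prod {ι α E : Type*} [Countable ι] [MeasurableSpace ι]
    [MeasurableSingletonClass ι] [MeasurableSpace α] [NormedAddCommGroup E] [NormedSpace ℝ E]
    [CompleteSpace E] {μ : Measure α} [SFinite μ] {f : ι × α → E}
    (hf : Integrable f (Measure.count.prod μ)) :
    ∫ p, f p ∂(Measure.count.prod μ) = ∑' i, ∫ x, f (i, x) ∂μ := by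
  rw [integral_prod _ hf, integral_countable hf.integral_prod_left]
  simp

end

/-! ### Partial fractions and Taylor remainders of 1/(e^x-1) -/

section

open MeasureTheory Filter Topology

/-- The `k`-th partial fraction contribution to `bernTail`. -/
noncomputable def bernTerm (p : ℕ) (x : ℝ) (k : ℕ) : ℝ :=
  (-1) ^ p * (x / (2 * Real.pi * (k + 1))) ^ (2 * p) *
    (2 * x / (x ^ 2 + (2 * Real.pi * (k + 1)) ^ 2))

/-- The remainder `1/(e^x-1) - 1/x + 1/2 - ∑_{i<p} β_i x^(2i+1)`, as a series. -/
noncomputable def bernTail (p : ℕ) (x : ℝ) : ℝ := ∑' k : ℕ, bernTerm p x k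

/-- The Taylor coefficient of `x^(2i+1)` in `1/(e^x-1) - 1/x + 1/2`. -/
noncomputable def bernCoeff (i : ℕ) : ℝ :=
  ∑' k : ℕ, (-1) ^ i * 2 / (2 * Real.pi * (k + 1)) ^ (2 * i + 2)

theorem summable_inv_succ_sq : Summable fun k : ℕ => 1 / ((k : ℝ) + 1) ^ 2 := by
  exact_mod_cast (summable_nat_add_iff 1).2 (Real.summable_one_div_nat_pow.2 one_lt_two)

theorem two_pi_succ_pos (k : ℕ) : 0 < 2 * Real.pi * ((k : ℝ) + 1) := by positivity

theorem abs_bernTerm_eq (p : ℕ) (x : ℝ) (k : ℕ) : |bernTerm p x k| =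
    2 * |x| ^ (2 * p + 1) / (2 * Real.pi * (k + 1)) ^ (2 * p) /
      (x ^ 2 + (2 * Real.pi * (k + 1)) ^ 2) := by
  have h := two_pi_succ_pos k
  rw [bernTerm, abs_mul, abs_mul, abs_pow, abs_neg, abs_one, one_pow, one_mul, abs_pow, abs_div,
    abs_div, abs_of_pos h, abs_mul, abs_two,
    abs_of_pos (by positivity : 0 < x ^ 2 + (2 * Real.pi * ((k : ℝ) + 1)) ^ 2), div_pow, pow_succ]
  field_simp
  ring

/-- Discarding x² in the denominator gives the right order at 0. The companion
`abs_bernTerm_le_of_one_le` discards the other summand and is adapted to infinity. -/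
theorem abs_bernTerm_le (p : ℕ) (x : ℝ) (k : ℕ) : |bernTerm p x k| ≤
    2 * |x| ^ (2 * p + 1) / (2 * Real.pi) ^ (2 * p + 2) * (1 / ((k : ℝ) + 1) ^ 2) := by
  have h := two_pi_succ_pos k
  rw [abs_bernTerm_eq]
  have h1 : (2 * Real.pi) ^ (2 * p + 2) * ((k : ℝ) + 1) ^ 2 ≤
      (2 * Real.pi * (k + 1)) ^ (2 * p) * (x ^ 2 + (2 * Real.pi * (k + 1)) ^ 2) := by
    have : (1 : ℝ) ≤ (k + 1) ^ (2 * p) := one_le_pow₀ (by linarith [Nat.cast_nonneg (α := ℝ) k])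
    calc (2 * Real.pi) ^ (2 * p + 2) * ((k : ℝ) + 1) ^ 2
        = (2 * Real.pi) ^ (2 * p) * 1 * (2 * Real.pi * (k + 1)) ^ 2 := by ring
      _ ≤ (2 * Real.pi) ^ (2 * p) * (k + 1) ^ (2 * p) *
          (x ^ 2 + (2 * Real.pi * (k + 1)) ^ 2) := by gcongr; nlinarith [sq_nonneg x]
      _ = _ := by rw [← mul_pow]
  calc _ = 2 * |x| ^ (2 * p + 1) /
        ((2 * Real.pi * (k + 1)) ^ (2 * p) * (x ^ 2 + (2 * Real.pi * (k + 1)) ^ 2)) := by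
        rw [div_div]
    _ ≤ 2 * |x| ^ (2 * p + 1) / ((2 * Real.pi) ^ (2 * p + 2) * ((k : ℝ) + 1) ^ 2) := by gcongr
    _ = _ := by rw [mul_one_div, div_div]

theorem summable_bernTerm (p : ℕ) (x : ℝ) : Summable fun k => bernTerm p x k :=
  Summable.of_norm_bounded (summable_inv_succ_sq.mul_left _) (abs_bernTerm_le p x)

/-- `∑ 1/k²`. -/
noncomputable def zetaTwo : ℝ := ∑' k : ℕ, 1 / ((k : ℝ) + 1) ^ 2

theorem zetaTwo_nonneg : 0 ≤ zetaTwo := tsum_nonneg fun _ => by positivity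

theorem abs_bernTail_le (p : ℕ) (x : ℝ) :
    |bernTail p x| ≤ 2 * zetaTwo / (2 * Real.pi) ^ (2 * p + 2) * |x| ^ (2 * p + 1) := by
  rw [← Real.norm_eq_abs]
  refine (tsum_of_norm_bounded (f := fun k => bernTerm p x k)
    (summable_inv_succ_sq.mul_left _).hasSum (abs_bernTerm_le p x)).trans (le_of_eq ?_)
  rw [tsum_mul_left, zetaTwo]
  ring

theorem measurable_bernTail (p : ℕ) : Measurable (bernTail p) := by
  refine measurable_of_tendsto_metrizable (f := fun n x => ∑ k ∈ Finset.range n, bernTerm p x k)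
    (fun n => ?_) (tendsto_pi_nhds.2 fun x => (summable_bernTerm p x).hasSum.tendsto_sum_nat)
  refine Finset.measurable_sum _ fun k _ => ?_
  unfold bernTerm
  fun_prop

theorem bernCoeff_term_norm_le (i k : ℕ) :
    ‖(-1 : ℝ) ^ i * 2 / (2 * Real.pi * (k + 1)) ^ (2 * i + 2)‖ ≤
      2 * (1 / ((k : ℝ) + 1) ^ 2) := by
  have h := two_pi_succ_pos k
  rw [norm_div, norm_mul, norm_pow, norm_neg, norm_one, one_pow, one_mul, norm_pow,
    Real.norm_of_nonneg h.le, Real.norm_of_nonneg zero_le_two, mul_one_div]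
  have hk : (0 : ℝ) ≤ k := Nat.cast_nonneg k
  have h2 : (1 : ℝ) ≤ 2 * Real.pi := by linarith [Real.pi_gt_three]
  have h1 : (k : ℝ) + 1 ≤ 2 * Real.pi * (k + 1) := by nlinarith
  gcongr
  calc ((k : ℝ) + 1) ^ 2 ≤ (2 * Real.pi * (k + 1)) ^ 2 := by gcongr
    _ ≤ _ := pow_le_pow_right₀ (by linarith) (by omega)

theorem summable_bernCoeff_term (i : ℕ) :
    Summable fun k : ℕ => (-1 : ℝ) ^ i * 2 / (2 * Real.pi * (k + 1)) ^ (2 * i + 2) :=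
  Summable.of_norm_bounded (summable_inv_succ_sq.mul_left 2) (bernCoeff_term_norm_le i)

/-- Termwise, with u = (x/(2π(k+1)))², this is (-u)^p/(1+u) = (-u)^p + (-u)^(p+1)/(1+u). -/
theorem bernTail_succ (p : ℕ) (x : ℝ) :
    bernTail p x = bernCoeff p * x ^ (2 * p + 1) + bernTail (p + 1) x := by
  rw [bernTail, bernTail, bernCoeff, ← tsum_mul_right,
    ← ((summable_bernCoeff_term p).mul_right _).tsum_add (summable_bernTerm _ _)]
  refine tsum_congr fun k => ?_
  have h := two_pi_succ_pos k
  unfold bernTerm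
  have h2 : x ^ 2 + (2 * Real.pi * ((k : ℝ) + 1)) ^ 2 ≠ 0 := by positivity
  generalize 2 * Real.pi * ((k : ℝ) + 1) = c at *
  have hc := h.ne'
  rw [show 2 * (p + 1) = 2 * p + 2 by ring, div_pow, div_pow]
  field_simp
  ring

/-- The partial fraction series of π cot(πz) at z = ix/(2π), since cot(ix/2) = -i(e^x+1)/(e^x-1). -/
theorem exp_sub_one_inv_eq {x : ℝ} (hx : 0 < x) :
    1 / (Real.exp x - 1) = 1 / x - 1 / 2 + bernTail 0 x := by
  have hmem : Complex.I * x / (2 * Real.pi) ∈ Complex.integerComplement := by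
    rintro ⟨n, hn⟩
    have := congrArg Complex.im hn
    have hc : (Complex.I * x / (2 * Real.pi) : ℂ) = ((x / (2 * Real.pi) : ℝ) : ℂ) * Complex.I := by
      push_cast; ring
    rw [hc, Complex.mul_I_im, Complex.ofReal_re, Complex.intCast_im] at this
    have h0 : 0 < x / (2 * Real.pi) := by positivity
    exact h0.ne this
  have hser := cot_series_rep' hmem
  have hpi : (Real.pi : ℂ) ≠ 0 := by exact_mod_cast Real.pi_ne_zero
  have hx' : (x : ℂ) ≠ 0 := by exact_mod_cast hx.ne'
  have hterm : ∀ k : ℕ, 1 / (Complex.I * x / (2 * Real.pi) - (k + 1)) +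
      1 / (Complex.I * x / (2 * Real.pi) + (k + 1)) =
      (-(2 * Real.pi) * Complex.I) * ((bernTerm 0 x k : ℝ) : ℂ) := by
    intro k
    have h := two_pi_succ_pos k
    have h3 : ((x : ℂ) ^ 2 + (2 * Real.pi * ((k : ℂ) + 1)) ^ 2) ≠ 0 := by
      have : (x ^ 2 + (2 * Real.pi * ((k : ℝ) + 1)) ^ 2) ≠ 0 := by positivity
      exact_mod_cast this
    have hf : (Complex.I * x - 2 * Real.pi * (k + 1)) * (Complex.I * x + 2 * Real.pi * (k + 1)) =
        -((x : ℂ) ^ 2 + (2 * Real.pi * ((k : ℂ) + 1)) ^ 2) := by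
      ring_nf; simp
    have h1 : (Complex.I * x - 2 * Real.pi * (k + 1)) ≠ 0 := by
      intro h0; rw [h0, zero_mul, eq_comm, neg_eq_zero] at hf; exact h3 hf
    have h2 : (Complex.I * x + 2 * Real.pi * (k + 1)) ≠ 0 := by
      intro h0; rw [h0, mul_zero, eq_comm, neg_eq_zero] at hf; exact h3 hf
    have e1 : Complex.I * x / (2 * Real.pi) - (k + 1) =
        (Complex.I * x - 2 * Real.pi * (k + 1)) / (2 * Real.pi) := by field_simp
    have e2 : Complex.I * x / (2 * Real.pi) + (k + 1) =
        (Complex.I * x + 2 * Real.pi * (k + 1)) / (2 * Real.pi) := by field_simp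
    rw [e1, e2, one_div_div, one_div_div, div_add_div _ _ h1 h2, hf]
    simp only [bernTerm]
    push_cast
    field_simp
    ring
  rw [tsum_congr hterm, tsum_mul_left, ← Complex.ofReal_tsum] at hser
  change _ = _ * ((bernTail 0 x : ℝ) : ℂ) at hser
  have hE : (Complex.exp x - 1) ≠ 0 := by
    have : Real.exp x - 1 ≠ 0 := by
      have := Real.add_one_lt_exp hx.ne'
      linarith
    exact_mod_cast this
  have hcot : Complex.cot (Real.pi * (Complex.I * x / (2 * Real.pi))) =
      -Complex.I * (Complex.exp x + 1) / (Complex.exp x - 1) := by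
    have e : (Real.pi * (Complex.I * x / (2 * Real.pi)) : ℂ) = Complex.I * x / 2 := by
      field_simp
    rw [e, Complex.cot_eq_exp_ratio]
    have e2 : 2 * Complex.I * (Complex.I * x / 2) = -(x : ℂ) := by
      ring_nf; simp
    rw [e2, Complex.exp_neg]
    have hex := Complex.exp_ne_zero x
    have h1 : (1 - (Complex.exp x)⁻¹) ≠ 0 := by
      intro h; apply hE; field_simp at h; simpa using h
    rw [div_eq_div_iff (by simp [h1]) hE]
    field_simp
    ring_nf
    simp
    ring
  rw [hcot] at hser
  have hfin : (1 / (Complex.exp x - 1) : ℂ) = 1 / x - 1 / 2 + ((bernTail 0 x : ℝ) : ℂ) := by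
    have hI := Complex.I_ne_zero
    have hb : ((bernTail 0 x : ℝ) : ℂ) = (Real.pi * (-Complex.I * (Complex.exp x + 1) /
      (Complex.exp x - 1)) - 1 / (Complex.I * x / (2 * Real.pi))) /
        (-(2 * Real.pi) * Complex.I) := by
      rw [hser]; field_simp
    rw [hb]
    field_simp
    ring_nf
    simp
  apply Complex.ofReal_injective
  push_cast
  exact hfin

/-- The argument 2i+2 is written as (2i+1)+1 so that it coincides with the one in `oddZeta (2i+1)`.
-/
theorem ofReal_bernCoeff (i : ℕ) : ((bernCoeff i : ℝ) : ℂ) =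
    2 * (-1) ^ i * riemannZeta ((2 * i + 1 : ℕ) + 1) / (2 * Real.pi) ^ (2 * i + 2) := by
  rw [show (((2 * i + 1 : ℕ) : ℂ) + 1) = ((2 * i + 2 : ℕ) : ℂ) by push_cast; ring,
    zeta_eq_tsum_one_div_nat_add_one_cpow (by
      rw [Complex.natCast_re]; push_cast; linarith [Nat.cast_nonneg (α := ℝ) i]),
    bernCoeff, Complex.ofReal_tsum, ← tsum_mul_left, ← tsum_div_const]
  refine tsum_congr fun k => ?_
  rw [Complex.cpow_natCast]
  push_cast
  rw [mul_pow]
  field_simp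

end

/-! ### The transform φ ↦ ∑_m m^(-s₁) ∫ x^(s₂-1) e^(-mx) φ(x) dx -/

section

open MeasureTheory Filter Topology Set

/-- The integrand `(m+1)^(-s₁) x^(s₂-1) e^(-(m+1)x) φ(x)`, in exponential form. -/
noncomputable def lapTerm (φ : ℝ → ℝ) (s : ℂ × ℂ) (m : ℕ) (x : ℝ) : ℂ :=
  Complex.exp (-(Real.log (m + 1) : ℂ) * s.1 + (Real.log x : ℂ) * s.2) *
    ((Real.exp (-((m + 1) * x)) * φ x / x : ℝ) : ℂ)

/-- `∑_m m^(-s₁) ∫_0^∞ x^(s₂-1) e^(-mx) φ(x) dx`. -/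
noncomputable def lapInt (φ : ℝ → ℝ) (s : ℂ × ℂ) : ℂ :=
  ∫ q : ℕ × ℝ, lapTerm φ s q.1 q.2 ∂(Measure.count.prod (volume.restrict (Ioi 0)))

theorem lapTerm_eq (φ : ℝ → ℝ) (s : ℂ × ℂ) (m : ℕ) {x : ℝ} (hx : 0 < x) :
    lapTerm φ s m x = ((m : ℂ) + 1) ^ (-s.1) *
      ((x : ℂ) ^ (s.2 - 1) * Complex.exp (-(((m + 1 : ℝ) : ℂ) * x)) * φ x) := by
  have hx' : (x : ℂ) ≠ 0 := by exact_mod_cast hx.ne'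
  have hm : ((m : ℂ) + 1) ≠ 0 := Nat.cast_add_one_ne_zero m
  rw [lapTerm, Complex.exp_add, Complex.cpow_sub _ _ hx', Complex.cpow_one,
    Complex.cpow_def_of_ne_zero hx', Complex.cpow_def_of_ne_zero hm, ← Complex.ofReal_log hx.le,
    show ((m : ℂ) + 1) = ((m + 1 : ℝ) : ℂ) by push_cast; ring,
    ← Complex.ofReal_log (by positivity)]
  push_cast
  rw [show -((Real.log (m + 1) : ℝ) : ℂ) * s.1 = (Real.log (m + 1) : ℝ) * -s.1 by ring]
  field_simp

theorem norm_lapTerm (φ : ℝ → ℝ) (s : ℂ × ℂ) (m : ℕ) {x : ℝ} (hx : 0 < x) :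
    ‖lapTerm φ s m x‖ = ((m : ℝ) + 1) ^ (-s.1.re) *
      (x ^ (s.2.re - 1) * Real.exp (-((m + 1) * x)) * |φ x|) := by
  rw [lapTerm_eq φ s m hx, norm_mul, norm_mul, norm_mul, Complex.norm_cpow_eq_rpow_re_of_pos hx,
    show ((m : ℂ) + 1) = ((m + 1 : ℝ) : ℂ) by push_cast; ring,
    Complex.norm_cpow_eq_rpow_re_of_pos (by positivity), Complex.norm_exp, Complex.norm_real,
    Real.norm_eq_abs]
  congr 3
  norm_cast

theorem measurable_lapTerm {φ : ℝ → ℝ} (hφ : Measurable φ) (s : ℂ × ℂ) (m : ℕ) :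
    Measurable (lapTerm φ s m) := by
  unfold lapTerm
  fun_prop

theorem integrableOn_rpow_mul_exp {c : ℝ} (hc : 0 < c) (m : ℕ) :
    IntegrableOn (fun x : ℝ => x ^ (c - 1) * Real.exp (-((m + 1) * x))) (Ioi 0) := by
  have := integrableOn_rpow_mul_exp_neg_mul_rpow (p := 1) (s := c - 1) (b := m + 1)
    (by linarith) one_pos (by positivity)
  simpa only [Real.rpow_one, neg_mul] using this

theorem norm_lapTerm_le {φ : ℝ → ℝ} {C c : ℝ} (hb : ∀ x, 0 < x → |φ x| ≤ C * x ^ c)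
    (s : ℂ × ℂ) (m : ℕ) {x : ℝ} (hx : 0 < x) : ‖lapTerm φ s m x‖ ≤
      (C * ((m : ℝ) + 1) ^ (-s.1.re)) *
        (x ^ (s.2.re + c - 1) * Real.exp (-((m + 1) * x))) := by
  rw [norm_lapTerm φ s m hx]
  calc _ ≤ ((m : ℝ) + 1) ^ (-s.1.re) *
      (x ^ (s.2.re - 1) * Real.exp (-((m + 1) * x)) * (C * x ^ c)) := by
        gcongr
        exact hb x hx
    _ = _ := by
        rw [show s.2.re + c - 1 = s.2.re - 1 + c by ring, Real.rpow_add hx]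
        ring

theorem integrable_lapTerm {φ : ℝ → ℝ} (hφ : Measurable φ) {C c : ℝ}
    (hb : ∀ x, 0 < x → |φ x| ≤ C * x ^ c) {s : ℂ × ℂ} (h2 : 0 < s.2.re + c) (m : ℕ) :
    Integrable (lapTerm φ s m) (volume.restrict (Ioi 0)) := by
  refine ((integrableOn_rpow_mul_exp h2 m).const_mul (C * ((m : ℝ) + 1) ^ (-s.1.re))).mono'
    (measurable_lapTerm hφ s m).aestronglyMeasurable ?_
  filter_upwards [ae_restrict_mem measurableSet_Ioi] with x hx
  exact norm_lapTerm_le hb s m hx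

theorem integral_rpow_mul_exp {c : ℝ} (hc : 0 < c) (m : ℕ) :
    ∫ x : ℝ in Ioi 0, x ^ (c - 1) * Real.exp (-((m + 1) * x)) =
      Real.Gamma c * ((m : ℝ) + 1) ^ (-c) := by
  rw [Real.integral_rpow_mul_exp_neg_mul_Ioi hc (by positivity : (0 : ℝ) < m + 1), one_div,
    Real.inv_rpow (by positivity), Real.rpow_neg (by positivity), mul_comm]

theorem summable_succ_rpow {r : ℝ} (hr : 1 < r) : Summable fun m : ℕ => ((m : ℝ) + 1) ^ (-r) := by
  exact_mod_cast (summable_nat_add_iff 1).2 (Real.summable_nat_rpow.2 (by linarith : -r < -1))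

/-- If φ is O(x^c), the m-th absolute integral is at most a multiple of m^(-Re s₁ - Re s₂ - c). The
first inequality on `s` makes each integral converge at 0, the second makes the sum over m converge.
-/
theorem integrable_lapTerm_prod {φ : ℝ → ℝ} (hφ : Measurable φ) {C c : ℝ}
    (hb : ∀ x, 0 < x → |φ x| ≤ C * x ^ c) {s : ℂ × ℂ} (h2 : 0 < s.2.re + c)
    (h1 : 1 < (s.1 + s.2).re + c) :
    Integrable (fun q : ℕ × ℝ => lapTerm φ s q.1 q.2)
      (Measure.count.prod (volume.restrict (Ioi 0))) := by
  refine integrable_count_prod (integrable_lapTerm hφ hb h2) ?_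
  rw [Complex.add_re] at h1
  refine Summable.of_nonneg_of_le (fun _ => integral_nonneg fun _ => norm_nonneg _) (fun m => ?_)
    ((summable_succ_rpow h1).mul_left (C * Real.Gamma (s.2.re + c)))
  calc ∫ x in Ioi 0, ‖lapTerm φ s m x‖
      ≤ ∫ x in Ioi 0, (C * ((m : ℝ) + 1) ^ (-s.1.re)) *
        (x ^ (s.2.re + c - 1) * Real.exp (-((m + 1) * x))) := by
        refine setIntegral_mono_on (integrable_lapTerm hφ hb h2 m).norm
          ((integrableOn_rpow_mul_exp h2 m).const_mul _) measurableSet_Ioi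
          fun x hx => norm_lapTerm_le hb s m hx
    _ = _ := by
        rw [integral_const_mul, integral_rpow_mul_exp h2,
          show -(s.1.re + s.2.re + c) = -s.1.re + -(s.2.re + c) by ring,
          Real.rpow_add (by positivity)]
        ring

theorem lapInt_eq_tsum {φ : ℝ → ℝ} (hφ : Measurable φ) {C c : ℝ}
    (hb : ∀ x, 0 < x → |φ x| ≤ C * x ^ c) {s : ℂ × ℂ} (h2 : 0 < s.2.re + c)
    (h1 : 1 < (s.1 + s.2).re + c) :
    lapInt φ s = ∑' m : ℕ, ∫ x in Ioi (0 : ℝ), lapTerm φ s m x :=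
  integral_count_prod (integrable_lapTerm_prod hφ hb h2 h1)

/-- Integer exponents are allowed because the pole term 1/x of 1/(e^x-1) is treated like the Taylor
terms. -/
theorem lapInt_zpow {s : ℂ × ℂ} (c : ℤ) (h2 : 0 < s.2.re + c) (h1 : 1 < (s.1 + s.2).re + c) :
    lapInt (fun x => x ^ c) s = Complex.Gamma (s.2 + c) * riemannZeta (s.1 + s.2 + c) := by
  have hb : ∀ x : ℝ, 0 < x → |x ^ c| ≤ 1 * x ^ (c : ℝ) := fun x hx => by
    rw [abs_of_pos (zpow_pos hx c), one_mul, Real.rpow_intCast]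
  rw [lapInt_eq_tsum (by fun_prop) hb h2 h1, zeta_eq_tsum_one_div_nat_add_one_cpow (by
      rw [Complex.add_re, Complex.intCast_re]; exact h1),
    ← tsum_mul_left]
  refine tsum_congr fun m => ?_
  have hm : ((m : ℂ) + 1) ≠ 0 := Nat.cast_add_one_ne_zero m
  have : ∫ x in Ioi (0 : ℝ), lapTerm (fun x => x ^ c) s m x =
      ∫ x in Ioi (0 : ℝ), ((m : ℂ) + 1) ^ (-s.1) *
        ((x : ℂ) ^ (s.2 + c - 1) * Complex.exp (-(((m + 1 : ℝ) : ℂ) * x))) := by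
    refine setIntegral_congr_fun measurableSet_Ioi fun x hx => ?_
    have hx' : (x : ℂ) ≠ 0 := by exact_mod_cast (ne_of_gt hx)
    rw [lapTerm_eq _ s m hx, show s.2 + c - 1 = s.2 - 1 + c by ring, Complex.cpow_add _ _ hx',
      Complex.cpow_intCast]
    push_cast
    ring
  rw [this, integral_const_mul, Complex.integral_cpow_mul_exp_neg_mul_Ioi (by simpa using h2)
    (by positivity), show (((m + 1 : ℝ)) : ℂ) = (m : ℂ) + 1 by push_cast; ring, one_div,
    Complex.inv_cpow _ _ (by
      rw [← Nat.cast_add_one, Complex.natCast_arg]; exact Real.pi_ne_zero.symm),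
    show s.1 + s.2 + (c : ℂ) = s.1 + (s.2 + c) by ring, Complex.cpow_neg]
  generalize s.2 + (c : ℂ) = z
  rw [Complex.cpow_add _ _ hm]
  field_simp

theorem lapInt_congr {φ ψ : ℝ → ℝ} (h : ∀ x, 0 < x → φ x = ψ x) (s : ℂ × ℂ) :
    lapInt φ s = lapInt ψ s := by
  refine integral_congr_ae ?_
  have hae : ∀ᵐ q : ℕ × ℝ ∂(Measure.count.prod (volume.restrict (Ioi 0))), q.2 ∈ Ioi (0 : ℝ) :=
    Measure.quasiMeasurePreserving_snd.ae (ae_restrict_mem measurableSet_Ioi)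
  filter_upwards [hae] with q hq
  simp only [lapTerm, h q.2 hq]

theorem lapInt_add {φ ψ : ℝ → ℝ} {s : ℂ × ℂ}
    (hφ : Integrable (fun q : ℕ × ℝ => lapTerm φ s q.1 q.2)
      (Measure.count.prod (volume.restrict (Ioi 0))))
    (hψ : Integrable (fun q : ℕ × ℝ => lapTerm ψ s q.1 q.2)
      (Measure.count.prod (volume.restrict (Ioi 0)))) :
    lapInt (fun x => φ x + ψ x) s = lapInt φ s + lapInt ψ s := by
  rw [lapInt, lapInt, lapInt, ← integral_add hφ hψ]
  congr 1
  ext q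
  simp only [lapTerm]
  push_cast
  ring

theorem lapInt_const_mul (c : ℝ) (φ : ℝ → ℝ) (s : ℂ × ℂ) :
    lapInt (fun x => c * φ x) s = c * lapInt φ s := by
  rw [lapInt, lapInt, ← integral_const_mul]
  congr 1
  ext q
  simp only [lapTerm]
  push_cast
  ring

theorem differentiableOn_lapInt {φ : ℝ → ℝ} (hφ : Measurable φ) {C c : ℝ}
    (hb : ∀ x, 0 < x → |φ x| ≤ C * x ^ c) :
    DifferentiableOn ℂ (lapInt φ) {s : ℂ × ℂ | 0 < s.2.re + c ∧ 1 < (s.1 + s.2).re + c} := by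
  have hU : IsOpen {s : ℂ × ℂ | 0 < s.2.re + c ∧ 1 < (s.1 + s.2).re + c} :=
    (isOpen_lt (f := fun _ : ℂ × ℂ => (0 : ℝ)) continuous_const (by fun_prop)).inter
      (isOpen_lt (f := fun _ : ℂ × ℂ => (1 : ℝ)) continuous_const (by fun_prop))
  refine differentiableOn_integral_exp
    (a := fun q : ℕ × ℝ => -(Real.log (q.1 + 1) : ℂ)) (b := fun q => (Real.log q.2 : ℂ))
    (w := fun q => ((Real.exp (-((q.1 + 1) * q.2)) * φ q.2 / q.2 : ℝ) : ℂ))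
    ?_ ?_ hU fun s hs => integrable_lapTerm_prod hφ hb hs.1 hs.2
  · exact Measurable.aestronglyMeasurable (by fun_prop)
  · exact Measurable.aestronglyMeasurable (by fun_prop)

end

/-! ### Euler–Maclaurin continuation and existence of the double zeta function -/

section

open MeasureTheory Filter Topology Set

theorem abs_bernTail_le_rpow (p : ℕ) (x : ℝ) (hx : 0 < x) :
    |bernTail p x| ≤ 2 * zetaTwo / (2 * Real.pi) ^ (2 * p + 2) * x ^ ((2 * p + 1 : ℕ) : ℝ) := by
  have := abs_bernTail_le p x
  rw [abs_of_pos hx] at this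
  rwa [Real.rpow_natCast]

/-- Iterating 1/Γ(z) = z/Γ(z+1), which is an identity between entire functions, keeps the formula
valid at the poles of Γ, where both sides vanish. Positivity is needed only to cancel Γ(z+n). -/
theorem Gamma_inv_mul_Gamma_add (z : ℂ) (n : ℕ) (h : 0 < (z + n).re) :
    (Complex.Gamma z)⁻¹ * Complex.Gamma (z + n) = (ascPochhammer ℂ n).eval z := by
  have key : ∀ n : ℕ, (Complex.Gamma z)⁻¹ =
      (ascPochhammer ℂ n).eval z * (Complex.Gamma (z + n))⁻¹ := by
    intro n
    induction n with
    | zero => simp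
    | succ n ih =>
      rw [ih, ascPochhammer_succ_eval, Complex.one_div_Gamma_eq_self_mul_one_div_Gamma_add_one (z + n)]
      push_cast
      ring_nf
  rw [key n, mul_assoc, inv_mul_cancel₀ (Complex.Gamma_ne_zero_of_re_pos h), mul_one]

/-- The Euler–Maclaurin continuation of the double zeta series to the region
`Re s₂ > -(2p+1)`, `Re (s₁+s₂) > -2p`. -/
noncomputable def eulerMaclaurinZeta (p : ℕ) (s : ℂ × ℂ) : ℂ :=
  riemannZeta (s.1 + s.2 - 1) / (s.2 - 1) - riemannZeta (s.1 + s.2) / 2 +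
    ∑ i ∈ Finset.range p, bernCoeff i * (ascPochhammer ℂ (2 * i + 1)).eval s.2 *
      riemannZeta (s.1 + s.2 + (2 * i + 1 : ℕ)) +
    (Complex.Gamma s.2)⁻¹ * lapInt (bernTail p) s

/-- The region where `eulerMaclaurinZeta p` is defined. -/
def emRegion (p : ℕ) : Set (ℂ × ℂ) :=
  {s | 0 < s.2.re + ((2 * p + 1 : ℕ) : ℝ) ∧ 1 < (s.1 + s.2).re + ((2 * p + 1 : ℕ) : ℝ)}

theorem isOpen_emRegion (p : ℕ) : IsOpen (emRegion p) :=
  (isOpen_lt (f := fun _ : ℂ × ℂ => (0 : ℝ)) continuous_const (by fun_prop)).inter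
      (isOpen_lt (f := fun _ : ℂ × ℂ => (1 : ℝ)) continuous_const (by fun_prop))

theorem integrable_lapTerm_bernTail {p : ℕ} {s : ℂ × ℂ} (hs : s ∈ emRegion p) :
    Integrable (fun q : ℕ × ℝ => lapTerm (bernTail p) s q.1 q.2)
      (Measure.count.prod (volume.restrict (Ioi 0))) :=
  integrable_lapTerm_prod (measurable_bernTail p) (abs_bernTail_le_rpow p) hs.1 hs.2

theorem lapInt_bernTail_succ {p : ℕ} {s : ℂ × ℂ} (hs : s ∈ emRegion p) :
    lapInt (bernTail p) s = bernCoeff p * (Complex.Gamma (s.2 + (2 * p + 1 : ℕ)) *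
      riemannZeta (s.1 + s.2 + (2 * p + 1 : ℕ))) + lapInt (bernTail (p + 1)) s := by
  have hb : ∀ x : ℝ, 0 < x → |bernCoeff p * x ^ ((2 * p + 1 : ℕ) : ℤ)| ≤
      |bernCoeff p| * x ^ ((2 * p + 1 : ℕ) : ℝ) := fun x hx => by
    rw [abs_mul, Real.rpow_natCast, zpow_natCast, abs_of_pos (pow_pos hx _)]
  have h1 : Integrable (fun q : ℕ × ℝ => lapTerm (fun x => bernCoeff p * x ^ ((2 * p + 1 : ℕ) : ℤ)) s q.1 q.2)
      (Measure.count.prod (volume.restrict (Ioi 0))) :=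
    integrable_lapTerm_prod (by fun_prop) hb hs.1 hs.2
  have hs' : s ∈ emRegion (p + 1) := by
    obtain ⟨h1, h2⟩ := hs
    constructor <;> · push_cast at *; linarith
  rw [lapInt_congr (φ := bernTail p)
    (ψ := fun x => bernCoeff p * x ^ ((2 * p + 1 : ℕ) : ℤ) + bernTail (p + 1) x)
    (fun x _ => by rw [bernTail_succ, zpow_natCast]) s,
    lapInt_add h1 (integrable_lapTerm_bernTail hs'), lapInt_const_mul,
    lapInt_zpow _ (by exact_mod_cast hs.1) (by exact_mod_cast hs.2)]
  push_cast
  rfl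

theorem emRegion_mono {p q : ℕ} (h : p ≤ q) : emRegion p ⊆ emRegion q := by
  rintro s ⟨h1, h2⟩
  have : (p : ℝ) ≤ q := by exact_mod_cast h
  constructor <;> · push_cast at *; linarith

/-- The Taylor term split off from `bernTail p` has transform Γ(s₂+2p+1) ζ(s₁+s₂+2p+1), and division
by Γ(s₂) turns it into the next summand. -/
theorem eulerMaclaurinZeta_succ {p : ℕ} {s : ℂ × ℂ} (hs : s ∈ emRegion p) :
    eulerMaclaurinZeta p s = eulerMaclaurinZeta (p + 1) s := by
  rw [eulerMaclaurinZeta, eulerMaclaurinZeta, Finset.sum_range_succ, lapInt_bernTail_succ hs,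
    ← Gamma_inv_mul_Gamma_add s.2 (2 * p + 1) (by
      rw [Complex.add_re, Complex.natCast_re]; exact hs.1)]
  ring

theorem eulerMaclaurinZeta_eq {p q : ℕ} (h : p ≤ q) {s : ℂ × ℂ} (hs : s ∈ emRegion p) :
    eulerMaclaurinZeta p s = eulerMaclaurinZeta q s := by
  induction q, h using Nat.le_induction with
  | base => rfl
  | succ n hn ih => rw [ih, eulerMaclaurinZeta_succ (emRegion_mono hn hs)]

theorem differentiableOn_eulerMaclaurinZeta (p : ℕ) :
    DifferentiableOn ℂ (eulerMaclaurinZeta p) (emRegion p ∩ doubleZetaPolarSetᶜ) := by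
  rintro s ⟨hs, hp⟩
  simp only [doubleZetaPolarSet, mem_compl_iff, mem_ofPred_eq, not_or, not_exists] at hp
  obtain ⟨h2, h1, h0⟩ := hp
  have hz : ∀ c : ℂ, s.1 + s.2 + c ≠ 1 →
      DifferentiableAt ℂ (fun s : ℂ × ℂ => riemannZeta (s.1 + s.2 + c)) s := fun c hc =>
    DifferentiableAt.comp (g := riemannZeta) (f := fun s : ℂ × ℂ => s.1 + s.2 + c) s
      (differentiableAt_riemannZeta hc) (by fun_prop)
  have hL : DifferentiableAt ℂ (lapInt (bernTail p)) s :=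
    (differentiableOn_lapInt (measurable_bernTail p) (abs_bernTail_le_rpow p)).differentiableAt
      ((isOpen_emRegion p).mem_nhds hs)
  have hG : DifferentiableAt ℂ (fun s : ℂ × ℂ => (Complex.Gamma s.2)⁻¹) s :=
    DifferentiableAt.comp (g := fun z => (Complex.Gamma z)⁻¹) (f := fun s : ℂ × ℂ => s.2) s
      (Complex.differentiable_one_div_Gamma _) (by fun_prop)
  have hP : ∀ n : ℕ, DifferentiableAt ℂ (fun s : ℂ × ℂ => (ascPochhammer ℂ n).eval s.2) s :=
    fun n => DifferentiableAt.comp (g := fun z => (ascPochhammer ℂ n).eval z)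
      (f := fun s : ℂ × ℂ => s.2) s (Polynomial.differentiable _ _) (by fun_prop)
  refine DifferentiableAt.differentiableWithinAt ?_
  unfold eulerMaclaurinZeta
  have hA : DifferentiableAt ℂ
      (fun s : ℂ × ℂ => riemannZeta (s.1 + s.2 - 1) / (s.2 - 1)) s := by
    have hd : DifferentiableAt ℂ (fun s : ℂ × ℂ => s.2 - 1) s := by fun_prop
    have hi : DifferentiableAt ℂ (fun s : ℂ × ℂ => (s.2 - 1)⁻¹) s :=
      DifferentiableAt.comp (g := fun z : ℂ => z⁻¹) (f := fun s : ℂ × ℂ => s.2 - 1) s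
        (differentiableAt_inv (sub_ne_zero.2 h2)) hd
    simp only [div_eq_mul_inv]
    refine DifferentiableAt.fun_mul ?_ hi
    simp only [sub_eq_add_neg]
    refine hz _ fun h => h0 0 ?_
    push_cast
    linear_combination h
  have hB : DifferentiableAt ℂ (fun s : ℂ × ℂ => riemannZeta (s.1 + s.2) / 2) s := by
    have := hz 0 (by simpa using h1)
    simp only [add_zero] at this
    simpa only [div_eq_mul_inv] using this.mul_const (2⁻¹ : ℂ)
  refine DifferentiableAt.fun_add (DifferentiableAt.fun_add (DifferentiableAt.fun_sub hA hB)
    (DifferentiableAt.fun_sum fun i _ => ?_)) (hG.fun_mul hL)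
  -- The i-th zeta factor has its pole on s₁+s₂ = -2i, the polar line with k = i+1. The line k = 0
  -- belongs to the term with 1/(s₂-1).
  refine ((differentiableAt_const _).mul (hP _)).mul (hz _ fun h => h0 (i + 1) ?_)
  push_cast at h ⊢
  linear_combination h

/-- A level at which the Euler–Maclaurin continuation is defined at `s`. -/
noncomputable def emLevel (s : ℂ × ℂ) : ℕ := ⌈|s.2.re| + |(s.1 + s.2).re|⌉₊ + 1

theorem mem_emRegion_emLevel (s : ℂ × ℂ) : s ∈ emRegion (emLevel s) := by
  have h := Nat.le_ceil (|s.2.re| + |(s.1 + s.2).re|)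
  have h1 := neg_abs_le s.2.re
  have h2 := neg_abs_le (s.1 + s.2).re
  have h3 := abs_nonneg s.2.re
  have h4 := abs_nonneg (s.1 + s.2).re
  constructor <;> · rw [emLevel]; push_cast; linarith

theorem eulerMaclaurinZeta_emLevel {p : ℕ} {s : ℂ × ℂ} (hs : s ∈ emRegion p) :
    eulerMaclaurinZeta (emLevel s) s = eulerMaclaurinZeta p s := by
  rw [eulerMaclaurinZeta_eq (le_max_left _ p) (mem_emRegion_emLevel s),
    ← eulerMaclaurinZeta_eq (le_max_right _ p) hs]

/-- The exponent Re s₂ is split as (Re s₂-1-δ) + (1+δ). The larger index dominates both the smaller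
one and the gap; the first part is charged to the smaller index and the second to the gap, which
leaves a product of two convergent series. -/
theorem summable_double {s : ℂ × ℂ} (h2 : 1 < s.2.re) (h1 : 2 < (s.1 + s.2).re) :
    Summable fun q : ℕ × ℕ => ((q.1 : ℝ) + 1) ^ (-s.1.re) * ((q.1 : ℝ) + q.2 + 2) ^ (-s.2.re) := by
  rw [Complex.add_re] at h1
  obtain ⟨δ, hδ0, hδ⟩ := exists_between (lt_min (sub_pos.2 h2) (sub_pos.2 h1))
  rw [lt_min_iff] at hδ
  refine Summable.of_nonneg_of_le (fun _ => by positivity) (fun q => ?_)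
    ((summable_succ_rpow (r := s.1.re + (s.2.re - 1 - δ)) (by linarith)).mul_of_nonneg
      (summable_succ_rpow (r := 1 + δ) (by linarith)) (fun _ => by positivity)
      (fun _ => by positivity))
  have e1 : ((q.1 : ℝ) + 1) ^ (-(s.1.re + (s.2.re - 1 - δ))) =
      ((q.1 : ℝ) + 1) ^ (-s.1.re) * ((q.1 : ℝ) + 1) ^ (-(s.2.re - 1 - δ)) := by
    rw [← Real.rpow_add (by positivity)]; ring_nf
  have e2 : ((q.1 : ℝ) + q.2 + 2) ^ (-s.2.re) = ((q.1 : ℝ) + q.2 + 2) ^ (-(s.2.re - 1 - δ)) *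
      ((q.1 : ℝ) + q.2 + 2) ^ (-(1 + δ)) := by
    rw [← Real.rpow_add (by positivity)]; ring_nf
  rw [e1, e2, mul_assoc]
  have hq1 : (0 : ℝ) ≤ q.1 := Nat.cast_nonneg _
  have hq2 : (0 : ℝ) ≤ q.2 := Nat.cast_nonneg _
  gcongr ?_ * (?_ * ?_)
  · exact Real.rpow_le_rpow_of_nonpos (by positivity) (by linarith) (by linarith)
  · exact Real.rpow_le_rpow_of_nonpos (by positivity) (by linarith) (by linarith)

/-- For fixed m, expand 1/(e^x-1) as a geometric series in e^(-x) and integrate termwise; the n-th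
integral is Γ(s₂)(m+n+2)^(-s₂), up to the factor in s₁. -/
theorem hasSum_double {s : ℂ × ℂ} (h2 : 1 < s.2.re) (h1 : 2 < (s.1 + s.2).re) :
    HasSum (fun q : ℕ × ℕ => 1 / (((q.1 : ℂ) + 1) ^ s.1 * ((q.1 : ℂ) + q.2 + 2) ^ s.2))
      ((Complex.Gamma s.2)⁻¹ * lapInt (fun x => 1 / (Real.exp x - 1)) s) := by
  have hΓ : Complex.Gamma s.2 ≠ 0 := Complex.Gamma_ne_zero_of_re_pos (by linarith)
  have hsum : Summable fun q : ℕ × ℕ =>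
      1 / (((q.1 : ℂ) + 1) ^ s.1 * ((q.1 : ℂ) + q.2 + 2) ^ s.2) := by
    refine Summable.of_norm_bounded (summable_double h2 h1) fun q => le_of_eq ?_
    rw [norm_div, norm_mul, norm_one, show ((q.1 : ℂ) + 1) = ((q.1 + 1 : ℝ) : ℂ) by push_cast; ring,
      show ((q.1 : ℂ) + q.2 + 2) = ((q.1 + q.2 + 2 : ℝ) : ℂ) by push_cast; ring,
      Complex.norm_cpow_eq_rpow_re_of_pos (by positivity),
      Complex.norm_cpow_eq_rpow_re_of_pos (by positivity), Real.rpow_neg (by positivity),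
      Real.rpow_neg (by positivity), one_div, mul_inv]
  rw [hsum.hasSum_iff, hsum.tsum_prod]
  have hexp : ∀ x : ℝ, 0 < x → 0 < Real.exp x - 1 := fun x hx => by
    linarith [Real.add_one_lt_exp hx.ne']
  have hb : ∀ x : ℝ, 0 < x → |1 / (Real.exp x - 1)| ≤ 1 * x ^ (-1 : ℝ) := by
    intro x hx
    rw [abs_of_pos (one_div_pos.2 (hexp x hx)), one_mul, Real.rpow_neg_one, ← one_div]
    exact one_div_le_one_div_of_le hx (by linarith [Real.add_one_le_exp x])
  rw [lapInt_eq_tsum (by fun_prop) hb (by linarith) (by linarith), ← tsum_mul_left]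
  refine tsum_congr fun m => ?_
  have hm : ((m : ℂ) + 1) ≠ 0 := Nat.cast_add_one_ne_zero m
  have hF : ∀ n : ℕ, ∀ x : ℝ, 0 < x → lapTerm (fun x => Real.exp (-((n + 1) * x))) s m x =
      ((m : ℂ) + 1) ^ (-s.1) * ((x : ℂ) ^ (s.2 - 1) *
        Complex.exp (-(((m + n + 2 : ℝ) : ℂ) * x))) := by
    intro n x hx
    rw [lapTerm_eq _ _ _ hx, mul_assoc ((x : ℂ) ^ (s.2 - 1)), Complex.ofReal_exp, ← Complex.exp_add]
    push_cast
    ring_nf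
  have hval : ∀ n : ℕ, ∫ x in Ioi (0 : ℝ), lapTerm (fun x => Real.exp (-((n + 1) * x))) s m x =
      Complex.Gamma s.2 * (1 / (((m : ℂ) + 1) ^ s.1 * ((m : ℂ) + n + 2) ^ s.2)) := by
    intro n
    rw [setIntegral_congr_fun measurableSet_Ioi fun x hx => hF n x hx, integral_const_mul,
      Complex.integral_cpow_mul_exp_neg_mul_Ioi (by linarith) (by positivity),
      show (((m + n + 2 : ℝ)) : ℂ) = (m : ℂ) + n + 2 by push_cast; ring, one_div,
      Complex.inv_cpow _ _ (by
        rw [show (m : ℂ) + n + 2 = ((m + n + 2 : ℕ) : ℂ) by push_cast; ring, Complex.natCast_arg]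
        exact Real.pi_ne_zero.symm), Complex.cpow_neg]
    field_simp
  have hb1 : ∀ n : ℕ, ∀ x : ℝ, 0 < x → |Real.exp (-((n + 1) * x))| ≤ 1 * x ^ (0 : ℝ) := by
    intro n x hx
    rw [Real.abs_exp, Real.rpow_zero, mul_one, Real.exp_le_one_iff]
    have : (0 : ℝ) ≤ n := Nat.cast_nonneg n
    nlinarith
  have hnorm : ∀ n : ℕ, ∫ x in Ioi (0 : ℝ), ‖lapTerm (fun x => Real.exp (-((n + 1) * x))) s m x‖ =
      Real.Gamma s.2.re * (((m : ℝ) + 1) ^ (-s.1.re) * ((m : ℝ) + n + 2) ^ (-s.2.re)) := by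
    intro n
    have : ∀ x ∈ Ioi (0 : ℝ), ‖lapTerm (fun x => Real.exp (-((n + 1) * x))) s m x‖ =
        ((m : ℝ) + 1) ^ (-s.1.re) *
          (x ^ (s.2.re - 1) * Real.exp (-((((m + n + 1 : ℕ) : ℝ) + 1) * x))) := by
      intro x hx
      rw [norm_lapTerm _ _ _ hx, Real.abs_exp, mul_assoc (x ^ _), ← Real.exp_add]
      push_cast
      ring_nf
    rw [setIntegral_congr_fun measurableSet_Ioi this, integral_const_mul,
      integral_rpow_mul_exp (by linarith)]
    push_cast
    ring_nf
  have hS := hasSum_integral_of_summable_integral_norm (μ := volume.restrict (Ioi 0))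
    (F := fun n : ℕ => lapTerm (fun x => Real.exp (-((n + 1) * x))) s m)
    (fun n => integrable_lapTerm (by fun_prop) (hb1 n) (by linarith) m) (by
      simp only [hnorm]
      exact ((summable_double h2 h1).prod_factor m).mul_left _)
  have hS' := hS.tsum_eq
  simp only [hval] at hS'
  rw [tsum_mul_left] at hS'
  rw [eq_comm, inv_mul_eq_iff_eq_mul₀ hΓ, hS']
  refine setIntegral_congr_fun measurableSet_Ioi fun x hx => ?_
  have hx0 : 0 < x := hx
  have hgeom : HasSum (fun n : ℕ => Real.exp (-((n + 1) * x))) (1 / (Real.exp x - 1)) := by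
    have h := (hasSum_geometric_of_lt_one (Real.exp_pos (-x)).le (by
      rw [Real.exp_lt_one_iff]; linarith)).mul_left (Real.exp (-x))
    convert! h using 1
    · ext n
      rw [← Real.exp_nat_mul, ← Real.exp_add]
      ring_nf
    · have := hexp x hx
      rw [Real.exp_neg]
      field_simp
  have h3 := ((Complex.hasSum_ofReal.2 hgeom).mul_left (((m : ℂ) + 1) ^ (-s.1) *
    ((x : ℂ) ^ (s.2 - 1) * Complex.exp (-(((m + 1 : ℝ) : ℂ) * x))))).tsum_eq
  simp only [lapTerm_eq _ _ _ hx0, ← mul_assoc] at h3 ⊢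
  exact h3.symm

theorem lapInt_exp_sub_one {s : ℂ × ℂ} (h2 : 1 < s.2.re) (h1 : 2 < (s.1 + s.2).re) :
    (Complex.Gamma s.2)⁻¹ * lapInt (fun x => 1 / (Real.exp x - 1)) s = eulerMaclaurinZeta 0 s := by
  have hΓ : Complex.Gamma s.2 ≠ 0 := Complex.Gamma_ne_zero_of_re_pos (by linarith)
  have hI : ∀ c : ℤ, -1 ≤ c → Integrable (fun q : ℕ × ℝ => lapTerm (fun x => x ^ c) s q.1 q.2)
      (Measure.count.prod (volume.restrict (Ioi 0))) := by
    intro c hc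
    have hc' : (-1 : ℝ) ≤ c := by exact_mod_cast hc
    refine integrable_lapTerm_prod (C := 1) (c := c) (by fun_prop) (fun x hx => ?_) (by linarith)
      (by linarith)
    rw [abs_of_pos (zpow_pos hx c), one_mul, Real.rpow_intCast]
  have hI0 : Integrable (fun q : ℕ × ℝ => lapTerm (fun x => (-1 / 2) * x ^ (0 : ℤ)) s q.1 q.2)
      (Measure.count.prod (volume.restrict (Ioi 0))) := by
    refine integrable_lapTerm_prod (C := 1) (c := 0) (by fun_prop) (fun x hx => ?_) (by linarith)
      (by linarith)
    norm_num
  have hR : s ∈ emRegion 0 := by constructor <;> · push_cast; linarith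
  have hI1 : Integrable (fun q : ℕ × ℝ => lapTerm (fun x => x ^ (-1 : ℤ) + (-1 / 2) * x ^ (0 : ℤ))
      s q.1 q.2) (Measure.count.prod (volume.restrict (Ioi 0))) := by
    convert! (hI (-1) le_rfl).add hI0 using 1
    ext q
    simp only [lapTerm, Pi.add_apply]
    push_cast
    ring
  rw [lapInt_congr (ψ := fun x => (x ^ (-1 : ℤ) + (-1 / 2) * x ^ (0 : ℤ)) + bernTail 0 x)
    (fun x hx => by rw [exp_sub_one_inv_eq hx]; simp; ring) s,
    lapInt_add hI1 (integrable_lapTerm_bernTail hR), lapInt_add (hI _ le_rfl) hI0,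
    lapInt_const_mul, lapInt_zpow _ (by push_cast; linarith) (by push_cast; linarith),
    lapInt_zpow _ (by push_cast; linarith) (by push_cast; linarith), eulerMaclaurinZeta]
  have hs2 : s.2 - 1 ≠ 0 := by
    intro h
    rw [sub_eq_zero.1 h] at h2
    simp at h2
  have hg : Complex.Gamma s.2 = (s.2 - 1) * Complex.Gamma (s.2 - 1) := by
    rw [← Complex.Gamma_add_one _ hs2, sub_add_cancel]
  have hΓ' : Complex.Gamma (s.2 - 1) ≠ 0 := Complex.Gamma_ne_zero_of_re_pos (by simpa using h2)
  push_cast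
  rw [Finset.sum_range_zero, ← sub_eq_add_neg, ← sub_eq_add_neg]
  simp only [add_zero]
  rw [mul_add, mul_add]
  congr 1
  rw [show (Complex.Gamma s.2)⁻¹ * (-1 / 2 * (Complex.Gamma s.2 * riemannZeta (s.1 + s.2))) =
    -(riemannZeta (s.1 + s.2) / 2) by field_simp, hg]
  field_simp
  ring

/-- Pairs `0 < m₁ < m₂` as `(m + 1, m + n + 2)`. -/
def strictPairEquiv : ℕ × ℕ ≃ {m : ℕ × ℕ // 0 < m.1 ∧ m.1 < m.2} where
  toFun q := ⟨(q.1 + 1, q.1 + q.2 + 2), by simp⟩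
  invFun m := (m.1.1 - 1, m.1.2 - m.1.1 - 1)
  left_inv q := by
    obtain ⟨a, b⟩ := q
    simp only [Prod.mk.injEq]
    omega
  right_inv m := by
    obtain ⟨⟨a, b⟩, h1, h2⟩ := m
    simp only [Subtype.mk.injEq, Prod.mk.injEq] at *
    omega

/-- The level varies with the point, but agreement of the levels on overlaps makes the glued
function locally equal to one fixed level. -/
theorem isDoubleZeta_eulerMaclaurinZeta :
    IsDoubleZeta fun s => eulerMaclaurinZeta (emLevel s) s where
  differentiableOn := by
    intro s hs
    have h : DifferentiableAt ℂ (eulerMaclaurinZeta (emLevel s)) s :=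
      (differentiableOn_eulerMaclaurinZeta _).differentiableAt
        (((isOpen_emRegion _).inter isClosed_doubleZetaPolarSet.isOpen_compl).mem_nhds
          ⟨mem_emRegion_emLevel s, hs⟩)
    refine (h.congr_of_eventuallyEq ?_).differentiableWithinAt
    filter_upwards [(isOpen_emRegion _).mem_nhds (mem_emRegion_emLevel s)] with t ht
    exact eulerMaclaurinZeta_emLevel ht
  hasSum := by
    intro s h2 h1
    have hR : s ∈ emRegion 0 := by constructor <;> · push_cast; linarith
    rw [← strictPairEquiv.hasSum_iff, eulerMaclaurinZeta_emLevel hR, ← lapInt_exp_sub_one h2 h1]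
    convert! hasSum_double h2 h1 using 1
    ext q
    simp [strictPairEquiv]

theorem isDoubleZeta_doubleZeta : IsDoubleZeta fun s => doubleZeta s.1 s.2 :=
  Classical.epsilon_spec (p := IsDoubleZeta) ⟨_, isDoubleZeta_eulerMaclaurinZeta⟩

theorem doubleZeta_eq_eulerMaclaurinZeta {p : ℕ} {s : ℂ × ℂ} (hs : s ∈ emRegion p)
    (h : s ∉ doubleZetaPolarSet) : doubleZeta s.1 s.2 = eulerMaclaurinZeta p s := by
  rw [← eulerMaclaurinZeta_emLevel hs]
  exact isDoubleZeta_doubleZeta.eqOn isDoubleZeta_eulerMaclaurinZeta h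

end

/-! ### Lipschitz's formula by Poisson summation -/

section

open MeasureTheory Filter Topology Set
open scoped FourierTransform

/-- The formula is known for real r > 0. Both sides are holomorphic on the right half-plane and
agree at the points 1+1/(n+1), which accumulate at 1. -/
theorem integral_cpow_mul_exp_neg_mul_complex {a r : ℂ} (ha : 0 < a.re) (hr : 0 < r.re) :
    ∫ t : ℝ in Ioi 0, (t : ℂ) ^ (a - 1) * Complex.exp (-(r * t)) = Complex.Gamma a * r ^ (-a) := by
  have hU : IsOpen {r : ℂ | 0 < r.re} := isOpen_lt continuous_const Complex.continuous_re
  have hint : ∀ r : ℂ, 0 < r.re →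
      IntegrableOn (fun t : ℝ => (t : ℂ) ^ (a - 1) * Complex.exp (-(r * t))) (Ioi 0) := by
    intro r hr
    have h := integrableOn_rpow_mul_exp_neg_mul_rpow (p := 1) (s := a.re - 1) (b := r.re)
      (by linarith) one_pos hr
    refine h.mono' ?_ ?_
    · refine ContinuousOn.aestronglyMeasurable (fun t ht => ?_) measurableSet_Ioi
      have ht0 : 0 < t := ht
      refine ContinuousAt.continuousWithinAt (ContinuousAt.mul ?_ (by fun_prop))
      exact Complex.continuousAt_ofReal_cpow_const _ _ (Or.inr ht0.ne')
    · filter_upwards [ae_restrict_mem measurableSet_Ioi] with t ht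
      rw [norm_mul, Complex.norm_cpow_eq_rpow_re_of_pos ht, Complex.norm_exp, Real.rpow_one]
      simp
  have hF : DifferentiableOn ℂ
      (fun r : ℂ => ∫ t : ℝ in Ioi 0, (t : ℂ) ^ (a - 1) * Complex.exp (-(r * t)))
      {r : ℂ | 0 < r.re} := by
    have h := differentiableOn_integral_exp (μ := volume.restrict (Ioi (0 : ℝ)))
      (a := fun t => -(t : ℂ)) (b := fun _ => 0) (w := fun t => (t : ℂ) ^ (a - 1))
      (Measurable.aestronglyMeasurable (by fun_prop)) (Measurable.aestronglyMeasurable (by fun_prop))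
      (U := {s : ℂ × ℂ | 0 < s.1.re})
      (isOpen_lt (f := fun _ : ℂ × ℂ => (0 : ℝ)) continuous_const (by fun_prop)) (by
        intro s hs
        refine (hint s.1 hs).congr (Eventually.of_forall fun t => ?_)
        simp only [zero_mul, add_zero]
        rw [mul_comm]
        ring_nf)
    have h2 := h.comp (f := fun r : ℂ => (r, (0 : ℂ))) (s := {r : ℂ | 0 < r.re})
      (DifferentiableOn.prodMk differentiableOn_id (differentiableOn_const _)) (fun r hr => hr)
    refine h2.congr fun r _ => ?_
    simp only [Function.comp]
    refine integral_congr_ae (Eventually.of_forall fun t => ?_)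
    simp only [mul_zero, add_zero]
    rw [mul_comm]
    ring_nf
  have hG : DifferentiableOn ℂ (fun r : ℂ => Complex.Gamma a * r ^ (-a)) {r : ℂ | 0 < r.re} := by
    intro r hr
    refine DifferentiableAt.differentiableWithinAt ?_
    refine (differentiableAt_const _).mul ?_
    exact (differentiableAt_id).cpow_const (Or.inl hr)
  have hconn : IsPreconnected {r : ℂ | 0 < r.re} := (convex_halfSpace_re_gt 0).isPreconnected
  have hfreq : ∃ᶠ r in 𝓝[≠] (1 : ℂ),
      (fun r : ℂ => ∫ t : ℝ in Ioi 0, (t : ℂ) ^ (a - 1) * Complex.exp (-(r * t))) r =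
        (fun r : ℂ => Complex.Gamma a * r ^ (-a)) r := by
    have htend : Tendsto (fun n : ℕ => (1 : ℂ) + 1 / ((n : ℂ) + 1)) atTop (𝓝[≠] 1) := by
      refine tendsto_nhdsWithin_iff.2 ⟨?_, Eventually.of_forall fun n => ?_⟩
      · simpa using (tendsto_one_div_add_atTop_nhds_zero_nat (𝕜 := ℂ)).const_add 1
      · have : ((n : ℂ) + 1) ≠ 0 := Nat.cast_add_one_ne_zero n
        simp [this]
    refine htend.frequently (Eventually.frequently (Eventually.of_forall fun n => ?_))
    have hpos : (0 : ℝ) < 1 + 1 / ((n : ℝ) + 1) := by positivity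
    have e : (1 : ℂ) + 1 / ((n : ℂ) + 1) = ((1 + 1 / ((n : ℝ) + 1) : ℝ) : ℂ) := by push_cast; ring
    simp only [e]
    rw [Complex.integral_cpow_mul_exp_neg_mul_Ioi ha hpos, mul_comm, one_div, Complex.cpow_neg,
      Complex.inv_cpow _ _ (by
        rw [Complex.arg_ofReal_of_nonneg hpos.le]; exact Real.pi_ne_zero.symm)]
  exact (hF.analyticOnNhd hU).eqOn_of_preconnected_of_frequently_eq (hG.analyticOnNhd hU) hconn
    (z₀ := 1) (by simp) hfreq hr

theorem norm_cpow_le_exp_pi (z w : ℂ) (hz : z ≠ 0) :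
    ‖z ^ w‖ ≤ ‖z‖ ^ w.re * Real.exp (Real.pi * |w.im|) := by
  rw [Complex.norm_cpow_of_ne_zero hz, div_eq_mul_inv, ← Real.exp_neg]
  gcongr
  calc -(z.arg * w.im) ≤ |z.arg * w.im| := neg_le_abs _
    _ = |z.arg| * |w.im| := abs_mul _ _
    _ ≤ _ := by gcongr; exact Complex.abs_arg_le_pi z

theorem abs_two_pi_mul_le_norm (x : ℝ) (t : ℝ) :
    2 * Real.pi * |t| ≤ ‖(x : ℂ) + 2 * Real.pi * Complex.I * t‖ := by
  have h := Complex.abs_im_le_norm ((x : ℂ) + 2 * Real.pi * Complex.I * t)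
  simp at h
  rwa [abs_of_pos Real.pi_pos] at h

theorem add_two_pi_I_ne_zero {x : ℝ} (hx : 0 < x) (t : ℝ) :
    (x : ℂ) + 2 * Real.pi * Complex.I * t ≠ 0 := by
  intro h
  have := congrArg Complex.re h
  simp at this
  linarith

/-- The function to which Poisson summation is applied. -/
noncomputable def lipschitzFun (a : ℂ) (x t : ℝ) : ℂ :=
  ((max t 0 : ℝ) : ℂ) ^ (a - 1) * Complex.exp (-(x * t))

theorem lipschitzFun_of_nonpos {a : ℂ} (ha : 1 < a.re) (x : ℝ) {t : ℝ} (ht : t ≤ 0) :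
    lipschitzFun a x t = 0 := by
  have : a - 1 ≠ 0 := by
    intro h
    rw [sub_eq_zero.1 h] at ha
    simp at ha
  simp [lipschitzFun, max_eq_right ht, this]

theorem lipschitzFun_of_pos (a : ℂ) (x : ℝ) {t : ℝ} (ht : 0 < t) :
    lipschitzFun a x t = (t : ℂ) ^ (a - 1) * Complex.exp (-(x * t)) := by
  rw [lipschitzFun, max_eq_left ht.le]

theorem fourier_lipschitzFun {a : ℂ} (ha : 1 < a.re) {x : ℝ} (hx : 0 < x) (ξ : ℝ) :
    𝓕 (lipschitzFun a x) ξ =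
      Complex.Gamma a * ((x : ℂ) + 2 * Real.pi * Complex.I * ξ) ^ (-a) := by
  rw [Real.fourier_eq', ← integral_cpow_mul_exp_neg_mul_complex (by linarith) (by simpa using hx),
    ← integral_indicator measurableSet_Ioi]
  congr 1
  ext t
  by_cases ht : 0 < t
  · rw [indicator_of_mem (by exact ht), lipschitzFun_of_pos a x ht, smul_eq_mul, mul_left_comm,
      ← Complex.exp_add]
    congr 2
    simp
    ring
  · rw [indicator_of_notMem (by exact ht), lipschitzFun_of_nonpos ha x (not_lt.1 ht), smul_zero]

/-- Lipschitz's formula. -/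
theorem lipschitz_formula {a : ℂ} (ha : 1 < a.re) {x : ℝ} (hx : 0 < x) :
    ∑' m : ℕ, ((m : ℂ) + 1) ^ (a - 1) * Complex.exp (-(((m + 1 : ℝ) : ℂ) * x)) =
      Complex.Gamma a * ∑' n : ℤ, ((x : ℂ) + 2 * Real.pi * Complex.I * (n : ℝ)) ^ (-a) := by
  -- Re a > 1 makes the truncated power continuous at 0; the `max` in the definition lets this
  -- follow by composition, without a case split.
  have hcont : Continuous (lipschitzFun a x) := by
    unfold lipschitzFun
    refine Continuous.mul ?_ (by fun_prop)
    exact (Complex.continuous_ofReal_cpow_const (by simpa using ha)).comp (by fun_prop)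
  have hdecay : lipschitzFun a x =O[cocompact ℝ] fun t => |t| ^ (-a.re) := by
    rw [cocompact_eq_atBot_atTop, Asymptotics.isBigO_sup]
    constructor
    · refine Asymptotics.IsBigO.of_bound 0 ?_
      filter_upwards [eventually_le_atBot 0] with t ht
      rw [lipschitzFun_of_nonpos ha x ht]
      simp
    · have h1 := (isLittleO_exp_neg_mul_rpow_atTop hx (-a.re - (a.re - 1))).isBigO
      have h2 := (Asymptotics.isBigO_refl (fun t : ℝ => t ^ (a.re - 1)) atTop).mul h1
      refine Asymptotics.IsBigO.trans (Asymptotics.IsBigO.of_bound 1 ?_) (h2.trans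
        (Asymptotics.IsBigO.of_bound 1 ?_))
      · filter_upwards [eventually_gt_atTop 0] with t ht
        rw [lipschitzFun_of_pos a x ht, norm_mul, Complex.norm_cpow_eq_rpow_re_of_pos ht,
          Complex.norm_exp, one_mul, norm_mul, Real.norm_of_nonneg (Real.rpow_nonneg ht.le _),
          Real.norm_of_nonneg (Real.exp_pos _).le]
        simp
      · filter_upwards [eventually_gt_atTop 0] with t ht
        rw [← Real.rpow_add ht, abs_of_pos ht, one_mul]
        ring_nf
        exact le_rfl
  have hF : 𝓕 (lipschitzFun a x) = fun ξ : ℝ =>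
      Complex.Gamma a * ((x : ℂ) + 2 * Real.pi * Complex.I * ξ) ^ (-a) :=
    funext (fourier_lipschitzFun ha hx)
  have hFdecay : 𝓕 (lipschitzFun a x) =O[cocompact ℝ] fun t => |t| ^ (-a.re) := by
    rw [hF]
    refine Asymptotics.IsBigO.of_bound (‖Complex.Gamma a‖ * Real.exp (Real.pi * |a.im|)) ?_
    have : ∀ᶠ t : ℝ in cocompact ℝ, t ≠ 0 :=
      (isCompact_singleton (x := (0 : ℝ))).compl_mem_cocompact
    filter_upwards [this] with t ht
    have h1 := norm_cpow_le_exp_pi _ (-a) (add_two_pi_I_ne_zero hx t)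
    rw [Complex.neg_re, Complex.neg_im, abs_neg] at h1
    have h2 := abs_two_pi_mul_le_norm x t
    have ht' : 0 < |t| := abs_pos.2 ht
    have h3 : |t| ≤ ‖(x : ℂ) + 2 * Real.pi * Complex.I * t‖ := by
      have := Real.pi_gt_three
      nlinarith
    have h4 := Real.rpow_le_rpow_of_nonpos ht' h3 (by linarith : -a.re ≤ 0)
    rw [norm_mul, Real.norm_of_nonneg (Real.rpow_nonneg (abs_nonneg t) _)]
    calc _ ≤ ‖Complex.Gamma a‖ * (|t| ^ (-a.re) * Real.exp (Real.pi * |a.im|)) := by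
          refine mul_le_mul_of_nonneg_left (h1.trans ?_) (norm_nonneg _)
          gcongr
      _ = _ := by ring
  have hP := Real.tsum_eq_tsum_fourier_of_rpow_decay hcont ha hdecay hFdecay 0
  rw [hF] at hP
  simp only [zero_add, QuotientAddGroup.mk_zero, fourier_eval_zero, mul_one] at hP
  rw [← tsum_mul_left, ← hP]
  have hinj : Function.Injective (fun m : ℕ => ((m : ℤ) + 1)) := fun m n h => by
    simpa using h
  -- The function vanishes at nonpositive integers, so the sum over ℤ reduces to the indices m+1.
  rw [← hinj.tsum_eq]
  · refine tsum_congr fun m => ?_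
    rw [lipschitzFun_of_pos a x (by push_cast; positivity)]
    push_cast
    ring_nf
  · intro n hn
    have hpos : 0 < n := by
      by_contra h
      exact hn (lipschitzFun_of_nonpos ha x (by exact_mod_cast not_lt.1 h))
    exact ⟨(n - 1).toNat, by simp only; omega⟩

end

/-! ### The Mellin transform of the Taylor remainder -/

section

open MeasureTheory Filter Topology Set

theorem integrableOn_rpow_min {f : ℝ → ℝ} {a b A B : ℝ} (ha : -1 < a) (hb : b < -1)
    (hm : AEStronglyMeasurable f (volume.restrict (Ioi 0)))
    (h0 : ∀ x, 0 < x → x ≤ 1 → |f x| ≤ A * x ^ a) (h1 : ∀ x, 1 < x → |f x| ≤ B * x ^ b) :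
    IntegrableOn f (Ioi 0) := by
  rw [← Ioc_union_Ioi_eq_Ioi (zero_le_one' ℝ)]
  refine IntegrableOn.union ?_ ?_
  · have hi : IntegrableOn (fun x : ℝ => A * x ^ a) (Ioc 0 1) := by
      refine Integrable.const_mul ?_ A
      exact (intervalIntegrable_iff_integrableOn_Ioc_of_le zero_le_one).1
        (intervalIntegral.intervalIntegrable_rpow' ha)
    refine hi.mono' (hm.mono_measure (Measure.restrict_mono Ioc_subset_Ioi_self le_rfl)) ?_
    filter_upwards [ae_restrict_mem measurableSet_Ioc] with x hx
    exact h0 x hx.1 hx.2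
  · have hi : IntegrableOn (fun x : ℝ => B * x ^ b) (Ioi 1) :=
      (integrableOn_Ioi_rpow_of_lt hb one_pos).const_mul B
    refine hi.mono' (hm.mono_measure (Measure.restrict_mono (Ioi_subset_Ioi zero_le_one) le_rfl)) ?_
    filter_upwards [ae_restrict_mem measurableSet_Ioi] with x hx
    exact h1 x hx

theorem integrableOn_rpow_div_one_add_sq {r : ℝ} (h0 : 0 < r) (h2 : r < 2) :
    IntegrableOn (fun x : ℝ => x ^ (r - 1) * (1 / (1 + x ^ 2))) (Ioi 0) := by
  refine integrableOn_rpow_min (a := r - 1) (b := r - 3) (A := 1) (B := 1) (by linarith)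
    (by linarith) (Measurable.aestronglyMeasurable (by fun_prop)) (fun x hx _ => ?_)
    (fun x hx => ?_)
  · rw [abs_of_nonneg (by positivity), one_mul]
    refine mul_le_of_le_one_right (by positivity) ?_
    rw [div_le_one (by positivity)]
    nlinarith
  · have hx0 : 0 < x := by linarith
    rw [abs_of_nonneg (by positivity), one_mul, show x ^ (r - 3) = x ^ (r - 1) * (1 / x ^ 2) by
      rw [show r - 3 = (r - 1) - (2 : ℕ) by push_cast; ring, Real.rpow_sub hx0 (r - 1),
        Real.rpow_natCast, div_eq_mul_one_div]]
    gcongr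
    linarith

/-- Insert 1/(1+x²) = ∫ e^(-(1+x²)t) dt and exchange the integrals. The Gaussian integral in x gives
Γ(w/2) t^(-w/2)/2, the t-integral gives Γ(1-w/2), and the reflection formula finishes. -/
theorem integral_cpow_div_one_add_sq {w : ℂ} (h0 : 0 < w.re) (h2 : w.re < 2) :
    ∫ x : ℝ in Ioi 0, (x : ℂ) ^ (w - 1) * ((1 / (1 + x ^ 2) : ℝ) : ℂ) =
      Real.pi / (2 * Complex.sin (Real.pi * w / 2)) := by
  have hre : (w / 2).re = w.re / 2 := by simp
  have hexp : ∀ x : ℝ, ∫ t : ℝ in Ioi 0, Real.exp (-((1 + x ^ 2) * t)) = 1 / (1 + x ^ 2) := by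
    intro x
    have := Real.integral_rpow_mul_exp_neg_mul_Ioi (a := 1) (r := 1 + x ^ 2) one_pos (by positivity)
    simpa using this
  have hexpI : ∀ x : ℝ, IntegrableOn (fun t : ℝ => Real.exp (-((1 + x ^ 2) * t))) (Ioi 0) := by
    intro x
    have := exp_neg_integrableOn_Ioi 0 (by positivity : 0 < 1 + x ^ 2)
    simpa only [neg_mul] using this
  have hF : Integrable (fun q : ℝ × ℝ => (q.1 : ℂ) ^ (w - 1) *
      ((Real.exp (-((1 + q.1 ^ 2) * q.2)) : ℝ) : ℂ))
      ((volume.restrict (Ioi 0)).prod (volume.restrict (Ioi 0))) := by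
    rw [integrable_prod_iff (Measurable.aestronglyMeasurable (by fun_prop))]
    refine ⟨Eventually.of_forall fun x => ((hexpI x).ofReal (𝕜 := ℂ)).const_mul ((x : ℂ) ^ (w - 1)), ?_⟩
    refine (integrableOn_rpow_div_one_add_sq h0 h2).congr ?_
    filter_upwards [ae_restrict_mem measurableSet_Ioi] with x hx
    simp only [norm_mul, Complex.norm_cpow_eq_rpow_re_of_pos hx, Complex.norm_real, Real.norm_eq_abs,
      Real.abs_exp]
    rw [integral_const_mul, hexp]
    simp
  have hswap := integral_integral_swap (f := fun x t : ℝ => (x : ℂ) ^ (w - 1) *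
      ((Real.exp (-((1 + x ^ 2) * t)) : ℝ) : ℂ)) hF
  have hL : ∀ x : ℝ, ∫ t in Ioi (0 : ℝ), (x : ℂ) ^ (w - 1) *
      ((Real.exp (-((1 + x ^ 2) * t)) : ℝ) : ℂ) =
      (x : ℂ) ^ (w - 1) * ((1 / (1 + x ^ 2) : ℝ) : ℂ) := by
    intro x
    rw [integral_const_mul, integral_complex_ofReal, hexp]
  have hgauss : ∀ t : ℝ, 0 < t → ∫ x in Ioi (0 : ℝ), (x : ℂ) ^ (w - 1) *
      ((Real.exp (-((1 + x ^ 2) * t)) : ℝ) : ℂ) =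
      Complex.Gamma (w / 2) / 2 * ((t : ℂ) ^ ((1 - w / 2) - 1) * Complex.exp (-((1 : ℝ) * t))) := by
    intro t ht
    have hsub := integral_comp_rpow_Ioi (fun u : ℝ => (u : ℂ) ^ (w / 2 - 1) *
      Complex.exp (-(t * u))) (p := 2) two_ne_zero
    rw [Complex.integral_cpow_mul_exp_neg_mul_Ioi (by rw [hre]; linarith) ht] at hsub
    have e1 : ∀ x ∈ Ioi (0 : ℝ), (|(2 : ℝ)| * x ^ ((2 : ℝ) - 1)) • ((((x ^ (2 : ℝ) : ℝ)) : ℂ) ^ (w / 2 - 1) *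
        Complex.exp (-(t * ((x ^ (2 : ℝ) : ℝ) : ℂ)))) = (2 * Complex.exp t) *
          ((x : ℂ) ^ (w - 1) * ((Real.exp (-((1 + x ^ 2) * t)) : ℝ) : ℂ)) := by
      intro x hx
      have hx0 : 0 < x := hx
      have hx' : (x : ℂ) ≠ 0 := by exact_mod_cast hx0.ne'
      rw [abs_two, show (2 : ℝ) - 1 = 1 by norm_num, Real.rpow_one,
        show (x ^ (2 : ℝ) : ℝ) = x ^ 2 by exact Real.rpow_natCast x 2, Complex.real_smul]
      have e2 : (((x ^ 2 : ℝ)) : ℂ) ^ (w / 2 - 1) = (x : ℂ) ^ (w - 1) / x := by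
        rw [sq, Complex.ofReal_mul, Complex.mul_cpow_ofReal_nonneg hx0.le hx0.le,
          ← Complex.cpow_add _ _ hx', show w / 2 - 1 + (w / 2 - 1) = w - 1 - 1 by ring,
          Complex.cpow_sub _ _ hx', Complex.cpow_one]
      rw [e2, Complex.ofReal_exp]
      have e3 : Complex.exp (-(t * ((x ^ 2 : ℝ) : ℂ))) =
          Complex.exp t * Complex.exp ((-((1 + x ^ 2) * t) : ℝ) : ℂ) := by
        rw [← Complex.exp_add]
        push_cast
        ring_nf
      rw [e3]
      push_cast
      field_simp
    rw [setIntegral_congr_fun measurableSet_Ioi e1, integral_const_mul] at hsub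
    have ht' : (t : ℂ) ≠ 0 := by exact_mod_cast ht.ne'
    have e4 : (1 / (t : ℂ)) ^ (w / 2) = (t : ℂ) ^ ((1 - w / 2) - 1) := by
      rw [one_div, Complex.inv_cpow _ _ (by
        rw [Complex.arg_ofReal_of_nonneg ht.le]; exact Real.pi_ne_zero.symm), ← Complex.cpow_neg]
      ring_nf
    rw [e4] at hsub
    have he := Complex.exp_ne_zero (t : ℂ)
    rw [Complex.ofReal_one, one_mul, Complex.exp_neg]
    generalize (t : ℂ) ^ ((1 - w / 2) - 1) = T at *
    field_simp
    linear_combination hsub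
  calc _ = ∫ x : ℝ in Ioi 0, ∫ t in Ioi (0 : ℝ), (x : ℂ) ^ (w - 1) *
      ((Real.exp (-((1 + x ^ 2) * t)) : ℝ) : ℂ) := by simp only [hL]
    _ = ∫ t : ℝ in Ioi 0, Complex.Gamma (w / 2) / 2 *
        ((t : ℂ) ^ ((1 - w / 2) - 1) * Complex.exp (-((1 : ℝ) * t))) := by
        rw [hswap]
        exact setIntegral_congr_fun measurableSet_Ioi fun t ht => hgauss t ht
    _ = Complex.Gamma (w / 2) * Complex.Gamma (1 - w / 2) / 2 := by
        rw [integral_const_mul, Complex.integral_cpow_mul_exp_neg_mul_Ioi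
          (by rw [Complex.sub_re, hre, Complex.one_re]; linarith) one_pos]
        simp
        ring
    _ = _ := by
        rw [Complex.Gamma_mul_Gamma_one_sub, mul_div_assoc, div_div, mul_comm (Complex.sin _)]

theorem abs_bernTerm_le_of_one_le {p : ℕ} (hp : 1 ≤ p) {x : ℝ} (hx : 0 < x) (k : ℕ) :
    |bernTerm p x k| ≤ (2 * x ^ ((2 * p - 1 : ℝ))) * (1 / ((k : ℝ) + 1) ^ 2) := by
  have h := two_pi_succ_pos k
  have hk : (0 : ℝ) ≤ k := Nat.cast_nonneg k
  have hpi := Real.pi_gt_three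
  have h1 : (k : ℝ) + 1 ≤ 2 * Real.pi * (k + 1) := by nlinarith
  have e : x ^ ((2 * p - 1 : ℝ)) = x ^ (2 * p + 1) / x ^ 2 := by
    rw [show (2 * p - 1 : ℝ) = ((2 * p + 1 : ℕ) : ℝ) - (2 : ℕ) by push_cast; ring,
      Real.rpow_sub hx, Real.rpow_natCast, Real.rpow_natCast]
  rw [abs_bernTerm_eq, e, abs_of_pos hx]
  calc 2 * x ^ (2 * p + 1) / (2 * Real.pi * (k + 1)) ^ (2 * p) /
        (x ^ 2 + (2 * Real.pi * (k + 1)) ^ 2)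
      ≤ 2 * x ^ (2 * p + 1) / (k + 1) ^ 2 / x ^ 2 := by
        gcongr
        · calc ((k : ℝ) + 1) ^ 2 ≤ (2 * Real.pi * (k + 1)) ^ 2 := by gcongr
            _ ≤ _ := pow_le_pow_right₀ (by linarith) (by omega)
        · nlinarith
    _ = _ := by ring

theorem abs_bernTail_le_of_one_le {p : ℕ} (hp : 1 ≤ p) {x : ℝ} (hx : 0 < x) :
    |bernTail p x| ≤ 2 * zetaTwo * x ^ ((2 * p - 1 : ℝ)) := by
  rw [← Real.norm_eq_abs]
  refine (tsum_of_norm_bounded (f := fun k => bernTerm p x k)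
    (summable_inv_succ_sq.mul_left _).hasSum (abs_bernTerm_le_of_one_le hp hx)).trans
      (le_of_eq ?_)
  rw [tsum_mul_left, zetaTwo]
  ring

/-- After x = 2π(k+1)y the factor y^(2p) shifts the Mellin variable by 2p. The sign (-1)^p then
cancels against sin(π(s+2p)/2) = (-1)^p sin(πs/2), so p affects the strip but not the value. -/
theorem integral_cpow_mul_bernTerm {p : ℕ} {s : ℂ} (h1 : -(2 * p : ℝ) < s.re)
    (h2 : s.re < 2 - 2 * p) (k : ℕ) :
    ∫ x : ℝ in Ioi 0, (x : ℂ) ^ (s - 2) * (bernTerm p x k : ℝ) =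
      (2 * Real.pi) ^ (s - 2) * Real.pi / Complex.sin (Real.pi / 2 * s) *
        (1 / ((k : ℂ) + 1) ^ (2 - s)) := by
  have h := two_pi_succ_pos k
  set c := 2 * Real.pi * ((k : ℝ) + 1) with hc
  have hc0 : (c : ℂ) ≠ 0 := by exact_mod_cast h.ne'
  have hsub := integral_comp_mul_left_Ioi (fun x : ℝ => (x : ℂ) ^ (s - 2) * (bernTerm p x k : ℝ)) 0 h
  rw [mul_zero] at hsub
  have e : ∀ y ∈ Ioi (0 : ℝ), ((c * y : ℝ) : ℂ) ^ (s - 2) * (bernTerm p (c * y) k : ℝ) =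
      (2 * (-1) ^ p * (c : ℂ) ^ (s - 2) / c) *
        ((y : ℂ) ^ ((s + 2 * p) - 1) * ((1 / (1 + y ^ 2) : ℝ) : ℂ)) := by
    intro y hy
    have hy0 : 0 < y := hy
    have hy' : (y : ℂ) ≠ 0 := by exact_mod_cast hy0.ne'
    have e1 : bernTerm p (c * y) k = (-1) ^ p * y ^ (2 * p) * (2 * y / c * (1 / (1 + y ^ 2))) := by
      have : (1 + y ^ 2) ≠ 0 := by positivity
      rw [bernTerm, ← hc, mul_div_cancel_left₀ _ h.ne',
        show (c * y) ^ 2 + c ^ 2 = c ^ 2 * (1 + y ^ 2) by ring]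
      field_simp
    have e2 : (y : ℂ) ^ ((s + 2 * p) - 1) = (y : ℂ) ^ (s - 2) * y ^ (2 * p) * y := by
      rw [show (s + 2 * p) - 1 = (s - 2) + ((2 * p : ℕ) : ℂ) + 1 by push_cast; ring,
        Complex.cpow_add _ _ hy', Complex.cpow_add _ _ hy', Complex.cpow_one, Complex.cpow_natCast]
    rw [e1, e2, Complex.ofReal_mul c y, Complex.mul_cpow_ofReal_nonneg h.le hy0.le]
    push_cast
    ring
  rw [setIntegral_congr_fun measurableSet_Ioi e, integral_const_mul,
    integral_cpow_div_one_add_sq (by simp; linarith) (by simp; linarith), eq_comm,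
    inv_smul_eq_iff₀ h.ne', Complex.real_smul] at hsub
  have hk : ((k : ℂ) + 1) ≠ 0 := Nat.cast_add_one_ne_zero k
  have e3 : (c : ℂ) ^ (s - 2) = (2 * Real.pi) ^ (s - 2) * (1 / ((k : ℂ) + 1) ^ (2 - s)) := by
    rw [hc, Complex.ofReal_mul, Complex.mul_cpow_ofReal_nonneg (by positivity) (by positivity),
      one_div, ← Complex.cpow_neg, neg_sub]
    push_cast
    rfl
  have e4 : Complex.sin (Real.pi * (s + 2 * p) / 2) = (-1) ^ p * Complex.sin (Real.pi / 2 * s) := by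
    rw [show (Real.pi * (s + 2 * p) / 2 : ℂ) = Real.pi / 2 * s + p * Real.pi by ring,
      Complex.sin_antiperiodic.add_nat_mul_eq]
  have e5 : ((-1 : ℂ) ^ p) * (-1) ^ p = 1 := by rw [← mul_pow]; simp
  have e6 : ((-1 : ℂ) ^ p) ≠ 0 := pow_ne_zero _ (by simp)
  rw [hsub, e3, e4]
  field_simp

theorem integrableOn_cpow_mul {φ : ℝ → ℝ} (hφ : Measurable φ) {A B : ℝ} {c d : ℝ}
    (hA : ∀ x, 0 < x → |φ x| ≤ A * x ^ c) (hB : ∀ x, 0 < x → |φ x| ≤ B * x ^ d) {s : ℂ}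
    (h1 : 1 < s.re + c) (h2 : s.re + d < 1) :
    IntegrableOn (fun x : ℝ => (x : ℂ) ^ (s - 2) * (φ x : ℂ)) (Ioi 0) := by
  have hm : Measurable (fun x : ℝ => (x : ℂ) ^ (s - 2) * (φ x : ℂ)) := by fun_prop
  have hre : (s - 2).re = s.re - 2 := by simp
  refine (integrable_norm_iff hm.aestronglyMeasurable).1 ?_
  refine integrableOn_rpow_min (a := s.re - 2 + c) (b := s.re - 2 + d)
    (by linarith) (by linarith) hm.norm.aestronglyMeasurable (A := A) (B := B) ?_ ?_
  · intro x hx _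
    rw [abs_norm, norm_mul, Complex.norm_cpow_eq_rpow_re_of_pos hx, Complex.norm_real,
      Real.rpow_add hx, hre, mul_left_comm]
    exact mul_le_mul_of_nonneg_left (hA x hx) (by positivity)
  · intro x hx
    have hx0 : 0 < x := by linarith
    rw [abs_norm, norm_mul, Complex.norm_cpow_eq_rpow_re_of_pos hx0, Complex.norm_real,
      Real.rpow_add hx0, hre, mul_left_comm]
    exact mul_le_mul_of_nonneg_left (hB x hx0) (by positivity)

theorem integrableOn_cpow_mul_bernTail {p : ℕ} (hp : 1 ≤ p) {s : ℂ} (h1 : -(2 * p : ℝ) < s.re)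
    (h2 : s.re < 2 - 2 * p) :
    IntegrableOn (fun x : ℝ => (x : ℂ) ^ (s - 2) * (bernTail p x : ℝ)) (Ioi 0) :=
  integrableOn_cpow_mul (measurable_bernTail p) (abs_bernTail_le_rpow p)
    (fun _ hx => abs_bernTail_le_of_one_le hp hx) (by push_cast; linarith) (by linarith)

theorem integral_cpow_mul_bernTail {p : ℕ} (hp : 1 ≤ p) {s : ℂ} (h1 : -(2 * p : ℝ) < s.re)
    (h2 : s.re < 2 - 2 * p) :
    ∫ x : ℝ in Ioi 0, (x : ℂ) ^ (s - 2) * (bernTail p x : ℝ) =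
      (2 * Real.pi) ^ (s - 2) * Real.pi / Complex.sin (Real.pi / 2 * s) * riemannZeta (2 - s) := by
  have hp' : (1 : ℝ) ≤ p := by exact_mod_cast hp
  rw [zeta_eq_tsum_one_div_nat_add_one_cpow (by simp; linarith), ← tsum_mul_left,
    ← tsum_congr (integral_cpow_mul_bernTerm h1 h2)]
  have hI : ∀ k, IntegrableOn (fun x : ℝ => (x : ℂ) ^ (s - 2) * (bernTerm p x k : ℝ)) (Ioi 0) := by
    intro k
    refine integrableOn_cpow_mul (c := ((2 * p + 1 : ℕ) : ℝ)) (d := 2 * p - 1)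
      (A := 2 / (2 * Real.pi) ^ (2 * p + 2) * (1 / ((k : ℝ) + 1) ^ 2))
      (B := 2 * (1 / ((k : ℝ) + 1) ^ 2)) (by unfold bernTerm; fun_prop) (fun x hx => ?_)
      (fun x hx => ?_) (by push_cast; linarith) (by linarith)
    · refine (abs_bernTerm_le p x k).trans (le_of_eq ?_)
      rw [abs_of_pos hx, Real.rpow_natCast]
      ring
    · refine (abs_bernTerm_le_of_one_le hp hx k).trans (le_of_eq ?_)
      ring
  -- `bernTerm p` has the constant sign (-1)^p on x > 0, so the integrals of the norms are given by
  -- the same formula at the real point Re s.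
  have hnorm : ∀ k, ((∫ x : ℝ in Ioi 0, ‖(x : ℂ) ^ (s - 2) * (bernTerm p x k : ℝ)‖ : ℝ) : ℂ) =
      (-1) ^ p * ((2 * Real.pi) ^ ((s.re : ℂ) - 2) * Real.pi /
        Complex.sin (Real.pi / 2 * (s.re : ℂ))) * (1 / ((k : ℂ) + 1) ^ (2 - (s.re : ℂ))) := by
    intro k
    rw [mul_assoc, ← integral_cpow_mul_bernTerm (p := p) (s := (s.re : ℂ)) (by simpa using h1)
      (by simpa using h2) k, ← integral_complex_ofReal, ← integral_const_mul]
    refine setIntegral_congr_fun measurableSet_Ioi fun x hx => ?_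
    have hx0 : 0 < x := hx
    have h := two_pi_succ_pos k
    have e : |bernTerm p x k| = (-1) ^ p * bernTerm p x k := by
      rw [bernTerm, ← mul_assoc, ← mul_assoc, ← mul_pow, neg_one_mul, neg_neg, one_pow, one_mul,
        abs_mul, abs_mul, abs_pow, abs_neg, abs_one, one_pow, one_mul, abs_of_nonneg, abs_of_nonneg]
      all_goals positivity
    simp only [norm_mul, Complex.norm_cpow_eq_rpow_re_of_pos hx0, Complex.norm_real,
      Real.norm_eq_abs, e]
    rw [show ((s.re : ℂ) - 2) = ((s.re - 2 : ℝ) : ℂ) by push_cast; ring,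
      ← Complex.ofReal_cpow hx0.le]
    push_cast
    simp
    ring
  have hsum : Summable fun k => ∫ x : ℝ in Ioi 0, ‖(x : ℂ) ^ (s - 2) * (bernTerm p x k : ℝ)‖ := by
    rw [← Complex.summable_ofReal]
    simp only [hnorm]
    refine Summable.mul_left _ ?_
    have := (Complex.summable_one_div_nat_cpow (p := 2 - (s.re : ℂ))).2 (by simp; linarith)
    exact_mod_cast (summable_nat_add_iff 1).2 this
  rw [(hasSum_integral_of_summable_integral_norm hI hsum).tsum_eq]
  refine integral_congr_ae (Eventually.of_forall fun x => ?_)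
  simp only [bernTail]
  rw [tsum_mul_left, Complex.ofReal_tsum]

end

/-! ### Decomposition of the remainder integral into frequencies -/

section

open MeasureTheory Filter Topology Set

theorem integral_count_prod_symm {ι α E : Type*} [Countable ι] [MeasurableSpace ι]
    [MeasurableSingletonClass ι] [MeasurableSpace α] [NormedAddCommGroup E] [NormedSpace ℝ E]
    [CompleteSpace E] {μ : Measure α} [SFinite μ] {f : ι × α → E}
    (hf : Integrable f (Measure.count.prod μ)) :
    ∫ p, f p ∂(Measure.count.prod μ) = ∫ x, ∑' i, f (i, x) ∂μ := by
  rw [integral_prod_symm _ hf]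
  refine integral_congr_ae ?_
  filter_upwards [hf.prod_left_ae] with x hx
  rw [integral_countable hx]
  simp

/-- The contribution of a nonzero frequency `n` in Lipschitz's formula. -/
noncomputable def freqTerm (p : ℕ) (s₁ s₂ : ℂ) (n : ℤ) (x : ℝ) : ℂ :=
  ((x : ℂ) + 2 * Real.pi * Complex.I * (n : ℝ)) ^ (s₁ - 1) *
    ((x : ℂ) ^ (s₂ - 1) * if n = 0 then 0 else (bernTail p x : ℂ))

/-- The sum of the contributions of the nonzero frequencies. -/
noncomputable def freqInt (p : ℕ) (s₁ s₂ : ℂ) : ℂ :=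
  ∫ q : ℤ × ℝ, freqTerm p s₁ s₂ q.1 q.2 ∂(Measure.count.prod (volume.restrict (Ioi 0)))

theorem le_norm_add_two_pi_I {x : ℝ} (hx : 0 < x) (t : ℝ) :
    x ≤ ‖(x : ℂ) + 2 * Real.pi * Complex.I * t‖ := by
  have h := Complex.abs_re_le_norm ((x : ℂ) + 2 * Real.pi * Complex.I * t)
  simp at h
  rwa [abs_of_pos hx] at h

/-- The base has modulus at least x, at least 2π|n| and at least 1. The decay is therefore shared: v
buys summability in n, u buys integrability in x at infinity without cost at 0. -/
theorem norm_cpow_freq_le {x : ℝ} (hx : 0 < x) {n : ℤ} (hn : n ≠ 0) {w : ℂ} {u v : ℝ}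
    (hu : 0 ≤ u) (hv : 0 ≤ v) (h : w.re = -(u + v)) :
    ‖((x : ℂ) + 2 * Real.pi * Complex.I * (n : ℝ)) ^ w‖ ≤
      Real.exp (Real.pi * |w.im|) * (2 * Real.pi * |(n : ℝ)|) ^ (-v) * min 1 (x ^ (-u)) := by
  set z := (x : ℂ) + 2 * Real.pi * Complex.I * (n : ℝ) with hz
  have hz0 : z ≠ 0 := add_two_pi_I_ne_zero hx _
  have h1 : x ≤ ‖z‖ := le_norm_add_two_pi_I hx _
  have h2 : 2 * Real.pi * |(n : ℝ)| ≤ ‖z‖ := abs_two_pi_mul_le_norm x _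
  have hn1 : (1 : ℝ) ≤ |(n : ℝ)| := by exact_mod_cast Int.one_le_abs hn
  have hpi := Real.pi_gt_three
  have hpos : 0 < 2 * Real.pi * |(n : ℝ)| := by positivity
  have hz1 : 1 ≤ ‖z‖ := by nlinarith
  have hzpos : 0 < ‖z‖ := by linarith
  refine (norm_cpow_le_exp_pi z w hz0).trans ?_
  rw [h, neg_add, Real.rpow_add hzpos, mul_comm, mul_assoc, mul_comm (‖z‖ ^ (-u))]
  gcongr ?_ * (?_ * ?_)
  · exact Real.rpow_le_rpow_of_nonpos hpos h2 (by linarith)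
  · refine le_min (Real.rpow_le_one_of_one_le_of_nonpos hz1 (by linarith)) ?_
    exact Real.rpow_le_rpow_of_nonpos hx h1 (by linarith)

theorem summable_two_pi_int_rpow {v : ℝ} (hv : 1 < v) :
    Summable fun n : ℤ => (2 * Real.pi * |(n : ℝ)|) ^ (-v) := by
  have : (fun n : ℤ => (2 * Real.pi * |(n : ℝ)|) ^ (-v)) =
      fun n : ℤ => (2 * Real.pi) ^ (-v) * |(n : ℝ)| ^ (-v) := by
    ext n
    rw [Real.mul_rpow (by positivity) (abs_nonneg _)]
  rw [this]
  exact (Real.summable_abs_int_rpow hv).mul_left _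

theorem norm_freqTerm_le (p : ℕ) {s₁ s₂ : ℂ} {u v : ℝ} (hu : 0 ≤ u) (hv : 0 ≤ v)
    (h : s₁.re - 1 = -(u + v)) (n : ℤ) {x : ℝ} (hx : 0 < x) :
    ‖freqTerm p s₁ s₂ n x‖ ≤ Real.exp (Real.pi * |s₁.im|) * (2 * Real.pi * |(n : ℝ)|) ^ (-v) *
      (min 1 (x ^ (-u)) * (x ^ (s₂.re - 1) * |bernTail p x|)) := by
  by_cases hn : n = 0
  · simp only [freqTerm, hn, if_true, mul_zero, norm_zero]
    positivity
  · rw [freqTerm, if_neg hn, norm_mul, norm_mul, Complex.norm_cpow_eq_rpow_re_of_pos hx,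
      Complex.norm_real, Real.norm_eq_abs, ← mul_assoc (Real.exp _ * _)]
    have := norm_cpow_freq_le hx hn (w := s₁ - 1) hu hv (by simpa using h)
    simp only [Complex.sub_im, Complex.one_im, sub_zero] at this
    rw [Complex.sub_re, Complex.one_re]
    gcongr

theorem measurable_freqTerm (p : ℕ) (s₁ s₂ : ℂ) (n : ℤ) : Measurable (freqTerm p s₁ s₂ n) := by
  have := measurable_bernTail p
  unfold freqTerm
  split_ifs <;> fun_prop

theorem integrableOn_freq_bound {p : ℕ} (hp : 1 ≤ p) {σ u : ℝ} (hσ : -(2 * p : ℝ) < σ)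
    (h : σ - u < 1 - 2 * p) :
    IntegrableOn (fun x : ℝ => min 1 (x ^ (-u)) * (x ^ (σ - 1) * |bernTail p x|)) (Ioi 0) := by
  have := measurable_bernTail p
  refine integrableOn_rpow_min (a := σ - 1 + ((2 * p + 1 : ℕ) : ℝ)) (b := -u + (σ - 1 + (2 * p - 1)))
    (A := 2 * zetaTwo / (2 * Real.pi) ^ (2 * p + 2)) (B := 2 * zetaTwo)
    (by push_cast; linarith) (by linarith) (Measurable.aestronglyMeasurable (by fun_prop)) ?_ ?_
  · intro x hx _
    rw [abs_of_nonneg (by positivity), Real.rpow_add hx]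
    calc _ ≤ 1 * (x ^ (σ - 1) * (2 * zetaTwo / (2 * Real.pi) ^ (2 * p + 2) *
          x ^ ((2 * p + 1 : ℕ) : ℝ))) := by
          gcongr
          · exact min_le_left _ _
          · exact abs_bernTail_le_rpow p x hx
      _ = _ := by ring
  · intro x hx
    have hx0 : 0 < x := by linarith
    rw [abs_of_nonneg (by positivity), Real.rpow_add hx0, Real.rpow_add hx0]
    have hz := zetaTwo_nonneg
    calc _ ≤ x ^ (-u) * (x ^ (σ - 1) * (2 * zetaTwo * x ^ ((2 * p - 1 : ℝ)))) := by
          gcongr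
          · exact min_le_right _ _
          · exact abs_bernTail_le_of_one_le hp hx0
      _ = _ := by ring

/-- For n ≠ 0 the factor (x+2πin)^(s₁-1) stays bounded near x = 0, so only s₂ matters there. Hence
Re(s₁+s₂) has no lower bound, unlike for the zero frequency. -/
theorem integrable_freqTerm {p : ℕ} (hp : 1 ≤ p) {s₁ s₂ : ℂ} (h2 : -(2 * p : ℝ) < s₂.re)
    (h1 : s₁.re < 0) (h : (s₁ + s₂).re < 1 - 2 * p) :
    Integrable (fun q : ℤ × ℝ => freqTerm p s₁ s₂ q.1 q.2)
      (Measure.count.prod (volume.restrict (Ioi 0))) := by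
  rw [Complex.add_re] at h
  -- The available exponent 1 - Re s₁ is split into v = 1+η, just enough to sum over n, and u = -Re
  -- s₁ - η for the integral.
  obtain ⟨η, hη0, hη⟩ := exists_between (lt_min (neg_pos.2 h1) (sub_pos.2 h))
  rw [lt_min_iff] at hη
  have hg := integrableOn_freq_bound hp (u := -s₁.re - η) h2 (by linarith)
  have hle : ∀ n : ℤ, ∀ᵐ x ∂(volume.restrict (Ioi (0 : ℝ))), ‖freqTerm p s₁ s₂ n x‖ ≤
      Real.exp (Real.pi * |s₁.im|) * (2 * Real.pi * |(n : ℝ)|) ^ (-(1 + η)) *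
      (min 1 (x ^ (-(-s₁.re - η))) * (x ^ (s₂.re - 1) * |bernTail p x|)) := by
    intro n
    filter_upwards [ae_restrict_mem measurableSet_Ioi] with x hx
    exact norm_freqTerm_le p (u := -s₁.re - η) (v := 1 + η) (by linarith) (by linarith) (by ring) n hx
  have hI : ∀ n, Integrable (freqTerm p s₁ s₂ n) (volume.restrict (Ioi 0)) := fun n =>
    (hg.const_mul _).mono' (measurable_freqTerm p s₁ s₂ n).aestronglyMeasurable (hle n)
  refine integrable_count_prod hI ?_
  refine Summable.of_nonneg_of_le (fun _ => integral_nonneg fun _ => norm_nonneg _)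
    (fun n => (integral_mono_ae (hI n).norm (hg.const_mul _) (hle n)).trans_eq
      (integral_const_mul _ _)) ?_
  exact ((summable_two_pi_int_rpow (v := 1 + η) (by linarith)).mul_left _).mul_right _

theorem differentiableOn_freqInt {p : ℕ} (hp : 1 ≤ p) {s₂ : ℂ} (h2 : -(2 * p : ℝ) < s₂.re) :
    DifferentiableOn ℂ (fun s₁ => freqInt p s₁ s₂) {s₁ | s₁.re < min 0 (1 - 2 * p - s₂.re)} := by
  have hae : ∀ᵐ q : ℤ × ℝ ∂(Measure.count.prod (volume.restrict (Ioi 0))), q.2 ∈ Ioi (0 : ℝ) :=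
    Measure.quasiMeasurePreserving_snd.ae (ae_restrict_mem measurableSet_Ioi)
  have hm := measurable_bernTail p
  have hcongr : ∀ s : ℂ × ℂ, (fun q : ℤ × ℝ => freqTerm p s.1 s₂ q.1 q.2)
      =ᵐ[Measure.count.prod (volume.restrict (Ioi 0))] fun q : ℤ × ℝ =>
        Complex.exp (Complex.log ((q.2 : ℂ) + 2 * Real.pi * Complex.I * (q.1 : ℝ)) * s.1 +
          0 * s.2) * (Complex.exp (-Complex.log ((q.2 : ℂ) + 2 * Real.pi * Complex.I * (q.1 : ℝ))) *
          ((q.2 : ℂ) ^ (s₂ - 1) * if q.1 = 0 then 0 else (bernTail p q.2 : ℂ))) := by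
    intro s
    filter_upwards [hae] with q hq
    rw [freqTerm, Complex.cpow_def_of_ne_zero (add_two_pi_I_ne_zero hq _),
      ← mul_assoc (Complex.exp (_ + _)), ← Complex.exp_add]
    ring_nf
  have h := differentiableOn_integral_exp (μ := Measure.count.prod (volume.restrict (Ioi (0 : ℝ))))
    (a := fun q : ℤ × ℝ => Complex.log ((q.2 : ℂ) + 2 * Real.pi * Complex.I * (q.1 : ℝ)))
    (b := fun _ => 0)
    (w := fun q => Complex.exp (-Complex.log ((q.2 : ℂ) + 2 * Real.pi * Complex.I * (q.1 : ℝ))) *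
          ((q.2 : ℂ) ^ (s₂ - 1) * if q.1 = 0 then 0 else (bernTail p q.2 : ℂ)))
    (U := {s : ℂ × ℂ | s.1.re < min 0 (1 - 2 * p - s₂.re)})
    (Measurable.aestronglyMeasurable (by fun_prop)) (Measurable.aestronglyMeasurable (by fun_prop))
    (isOpen_lt (g := fun _ : ℂ × ℂ => min 0 (1 - 2 * (p : ℝ) - s₂.re)) (by fun_prop)
      continuous_const)
    (fun s hs => by
      rw [mem_ofPred_eq, lt_min_iff] at hs
      exact (integrable_freqTerm hp h2 hs.1 (by rw [Complex.add_re]; linarith)).congr (hcongr s))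
  have h2 := h.comp (f := fun r : ℂ => (r, (0 : ℂ)))
    (s := {s₁ | s₁.re < min 0 (1 - 2 * (p : ℝ) - s₂.re)})
    (DifferentiableOn.prodMk differentiableOn_id (differentiableOn_const _)) (fun r hr => hr)
  exact h2.congr fun r _ => integral_congr_ae (hcongr (r, 0))

/-- Lipschitz's formula with a = 1 - s₁ evaluates the sum over m under the integral. The frequency 0
contributes x^(s₁-1), that is, the Mellin transform of the remainder, and this alone requires the
strip in Re(s₁+s₂). -/
theorem lapInt_bernTail_eq {p : ℕ} (hp : 1 ≤ p) {s₁ s₂ : ℂ} (h2 : -(2 * p : ℝ) < s₂.re)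
    (h1 : s₁.re < 0) (h : (s₁ + s₂).re < 1 - 2 * p) (h' : -(2 * p : ℝ) < (s₁ + s₂).re) :
    lapInt (bernTail p) (s₁, s₂) = Complex.Gamma (1 - s₁) *
      ((2 * Real.pi) ^ (s₁ + s₂ - 2) * Real.pi / Complex.sin (Real.pi / 2 * (s₁ + s₂)) *
        riemannZeta (2 - (s₁ + s₂)) + freqInt p s₁ s₂) := by
  have hR : (s₁, s₂) ∈ emRegion p := by constructor <;> · push_cast; linarith
  have hK := integrable_freqTerm hp h2 h1 h
  have hT := integrableOn_cpow_mul_bernTail hp h' (by linarith)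
  rw [← integral_cpow_mul_bernTail hp h' (by linarith), lapInt,
    integral_count_prod_symm (integrable_lapTerm_bernTail hR), freqInt, integral_count_prod_symm hK]
  have hKI : Integrable (fun x => ∑' n : ℤ, freqTerm p s₁ s₂ n x) (volume.restrict (Ioi 0)) := by
    refine hK.integral_prod_right.congr ?_
    filter_upwards [hK.prod_left_ae] with x hx
    rw [integral_countable hx]
    simp
  rw [← integral_add hT hKI, ← integral_const_mul]
  refine setIntegral_congr_fun measurableSet_Ioi fun x hx => ?_
  have hx0 : 0 < x := hx
  have hx' : (x : ℂ) ≠ 0 := by exact_mod_cast hx0.ne'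
  have hsum : Summable fun n : ℤ => ((x : ℂ) + 2 * Real.pi * Complex.I * (n : ℝ)) ^ (s₁ - 1) := by
    refine Summable.of_norm_bounded_eventually
      (((summable_two_pi_int_rpow (v := 1 - s₁.re) (by linarith)).mul_left
        (Real.exp (Real.pi * |(s₁ - 1).im|))).mul_right (min 1 (x ^ (-0 : ℝ)))) ?_
    filter_upwards [(finite_singleton (0 : ℤ)).compl_mem_cofinite] with n hn
    exact norm_cpow_freq_le hx0 hn le_rfl (by linarith) (by simp)
  have hL := lipschitz_formula (a := 1 - s₁) (by simp; linarith) hx0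
  rw [show (1 - s₁) - 1 = -s₁ by ring, show -(1 - s₁) = s₁ - 1 by ring,
    hsum.tsum_eq_add_tsum_ite 0] at hL
  simp only [Int.cast_zero, Complex.ofReal_zero, mul_zero, add_zero] at hL
  calc ∑' m : ℕ, lapTerm (bernTail p) (s₁, s₂) m x
      = ∑' m : ℕ, (((m : ℂ) + 1) ^ (-s₁) * Complex.exp (-(((m + 1 : ℝ) : ℂ) * x))) *
        ((x : ℂ) ^ (s₂ - 1) * bernTail p x) := by
        refine tsum_congr fun m => ?_
        rw [lapTerm_eq _ _ _ hx0]
        ring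
    _ = _ := by
        rw [tsum_mul_right, hL, mul_assoc, add_mul]
        congr 2
        · rw [show s₁ + s₂ - 2 = (s₁ - 1) + (s₂ - 1) by ring, Complex.cpow_add _ _ hx']
          ring
        · rw [← tsum_mul_right]
          refine tsum_congr fun n => ?_
          rw [freqTerm]
          split_ifs <;> simp

end

/-! ### Continuation of the frequency formula to the left -/

section

open MeasureTheory Filter Topology Set

/-- A half-plane minus a countable set is preconnected. -/
theorem isPreconnected_halfPlane_diff_countable (a : ℝ) {C : Set ℂ} (hC : C.Countable) :
    IsPreconnected ({z : ℂ | z.re < a} \ C) := by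
  -- A homeomorphism from the plane onto the half-plane, through which connectedness of the plane
  -- minus a countable set is transported.
  let φ : ℂ → ℂ := fun z => ((a - Real.exp z.re : ℝ) : ℂ) + z.im * Complex.I
  have hφc : Continuous φ := by fun_prop
  have hre : ∀ z, (φ z).re = a - Real.exp z.re := fun z => by
    simp [φ, -Complex.ofReal_exp]
  have him : ∀ z, (φ z).im = z.im := fun z => by simp [φ]
  have hinj : Function.Injective φ := by
    intro z w h
    refine Complex.ext (Real.exp_injective ?_) ?_
    · have := congrArg Complex.re h
      rw [hre, hre] at this
      linarith
    · rw [← him z, ← him w, h]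
  have hpre : (φ ⁻¹' C).Countable := hC.preimage hinj
  have hconn := (hpre.isConnected_compl_of_one_lt_rank (E := ℂ) (by simp)).isPreconnected.image φ
    hφc.continuousOn
  convert! hconn using 1
  ext z
  constructor
  · rintro ⟨hz, hzC⟩
    have hz' : 0 < a - z.re := sub_pos.2 hz
    have hpt : φ ⟨Real.log (a - z.re), z.im⟩ = z := by
      refine Complex.ext ?_ ?_
      · rw [hre, Real.exp_log hz']; ring
      · rw [him]
    exact ⟨_, by simpa [hpt] using hzC, hpt⟩
  · rintro ⟨w, hw, rfl⟩
    refine ⟨?_, hw⟩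
    change (φ w).re < a
    rw [hre]
    linarith [Real.exp_pos w.re]

theorem sin_half_pi_mul_ne_zero {s : ℂ} (hs : ∀ k : ℤ, s ≠ 2 * (k : ℂ)) :
    Complex.sin (Real.pi / 2 * s) ≠ 0 := by
  rw [Complex.sin_ne_zero_iff]
  intro k hk
  refine hs k ?_
  have hpi : (Real.pi : ℂ) ≠ 0 := by exact_mod_cast Real.pi_ne_zero
  have : (Real.pi : ℂ) * s = Real.pi * (2 * k) := by linear_combination 2 * hk
  exact mul_left_cancel₀ hpi this

/-- The continuation of `eulerMaclaurinZeta p` to the left, through Lipschitz's formula. -/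
noncomputable def lipschitzZeta (p : ℕ) (s₁ s₂ : ℂ) : ℂ :=
  riemannZeta (s₁ + s₂ - 1) / (s₂ - 1) - riemannZeta (s₁ + s₂) / 2 +
    ∑ i ∈ Finset.range p, bernCoeff i * (ascPochhammer ℂ (2 * i + 1)).eval s₂ *
      riemannZeta (s₁ + s₂ + (2 * i + 1 : ℕ)) +
    (Complex.Gamma s₂)⁻¹ * (Complex.Gamma (1 - s₁) *
      ((2 * Real.pi) ^ (s₁ + s₂ - 2) * Real.pi / Complex.sin (Real.pi / 2 * (s₁ + s₂)) *
        riemannZeta (2 - (s₁ + s₂)) + freqInt p s₁ s₂))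

/-- For fixed s₂ both sides are holomorphic in s₁ on a left half-plane with the points s₁+s₂ ∈ 2ℤ
removed. They agree on the part where -2p < Re(s₁+s₂), which is where the integral representation of
both is available. -/
theorem doubleZeta_eq_lipschitzZeta {p : ℕ} (hp : 1 ≤ p) {s₁ s₂ : ℂ} (h2 : -(2 * p : ℝ) < s₂.re)
    (hs2 : s₂ ≠ 1) (h1 : s₁.re < 0) (h : (s₁ + s₂).re < 1 - 2 * p)
    (hs : ∀ k : ℤ, s₁ + s₂ ≠ 2 * (k : ℂ)) : doubleZeta s₁ s₂ = lipschitzZeta p s₁ s₂ := by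
  have hp' : (1 : ℝ) ≤ p := by exact_mod_cast hp
  set a : ℝ := min 0 (1 - 2 * p - s₂.re) with ha
  let C : Set ℂ := {z | ∃ k : ℤ, z + s₂ = 2 * (k : ℂ)}
  have hCc : C.Countable := by
    refine (countable_range fun k : ℤ => 2 * (k : ℂ) - s₂).mono ?_
    rintro z ⟨k, hk⟩
    exact ⟨k, by simp only; rw [← hk]; ring⟩
  have hCcl : IsClosed C := by
    have hcl : IsClosed (range fun k : ℤ => (k : ℂ)) := Complex.isClosed_range_intCast
    have : C = (fun z : ℂ => (z + s₂) / 2) ⁻¹' (range fun k : ℤ => (k : ℂ)) := by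
      ext z
      simp only [C, mem_preimage, mem_range, mem_ofPred_eq]
      refine exists_congr fun k => ?_
      constructor <;> intro h
      · linear_combination (-1 / 2) * h
      · linear_combination (-2) * h
    rw [this]
    exact hcl.preimage (by fun_prop)
  set V : Set ℂ := {z : ℂ | z.re < a} \ C with hV
  have hVo : IsOpen V := (isOpen_lt Complex.continuous_re continuous_const).sdiff hCcl
  have hVmem : ∀ z, z ∈ V ↔ (z.re < 0 ∧ (z + s₂).re < 1 - 2 * p) ∧ ∀ k : ℤ, z + s₂ ≠ 2 * (k : ℂ) := by
    intro z
    rw [hV, Set.mem_sdiff, mem_ofPred_eq, ha, lt_min_iff, Complex.add_re]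
    simp only [C, mem_ofPred_eq, not_exists]
    refine and_congr (and_congr Iff.rfl ?_) Iff.rfl
    constructor <;> intro h <;> linarith
  have hpolar : ∀ z ∈ V, (z, s₂) ∉ doubleZetaPolarSet := by
    intro z hz
    obtain ⟨⟨hz1, hz2⟩, hz3⟩ := (hVmem z).1 hz
    rintro (h | h | ⟨k, h⟩)
    · exact hs2 h
    · simp only at h
      rw [h, Complex.one_re] at hz2
      linarith
    · refine hz3 (1 - k) ?_
      simp only at h
      rw [h]
      push_cast
      ring
  have hf : DifferentiableOn ℂ (fun z => doubleZeta z s₂) V := by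
    have := isDoubleZeta_doubleZeta.differentiableOn.comp (f := fun z : ℂ => (z, s₂)) (s := V)
      (DifferentiableOn.prodMk differentiableOn_id (differentiableOn_const _)) hpolar
    exact this
  have hz : ∀ c : ℂ, ∀ z : ℂ, z + s₂ + c ≠ 1 →
      DifferentiableAt ℂ (fun z : ℂ => riemannZeta (z + s₂ + c)) z := fun c z hc =>
    DifferentiableAt.comp (g := riemannZeta) (f := fun z : ℂ => z + s₂ + c) z
      (differentiableAt_riemannZeta hc) (by fun_prop)
  have hg : DifferentiableOn ℂ (fun z => lipschitzZeta p z s₂) V := by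
    intro z hzV
    obtain ⟨⟨hz1, hz2⟩, hz3⟩ := (hVmem z).1 hzV
    have hne : ∀ c : ℂ, c.re ≤ 0 → z + s₂ + c ≠ 1 := by
      intro c hc h
      have := congrArg Complex.re h
      rw [Complex.add_re, Complex.one_re] at this
      linarith
    have hA : DifferentiableAt ℂ (fun z : ℂ => riemannZeta (z + s₂ - 1) / (s₂ - 1)) z := by
      simp only [sub_eq_add_neg (_ + s₂)]
      exact (hz _ z (hne _ (by simp))).div_const _
    have hB : DifferentiableAt ℂ (fun z : ℂ => riemannZeta (z + s₂) / 2) z := by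
      have := (hz 0 z (hne 0 (by simp))).div_const 2
      simpa only [add_zero] using this
    have hD : DifferentiableAt ℂ (fun z : ℂ => ∑ i ∈ Finset.range p, bernCoeff i *
        (ascPochhammer ℂ (2 * i + 1)).eval s₂ * riemannZeta (z + s₂ + (2 * i + 1 : ℕ))) z := by
      refine DifferentiableAt.fun_sum fun i _ => (hz _ z fun h => hz3 (-i) ?_).const_mul _
      push_cast at h ⊢
      linear_combination h
    have hΓ : DifferentiableAt ℂ (fun z : ℂ => Complex.Gamma (1 - z)) z := by
      refine DifferentiableAt.comp (g := Complex.Gamma) z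
        (Complex.differentiableAt_Gamma _ fun m h => ?_) (by fun_prop)
      have := congrArg Complex.re h
      simp at this
      linarith [Nat.cast_nonneg (α := ℝ) m]
    have hpow : DifferentiableAt ℂ (fun z : ℂ => (2 * Real.pi : ℂ) ^ (z + s₂ - 2)) z :=
      DifferentiableAt.const_cpow (by fun_prop) (Or.inl (by
        have : (2 * Real.pi : ℝ) ≠ 0 := by positivity
        exact_mod_cast this))
    have hsin : DifferentiableAt ℂ (fun z : ℂ => Complex.sin (Real.pi / 2 * (z + s₂))) z := by
      fun_prop
    have hζ : DifferentiableAt ℂ (fun z : ℂ => riemannZeta (2 - (z + s₂))) z := by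
      refine DifferentiableAt.comp (g := riemannZeta) z
        (differentiableAt_riemannZeta fun h => ?_) (by fun_prop)
      have := congrArg Complex.re h
      rw [Complex.sub_re] at this
      simp only [Complex.one_re, Complex.re_ofNat] at this
      linarith
    have hK : DifferentiableAt ℂ (fun z : ℂ => freqInt p z s₂) z :=
      (differentiableOn_freqInt hp h2).differentiableAt
        ((isOpen_lt Complex.continuous_re continuous_const).mem_nhds hzV.1)
    exact (((hA.fun_sub hB).fun_add hD).fun_add ((hΓ.fun_mul (((hpow.mul_const _).fun_div hsin
      (sin_half_pi_mul_ne_zero hz3)).fun_mul hζ |>.fun_add hK)).const_mul _)).differentiableWithinAt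
  obtain ⟨x, hx1, hx2⟩ : ∃ x : ℝ, -(2 * p : ℝ) - s₂.re < x ∧ x < a :=
    exists_between (lt_min (by linarith) (by linarith))
  -- The sum z₀ + s₂ has imaginary part 1, so the excluded even integers are avoided near the base
  -- point.
  let z₀ : ℂ := ⟨x, 1 - s₂.im⟩
  have hcond : ∀ᶠ z in 𝓝 z₀, z ∈ V ∧ -(2 * p : ℝ) < (z + s₂).re := by
    have e1 : ∀ᶠ z : ℂ in 𝓝 z₀, z.re < a :=
      (isOpen_lt Complex.continuous_re continuous_const).mem_nhds hx2
    have e2 : ∀ᶠ z : ℂ in 𝓝 z₀, -(2 * p : ℝ) - s₂.re < z.re :=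
      (isOpen_lt continuous_const Complex.continuous_re).mem_nhds hx1
    have e3 : ∀ᶠ z : ℂ in 𝓝 z₀, -s₂.im < z.im :=
      (isOpen_lt continuous_const Complex.continuous_im).mem_nhds (by
        change -s₂.im < 1 - s₂.im
        linarith)
    filter_upwards [e1, e2, e3] with z h1 h2 h3
    refine ⟨⟨h1, ?_⟩, by rw [Complex.add_re]; linarith⟩
    rintro ⟨k, hk⟩
    have := congrArg Complex.im hk
    simp at this
    linarith
  have hev : (fun z => doubleZeta z s₂) =ᶠ[𝓝 z₀] fun z => lipschitzZeta p z s₂ := by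
    filter_upwards [hcond] with z hz
    obtain ⟨hzV, hz4⟩ := hz
    obtain ⟨⟨hz1, hz2⟩, hz3⟩ := (hVmem z).1 hzV
    have hR : (z, s₂) ∈ emRegion p := by constructor <;> · push_cast; linarith
    rw [doubleZeta_eq_eulerMaclaurinZeta hR (hpolar z hzV), eulerMaclaurinZeta, lipschitzZeta,
      lapInt_bernTail_eq hp h2 hz1 hz2 hz4]
  exact (hf.analyticOnNhd hVo).eqOn_of_preconnected_of_eventuallyEq (hg.analyticOnNhd hVo)
    (isPreconnected_halfPlane_diff_countable a hCc) hcond.self_of_nhds.1 hev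
    ((hVmem s₁).2 ⟨⟨h1, h⟩, hs⟩)

end

/-! ### The Taylor coefficients c_j: differential equation, recurrence, explicit formula -/

section

open Filter Topology PowerSeries

/-- The Taylor series at `0`, as a formal power series. -/
noncomputable def taylorSeries (f : ℂ → ℂ) : ℂ⟦X⟧ := PowerSeries.mk (taylorCoeff f)

theorem taylorSeries_congr {f g : ℂ → ℂ} (h : f =ᶠ[𝓝 0] g) : taylorSeries f = taylorSeries g := by
  ext n
  simp only [taylorSeries, coeff_mk, taylorCoeff, h.iteratedDeriv_eq]

theorem taylorSeries_mul {f g : ℂ → ℂ} (hf : AnalyticAt ℂ f 0) (hg : AnalyticAt ℂ g 0) :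
    taylorSeries (f * g) = taylorSeries f * taylorSeries g := by
  ext n
  rw [coeff_mul, taylorSeries, coeff_mk, taylorCoeff, iteratedDeriv_mul hf.contDiffAt hg.contDiffAt,
    Finset.Nat.sum_antidiagonal_eq_sum_range_succ_mk, Finset.sum_div]
  refine Finset.sum_congr rfl fun i hi => ?_
  have hi' : i ≤ n := by simpa [Nat.lt_succ_iff] using hi
  simp only [taylorSeries, coeff_mk, taylorCoeff]
  rw [Nat.cast_choose ℂ hi']
  have h1 := Nat.factorial_ne_zero n
  have h2 := Nat.factorial_ne_zero i
  have h3 := Nat.factorial_ne_zero (n - i)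
  field_simp

theorem taylorSeries_deriv (f : ℂ → ℂ) : taylorSeries (deriv f) = d⁄dX ℂ (taylorSeries f) := by
  ext n
  rw [coeff_derivative, taylorSeries, taylorSeries, coeff_mk, coeff_mk, taylorCoeff, taylorCoeff,
    iteratedDeriv_succ', Nat.factorial_succ]
  have h2 := Nat.factorial_ne_zero n
  have h3 := Nat.cast_add_one_ne_zero (R := ℂ) n
  push_cast
  field_simp

theorem taylorSeries_const (c : ℂ) : taylorSeries (fun _ => c) = PowerSeries.C c := by
  ext n
  rw [taylorSeries, coeff_mk, taylorCoeff, iteratedDeriv_const, coeff_C]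
  split_ifs with h <;> simp [h]

theorem taylorSeries_add {f g : ℂ → ℂ} (hf : AnalyticAt ℂ f 0) (hg : AnalyticAt ℂ g 0) :
    taylorSeries (f + g) = taylorSeries f + taylorSeries g := by
  ext n
  rw [map_add, taylorSeries, taylorSeries, taylorSeries, coeff_mk, coeff_mk, coeff_mk, taylorCoeff,
    taylorCoeff, taylorCoeff, iteratedDeriv_add hf.contDiffAt hg.contDiffAt, add_div]

theorem taylorSeries_id : taylorSeries (fun x => x) = PowerSeries.X := by
  have h : d⁄dX ℂ (taylorSeries fun x => x) = d⁄dX ℂ (PowerSeries.X : ℂ⟦X⟧) := by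
    rw [← taylorSeries_deriv, show deriv (fun x : ℂ => x) = fun _ => 1 from by ext; simp,
      taylorSeries_const]
    simp
  refine PowerSeries.derivative.ext h ?_
  simp [taylorSeries, taylorCoeff, ← coeff_zero_eq_constantCoeff_apply]

/-- The function whose Taylor coefficients are the `cCoeff`. -/
noncomputable def cFun (s₁ s₂ : ℂ) (x : ℂ) : ℂ :=
  (1 + x * (s₂ / (s₁ + s₂))) ^ (-s₁) * (1 - x * (s₁ / (s₁ + s₂))) ^ (-s₂)

theorem coeff_taylorSeries_cFun (s₁ s₂ : ℂ) (j : ℕ) :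
    coeff j (taylorSeries (cFun s₁ s₂)) = cCoeff s₁ s₂ j := by
  rw [taylorSeries, coeff_mk]
  rfl

theorem analyticAt_cFun (s₁ s₂ : ℂ) : AnalyticAt ℂ (cFun s₁ s₂) 0 := by
  unfold cFun
  refine AnalyticAt.mul (AnalyticAt.cpow (by fun_prop) (by fun_prop) ?_)
    (AnalyticAt.cpow (by fun_prop) (by fun_prop) ?_) <;> simp

/-- The logarithmic derivative is -s₁r₂/(1+r₂x) + s₂r₁/(1-r₁x). Because s₁r₂ = s₂r₁ the constant
term of its numerator cancels, leaving a multiple of x. -/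
theorem deriv_cFun {s₁ s₂ : ℂ} (hs : s₁ + s₂ ≠ 0) : ∀ᶠ x in 𝓝 (0 : ℂ),
    (1 + (s₂ / (s₁ + s₂)) * x) * (1 + (-(s₁ / (s₁ + s₂))) * x) * deriv (cFun s₁ s₂) x =
      (s₁ * s₂ / (s₁ + s₂)) * x * cFun s₁ s₂ x := by
  have h1 : ∀ᶠ x in 𝓝 (0 : ℂ), 1 + x * (s₂ / (s₁ + s₂)) ∈ Complex.slitPlane := by
    refine ContinuousAt.eventually_mem (f := fun x : ℂ => 1 + x * (s₂ / (s₁ + s₂))) (by fun_prop)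
      (Complex.isOpen_slitPlane.mem_nhds ?_)
    simp
  have h2 : ∀ᶠ x in 𝓝 (0 : ℂ), 1 - x * (s₁ / (s₁ + s₂)) ∈ Complex.slitPlane := by
    refine ContinuousAt.eventually_mem (f := fun x : ℂ => 1 - x * (s₁ / (s₁ + s₂))) (by fun_prop)
      (Complex.isOpen_slitPlane.mem_nhds ?_)
    simp
  filter_upwards [h1, h2] with x hx1 hx2
  have n1 := Complex.slitPlane_ne_zero hx1
  have n2 := Complex.slitPlane_ne_zero hx2
  have d1 : HasDerivAt (fun x : ℂ => 1 + x * (s₂ / (s₁ + s₂))) (s₂ / (s₁ + s₂)) x := by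
    simpa using ((hasDerivAt_id x).mul_const (s₂ / (s₁ + s₂))).const_add 1
  have d2 : HasDerivAt (fun x : ℂ => 1 - x * (s₁ / (s₁ + s₂))) (-(s₁ / (s₁ + s₂))) x := by
    simpa using ((hasDerivAt_id x).mul_const (s₁ / (s₁ + s₂))).const_sub 1
  have d := (d1.cpow_const (c := -s₁) hx1).mul (d2.cpow_const (c := -s₂) hx2)
  have e : deriv (cFun s₁ s₂) x = _ := d.deriv
  rw [e, cFun, Complex.cpow_sub _ _ n1, Complex.cpow_sub _ _ n2, Complex.cpow_one, Complex.cpow_one]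
  have m1 : (1 + s₂ / (s₁ + s₂) * x) = 1 + x * (s₂ / (s₁ + s₂)) := by ring
  have m2 : (1 + -(s₁ / (s₁ + s₂)) * x) = 1 - x * (s₁ / (s₁ + s₂)) := by ring
  rw [m1, m2]
  generalize (1 + x * (s₂ / (s₁ + s₂))) ^ (-s₁) = A
  generalize (1 - x * (s₁ / (s₁ + s₂))) ^ (-s₂) = B
  have e1 : (1 + x * (s₂ / (s₁ + s₂))) * (1 - x * (s₁ / (s₁ + s₂))) *
      (-s₁ * (A / (1 + x * (s₂ / (s₁ + s₂)))) * (s₂ / (s₁ + s₂)) * B +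
        A * (-s₂ * (B / (1 - x * (s₁ / (s₁ + s₂)))) * -(s₁ / (s₁ + s₂)))) =
      (-s₁ * (s₂ / (s₁ + s₂)) * (1 - x * (s₁ / (s₁ + s₂))) +
        s₂ * (s₁ / (s₁ + s₂)) * (1 + x * (s₂ / (s₁ + s₂)))) * (A * B) := by
    generalize 1 + x * (s₂ / (s₁ + s₂)) = u at *
    generalize 1 - x * (s₁ / (s₁ + s₂)) = v at *
    field_simp
  rw [e1]
  congr 1
  field_simp
  ring

theorem derivative_taylorSeries_cFun {s₁ s₂ : ℂ} (hs : s₁ + s₂ ≠ 0) :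
    (1 + PowerSeries.C (s₂ / (s₁ + s₂)) * X) * (1 + PowerSeries.C (-(s₁ / (s₁ + s₂))) * X) *
      d⁄dX ℂ (taylorSeries (cFun s₁ s₂)) =
      PowerSeries.C (s₁ * s₂ / (s₁ + s₂)) * X * taylorSeries (cFun s₁ s₂) := by
  have hlin : ∀ c : ℂ, taylorSeries (fun x => 1 + c * x) = 1 + PowerSeries.C c * X := by
    intro c
    have : (fun x : ℂ => 1 + c * x) = (fun _ => 1) + (fun _ => c) * fun x => x := rfl
    rw [this, taylorSeries_add (by fun_prop) (by fun_prop), taylorSeries_mul (by fun_prop)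
      (by fun_prop), taylorSeries_const, taylorSeries_const, taylorSeries_id, map_one]
  have h := taylorSeries_congr (f := ((fun x => 1 + (s₂ / (s₁ + s₂)) * x) *
    fun x => 1 + (-(s₁ / (s₁ + s₂))) * x) * deriv (cFun s₁ s₂))
    (g := ((fun _ => s₁ * s₂ / (s₁ + s₂)) * fun x => x) * cFun s₁ s₂) (by
      filter_upwards [deriv_cFun hs] with x hx
      simpa only [Pi.mul_apply] using hx)
  rwa [taylorSeries_mul (by fun_prop) (analyticAt_cFun s₁ s₂).deriv,
    taylorSeries_mul (by fun_prop) (by fun_prop), hlin, hlin, taylorSeries_deriv,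
    taylorSeries_mul (by fun_prop) (analyticAt_cFun s₁ s₂),
    taylorSeries_mul (by fun_prop) (by fun_prop), taylorSeries_const, taylorSeries_id] at h

theorem cCoeff_zero (s₁ s₂ : ℂ) : cCoeff s₁ s₂ 0 = 1 := by
  simp [cCoeff, taylorCoeff]

theorem cCoeff_one {s₁ s₂ : ℂ} (hs : s₁ + s₂ ≠ 0) : cCoeff s₁ s₂ 1 = 0 := by
  have h := congrArg (coeff 0) (derivative_taylorSeries_cFun hs)
  simp only [coeff_zero_eq_constantCoeff_apply, map_mul, map_add, constantCoeff_X, map_one,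
    mul_zero, zero_mul, add_zero, one_mul] at h
  rw [← coeff_zero_eq_constantCoeff_apply, coeff_derivative, coeff_taylorSeries_cFun] at h
  simpa using h

/-- Comparison of coefficients in the differential equation. The factor s₁+s₂+i is what later
matches the Pochhammer symbols in the central moments. -/
theorem cCoeff_recurrence {s₁ s₂ : ℂ} (hs : s₁ + s₂ ≠ 0) (i : ℕ) :
    ((i : ℂ) + 2) * cCoeff s₁ s₂ (i + 2) =
      (1 - 2 * (s₂ / (s₁ + s₂))) * (i + 1) * cCoeff s₁ s₂ (i + 1) +
        s₂ / (s₁ + s₂) * (1 - s₂ / (s₁ + s₂)) * (s₁ + s₂ + i) * cCoeff s₁ s₂ i := by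
  have h := congrArg (coeff (i + 1)) (derivative_taylorSeries_cFun hs)
  have hr : s₁ / (s₁ + s₂) = 1 - s₂ / (s₁ + s₂) := by field_simp; ring
  have hk : s₁ * s₂ / (s₁ + s₂) = (s₁ + s₂) * (s₂ / (s₁ + s₂) * (1 - s₂ / (s₁ + s₂))) := by
    field_simp; ring
  rw [hk, hr] at h
  generalize s₂ / (s₁ + s₂) = r at *
  have e : ∀ G : ℂ⟦X⟧, (1 + PowerSeries.C r * X) * (1 + PowerSeries.C (-(1 - r)) * X) * G =
      G + PowerSeries.C (2 * r - 1) * (X * G) + PowerSeries.C (-(r * (1 - r))) * (X * (X * G)) := by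
    intro G
    simp only [map_neg, map_sub, map_mul, map_one, map_ofNat]
    ring
  rw [e, mul_assoc] at h
  simp only [map_add, coeff_C_mul, coeff_succ_X_mul, coeff_derivative, coeff_taylorSeries_cFun] at h
  rcases i with _ | i
  · simp only [zero_add, coeff_zero_X_mul, mul_zero, add_zero, CharP.cast_eq_zero, Nat.cast_one] at h ⊢
    linear_combination h
  · simp only [coeff_succ_X_mul, coeff_derivative, coeff_taylorSeries_cFun] at h
    push_cast at h ⊢
    linear_combination h

theorem one_add_C_mul_X_mul_mk (c : ℂ) :
    (1 + PowerSeries.C c * X) * PowerSeries.mk (fun k => (-c) ^ k) = 1 := by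
  ext n
  rw [add_mul, one_mul, mul_assoc, map_add, coeff_C_mul, coeff_mk]
  rcases n with _ | n
  · simp
  · rw [coeff_succ_X_mul, coeff_mk, coeff_one, if_neg (Nat.succ_ne_zero n)]
    ring

/-- The `k`-th coefficient `s (r₁ (-r₂)^k + r₂ r₁^k) / k` of the logarithm of `cFun`. -/
noncomputable def logCoeff (s₁ s₂ : ℂ) (k : ℕ) : ℂ :=
  (s₁ + s₂) * ((s₁ / (s₁ + s₂) * (-(s₂ / (s₁ + s₂))) ^ k +
    s₂ / (s₁ + s₂) * (s₁ / (s₁ + s₂)) ^ k) / k)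

/-- The two linear factors of the differential equation are inverted by geometric series; since
r₁+r₂ = 1 they differ by X, which gives the partial fraction decomposition of X/(AB). -/
theorem derivative_taylorSeries_eq_logCoeff {s₁ s₂ : ℂ} (hs : s₁ + s₂ ≠ 0) :
    d⁄dX ℂ (taylorSeries (cFun s₁ s₂)) =
      PowerSeries.mk (fun k => ((k + 1 : ℕ) : ℂ) * logCoeff s₁ s₂ (k + 1)) *
        taylorSeries (cFun s₁ s₂) := by
  have h := derivative_taylorSeries_cFun hs
  set r₂ := s₂ / (s₁ + s₂) with hr₂
  set r₁ := s₁ / (s₁ + s₂) with hr₁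
  have hsum : r₁ + r₂ = 1 := by rw [hr₁, hr₂]; field_simp
  have hk : s₁ * s₂ / (s₁ + s₂) = (s₁ + s₂) * (r₁ * r₂) := by rw [hr₁, hr₂]; field_simp
  have hP : PowerSeries.mk (fun k => ((k + 1 : ℕ) : ℂ) * logCoeff s₁ s₂ (k + 1)) =
      PowerSeries.C (s₁ * s₂ / (s₁ + s₂)) * (PowerSeries.mk (fun k => (-(-r₁)) ^ k) -
        PowerSeries.mk (fun k => (-r₂) ^ k)) := by
    ext k
    rw [coeff_mk, coeff_C_mul, map_sub, coeff_mk, coeff_mk, logCoeff, hk, ← hr₁, ← hr₂]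
    have := Nat.cast_add_one_ne_zero (R := ℂ) k
    push_cast
    field_simp
    ring
  have h1 := one_add_C_mul_X_mul_mk r₂
  have h2 := one_add_C_mul_X_mul_mk (-r₁)
  set A := 1 + PowerSeries.C r₂ * X
  set B := 1 + PowerSeries.C (-r₁) * (X : ℂ⟦X⟧)
  set U := PowerSeries.mk (fun k => (-r₂) ^ k)
  set V := PowerSeries.mk (fun k => (-(-r₁)) ^ k)
  have hAB : A - B = X := by
    simp only [A, B, map_neg]
    have : PowerSeries.C r₁ + PowerSeries.C r₂ = 1 := by rw [← map_add, hsum, map_one]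
    linear_combination (X : ℂ⟦X⟧) * this
  rw [hP]
  calc d⁄dX ℂ (taylorSeries (cFun s₁ s₂))
      = (U * V) * (A * B * d⁄dX ℂ (taylorSeries (cFun s₁ s₂))) := by
        linear_combination (-(d⁄dX ℂ (taylorSeries (cFun s₁ s₂))) * (B * V)) * h1 -
          (d⁄dX ℂ (taylorSeries (cFun s₁ s₂))) * h2
    _ = _ := by
        rw [h, ← hAB]
        linear_combination (PowerSeries.C (s₁ * s₂ / (s₁ + s₂)) * taylorSeries (cFun s₁ s₂)) *
          (V * h1 - U * h2)

/-- The power series `exp (p X^k)`. -/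
noncomputable def expMonomial (p : ℂ) (k : ℕ) : ℂ⟦X⟧ :=
  PowerSeries.mk fun n => if k ∣ n then p ^ (n / k) / ((n / k).factorial : ℂ) else 0

theorem derivative_expMonomial (p : ℂ) {k : ℕ} (hk : 1 ≤ k) :
    d⁄dX ℂ (expMonomial p k) = PowerSeries.C (k * p) * X ^ (k - 1) * expMonomial p k := by
  ext n
  rw [coeff_derivative, mul_assoc, coeff_C_mul, coeff_X_pow_mul', expMonomial, coeff_mk]
  by_cases hd : k ∣ n + 1
  · obtain ⟨m, hm⟩ := hd
    obtain ⟨m, rfl⟩ : ∃ m', m = m' + 1 := ⟨m - 1, by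
      rcases m with _ | m
      · simp at hm
      · simp⟩
    have hn : n - (k - 1) = k * m := by rw [mul_add] at hm; omega
    have hle : k - 1 ≤ n := by rw [mul_add] at hm; omega
    rw [if_pos ⟨_, hm⟩, if_pos hle, coeff_mk, hn, if_pos (dvd_mul_right k m), hm,
      Nat.mul_div_cancel_left _ hk, Nat.mul_div_cancel_left _ hk, Nat.factorial_succ]
    have h1 := Nat.cast_add_one_ne_zero (R := ℂ) m
    have h2 := Nat.factorial_ne_zero m
    have h3 : (n : ℂ) + 1 = k * (m + 1) := by exact_mod_cast hm
    rw [h3]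
    push_cast
    field_simp
    ring
  · rw [if_neg hd, zero_mul]
    split_ifs with hle
    · rw [coeff_mk, if_neg, mul_zero]
      intro h
      apply hd
      have : n + 1 = (n - (k - 1)) + k := by omega
      rw [this]
      exact h.add (dvd_refl k)
    · simp

theorem derivative_prod_expMonomial {ι : Type*} (S : Finset ι) (p : ι → ℂ) (k : ι → ℕ)
    (hk : ∀ i ∈ S, 1 ≤ k i) : d⁄dX ℂ (∏ i ∈ S, expMonomial (p i) (k i)) =
      (∑ i ∈ S, PowerSeries.C (k i * p i) * X ^ (k i - 1)) * ∏ i ∈ S, expMonomial (p i) (k i) := by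
  classical
  induction S using Finset.induction_on with
  | empty => simp
  | insert a S ha ih =>
    rw [Finset.prod_insert ha, Finset.sum_insert ha, Derivation.leibniz,
      ih fun i hi => hk i (Finset.mem_insert_of_mem hi),
      derivative_expMonomial _ (hk a (Finset.mem_insert_self a S)), smul_eq_mul, smul_eq_mul]
    ring

/-- Both series have constant term 1, and their logarithmic derivatives agree in degrees below j, so
they agree up to degree j. A finite product of exponentials thus replaces the exponential of the
full logarithm. -/
theorem cCoeff_eq_coeff_prod {s₁ s₂ : ℂ} (hs : s₁ + s₂ ≠ 0) (j : ℕ) :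
    cCoeff s₁ s₂ j = coeff j (∏ k : Finset.Icc 2 j, expMonomial (logCoeff s₁ s₂ k) k) := by
  set F := ∏ k : Finset.Icc 2 j, expMonomial (logCoeff s₁ s₂ k) k with hF
  have hF' : d⁄dX ℂ F = (∑ k : Finset.Icc 2 j, PowerSeries.C ((k : ℕ) * logCoeff s₁ s₂ k) *
      X ^ ((k : ℕ) - 1)) * F :=
    derivative_prod_expMonomial _ _ _ fun k _ => le_trans one_le_two (Finset.mem_Icc.1 k.2).1
  have hA : ∀ i < j, coeff i (∑ k : Finset.Icc 2 j, PowerSeries.C ((k : ℕ) * logCoeff s₁ s₂ k) *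
      X ^ ((k : ℕ) - 1)) = ((i + 1 : ℕ) : ℂ) * logCoeff s₁ s₂ (i + 1) := by
    intro i hi
    simp only [map_sum, coeff_C_mul, coeff_X_pow]
    rw [Finset.sum_coe_sort (Finset.Icc 2 j)
      (fun k => (k : ℂ) * logCoeff s₁ s₂ k * if i = k - 1 then 1 else 0)]
    rcases i with _ | i
    -- The linear coefficient of the logarithm is s(-r₁r₂+r₂r₁) = 0, which is why the families start
    -- at k = 2.
    · have : logCoeff s₁ s₂ 1 = 0 := by rw [logCoeff]; ring
      rw [zero_add, this, mul_zero]
      refine Finset.sum_eq_zero fun k hk => ?_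
      rw [if_neg, mul_zero]
      have := (Finset.mem_Icc.1 hk).1
      omega
    · rw [Finset.sum_eq_single (i + 1 + 1)]
      · simp
      · intro k hk hne
        rw [if_neg, mul_zero]
        have := (Finset.mem_Icc.1 hk).1
        omega
      · intro h
        exact absurd (Finset.mem_Icc.2 ⟨by omega, by omega⟩) h
  have hG := derivative_taylorSeries_eq_logCoeff hs
  have key : ∀ n ≤ j, coeff n F = coeff n (taylorSeries (cFun s₁ s₂)) := by
    intro n
    induction n using Nat.strong_induction_on with
    | _ n ih =>
      intro hn
      rcases n with _ | n
      · rw [coeff_taylorSeries_cFun, cCoeff_zero, coeff_zero_eq_constantCoeff_apply, hF, map_prod]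
        refine Finset.prod_eq_one fun k _ => ?_
        rw [← coeff_zero_eq_constantCoeff_apply, expMonomial, coeff_mk]
        simp
      · have h1 := congrArg (coeff n) hF'
        have h2 := congrArg (coeff n) hG
        rw [coeff_derivative, coeff_mul] at h1 h2
        have hne := Nat.cast_add_one_ne_zero (R := ℂ) n
        refine mul_right_cancel₀ hne ?_
        rw [h1, h2]
        refine Finset.sum_congr rfl fun q hq => ?_
        have hq' := Finset.HasAntidiagonal.mem_antidiagonal.1 hq
        rw [hA _ (by omega), coeff_mk, ih _ (by omega) (by omega)]
  rw [key j le_rfl, coeff_taylorSeries_cFun]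

theorem cCoeff_eq_sum {s₁ s₂ : ℂ} (hs : s₁ + s₂ ≠ 0) (j : ℕ) :
    cCoeff s₁ s₂ j =
        ∑ l ∈ weightedFamilies j, (s₁ + s₂) ^ (∑ k, l k) *
          ∏ k : Finset.Icc 2 j, 1 / ((l k).factorial : ℂ) *
            ((s₁ / (s₁ + s₂) * (-(s₂ / (s₁ + s₂))) ^ (k : ℕ)
              + s₂ / (s₁ + s₂) * (s₁ / (s₁ + s₂)) ^ (k : ℕ)) / (k : ℕ)) ^ (l k) := by
  have hpos : ∀ k : Finset.Icc 2 j, 0 < (k : ℕ) := fun k =>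
    lt_of_lt_of_le two_pos (Finset.mem_Icc.1 k.2).1
  rw [cCoeff_eq_coeff_prod hs, PowerSeries.coeff_prod, eq_comm]
  refine Finset.sum_of_injOn
    (fun l => Finsupp.equivFunOnFinite.symm fun k => (k : ℕ) * l k) ?_ ?_ ?_ ?_
  · intro l _ l' _ h
    ext k
    have := DFunLike.congr_fun h k
    exact Nat.eq_of_mul_eq_mul_left (hpos k) this
  · intro l hl
    have := mem_weightedFamilies.1 hl
    simp only [Finset.mem_coe, Finset.mem_finsuppAntidiag]
    exact ⟨this, Finset.subset_univ _⟩
  · intro l hl hne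
    -- The k-th factor is a series in X^k, so a tuple of exponents contributes only if its k-th
    -- entry is k times an integer; that integer is the index of the family.
    by_cases hd : ∀ k : Finset.Icc 2 j, (k : ℕ) ∣ l k
    · exfalso
      refine hne ⟨fun k => l k / k, ?_, ?_⟩
      · refine mem_weightedFamilies.2 ?_
        exact (Finset.sum_congr rfl fun k _ => Nat.mul_div_cancel' (hd k)).trans
          (Finset.mem_finsuppAntidiag.1 hl).1
      · ext k
        exact Nat.mul_div_cancel' (hd k)
    · push Not at hd
      obtain ⟨k, hk⟩ := hd
      refine Finset.prod_eq_zero (Finset.mem_univ k) ?_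
      rw [expMonomial, coeff_mk, if_neg hk]
  · intro l _
    rw [← Finset.prod_pow_eq_pow_sum, ← Finset.prod_mul_distrib]
    refine Finset.prod_congr rfl fun k _ => ?_
    rw [expMonomial, coeff_mk, Finsupp.equivFunOnFinite_symm_apply_apply, if_pos (dvd_mul_right _ _),
      Nat.mul_div_cancel_left _ (hpos k), logCoeff, mul_pow]
    ring

end

/-! ### Moments of the formal Beta law -/

section

open Polynomial

/-- The quotient `(b)_j / (s)_j` of Pochhammer symbols, the `j`-th moment of a Beta distribution. -/
noncomputable def betaMoment (b s : ℂ) (j : ℕ) : ℂ :=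
  (ascPochhammer ℂ j).eval b / (ascPochhammer ℂ j).eval s

/-- The linear functional on polynomials with moments `betaMoment`. -/
noncomputable def betaFunctional (b s : ℂ) : ℂ[X] →ₗ[ℂ] ℂ :=
  Polynomial.lsum fun j => betaMoment b s j • LinearMap.id

theorem betaMoment_zero (b s : ℂ) : betaMoment b s 0 = 1 := by simp [betaMoment]

theorem betaMoment_succ_left (b s : ℂ) (j : ℕ) :
    betaMoment b s (j + 1) = b / s * betaMoment (b + 1) (s + 1) j := by
  simp only [betaMoment, ascPochhammer_succ_left, eval_mul, eval_X, eval_comp, eval_add, eval_one]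
  rw [mul_div_mul_comm]

theorem betaMoment_succ (b s : ℂ) (j : ℕ) :
    betaMoment b s (j + 1) = betaMoment b s j * ((b + j) / (s + j)) := by
  simp only [betaMoment, ascPochhammer_succ_eval]
  rw [mul_div_mul_comm]

theorem betaFunctional_X_pow (b s : ℂ) (j : ℕ) : betaFunctional b s (X ^ j) = betaMoment b s j := by
  rw [betaFunctional, ← monomial_one_right_eq_X_pow, Polynomial.lsum_apply, sum_monomial_index]
  · simp
  · simp

theorem betaFunctional_one (b s : ℂ) : betaFunctional b s 1 = 1 := by
  have := betaFunctional_X_pow b s 0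
  rwa [pow_zero, betaMoment_zero] at this

theorem betaFunctional_C_mul (b s c : ℂ) (P : ℂ[X]) :
    betaFunctional b s (C c * P) = c * betaFunctional b s P := by
  rw [← smul_eq_C_mul, map_smul, smul_eq_mul]

theorem betaFunctional_X_mul (b s : ℂ) (P : ℂ[X]) :
    betaFunctional b s (X * P) = b / s * betaFunctional (b + 1) (s + 1) P := by
  induction P using Polynomial.induction_on' with
  | add p q hp hq => rw [mul_add, map_add, map_add, hp, hq, mul_add]
  | monomial n a =>
    rw [← C_mul_X_pow_eq_monomial, mul_left_comm, ← pow_succ', betaFunctional_C_mul,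
      betaFunctional_C_mul, betaFunctional_X_pow, betaFunctional_X_pow, betaMoment_succ_left]
    ring

/-- Weighting a Beta law by x^l gives a Beta law again, with both `b` and the total `s` raised by l.
-/
theorem betaFunctional_X_pow_mul (b s : ℂ) (l : ℕ) (P : ℂ[X]) :
    betaFunctional b s (X ^ l * P) = betaMoment b s l * betaFunctional (b + l) (s + l) P := by
  induction l generalizing P with
  | zero => simp [betaMoment_zero]
  | succ l ih =>
    rw [pow_succ, mul_assoc, ih, betaFunctional_X_mul, betaMoment_succ]
    push_cast
    simp only [add_assoc, mul_assoc]

/-- Stein's identity: formally, integration by parts against x^(b-1)(1-x)^(s-b-1). Linearity reduces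
it to monomials, where it is the ratio of consecutive moments. -/
theorem betaFunctional_stein {b s : ℂ} {n : ℕ} (hs : ∀ j ≤ n, s + j ≠ 0) {P : ℂ[X]}
    (hP : P.natDegree ≤ n) :
    betaFunctional b s (X * (1 - X) * derivative P) = betaFunctional b s ((C s * X - C b) * P) := by
  refine Polynomial.induction_with_natDegree_le (fun P => betaFunctional b s
    (X * (1 - X) * derivative P) = betaFunctional b s ((C s * X - C b) * P)) n ?_ ?_ ?_ P hP
  · simp
  · intro j a _ hj
    have e1 : X * (1 - X) * derivative (C a * X ^ j) =
        C (a * j) * X ^ j - C (a * j) * X ^ (j + 1) := by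
      rcases j with _ | j
      · simp
      · rw [derivative_C_mul_X_pow]
        simp only [Nat.add_sub_cancel, map_mul]
        ring
    have e2 : (C s * X - C b) * (C a * X ^ j) = C (s * a) * X ^ (j + 1) - C (b * a) * X ^ j := by
      simp only [map_mul]
      ring
    rw [e1, e2, map_sub, map_sub]
    simp only [betaFunctional_C_mul, betaFunctional_X_pow, betaMoment_succ]
    have := hs j hj
    field_simp
    ring
  · intro f g _ _ hf hg
    rw [derivative_add, mul_add, mul_add, map_add, map_add, hf, hg]

/-- Stein's identity for (X-r)^q, with X(1-X) rewritten as r(1-r) + (1-2r)(X-r) - (X-r)². For q = 0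
the truncated exponent q-1 is harmless because its coefficient is 0. -/
theorem betaFunctional_sub_C_pow_succ {b s : ℂ} (r : ℂ) {q : ℕ} (hs : ∀ j ≤ q, s + j ≠ 0) :
    (s + q) * betaFunctional b s ((X - C r) ^ (q + 1)) =
      (q * (1 - 2 * r) + (b - s * r)) * betaFunctional b s ((X - C r) ^ q) +
        q * (r * (1 - r)) * betaFunctional b s ((X - C r) ^ (q - 1)) := by
  have h := betaFunctional_stein (b := b) hs (P := (X - C r) ^ q) (by
    refine natDegree_pow_le.trans ?_
    rw [natDegree_X_sub_C, mul_one])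
  have e1 : X * (1 - X) * derivative ((X - C r) ^ q) = C (q * (r * (1 - r))) * (X - C r) ^ (q - 1) +
      C (q * (1 - 2 * r)) * (X - C r) ^ q - C (q : ℂ) * (X - C r) ^ (q + 1) := by
    rcases q with _ | q
    · simp
    · rw [derivative_X_sub_C_pow]
      simp only [Nat.add_sub_cancel, map_mul, map_sub, map_natCast, map_one, map_ofNat]
      ring
  have e2 : (C s * X - C b) * (X - C r) ^ q =
      C s * (X - C r) ^ (q + 1) - C (b - s * r) * (X - C r) ^ q := by
    simp only [map_sub, map_mul]
    ring
  rw [e1, e2, map_sub, map_sub, map_add] at h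
  simp only [betaFunctional_C_mul] at h
  linear_combination -h

/-- The exponent of Y is ⌈q/2⌉. In the recurrence, order q+1 gains 1/Y relative to order q-1, so
each two orders win one power. `T` absorbs the coefficients 3q + ‖b-sr‖ and 2q. -/
theorem norm_betaFunctional_sub_C_pow_le {b s r : ℂ} {Y T : ℝ} {M : ℕ} (hY : 1 ≤ Y)
    (hs : ∀ q < M, Y ≤ ‖s + q‖) (hr : ‖r‖ ≤ 1) (hT : 5 * M + ‖b - s * r‖ + 1 ≤ T) :
    ∀ q ≤ M, ‖betaFunctional b s ((X - C r) ^ q)‖ * Y ^ ((q + 1) / 2) ≤ T ^ q := by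
  have hY0 : 0 < Y := by linarith
  have hM0 : (0 : ℝ) ≤ M := Nat.cast_nonneg M
  have hT1 : 1 ≤ T := by linarith [norm_nonneg (b - s * r)]
  have hT0 : 0 ≤ T := by linarith
  have hs0 : ∀ q < M, s + q ≠ 0 := fun q hq h => by
    have := hs q hq
    rw [h, norm_zero] at this
    linarith
  have h2r : ‖1 - 2 * r‖ ≤ 3 := by
    calc ‖1 - 2 * r‖ ≤ ‖(1 : ℂ)‖ + ‖2 * r‖ := norm_sub_le _ _
      _ ≤ 3 := by rw [norm_mul, norm_one, Complex.norm_ofNat]; linarith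
  have hrr : ‖r * (1 - r)‖ ≤ 2 := by
    rw [norm_mul]
    have : ‖1 - r‖ ≤ 2 := (norm_sub_le _ _).trans (by rw [norm_one]; linarith)
    nlinarith [norm_nonneg r, norm_nonneg (1 - r)]
  intro q
  induction q using Nat.strong_induction_on with
  | _ q ih =>
    intro hq
    rcases q with _ | q
    · simp [betaFunctional_one]
    · have hqM : q < M := hq
      have hqM' : (q : ℝ) + 1 ≤ M := by exact_mod_cast hqM
      have hq0 : (0 : ℝ) ≤ q := Nat.cast_nonneg q
      have hrec := congrArg norm (betaFunctional_sub_C_pow_succ (b := b) (s := s) r (q := q)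
        fun j hj => hs0 j (lt_of_le_of_lt hj hqM))
      have h1 : ‖(q : ℂ) * (1 - 2 * r) + (b - s * r)‖ ≤ 3 * q + ‖b - s * r‖ := by
        refine (norm_add_le _ _).trans ?_
        rw [norm_mul, Complex.norm_natCast]
        nlinarith
      have h2 : ‖(q : ℂ) * (r * (1 - r))‖ ≤ 2 * q := by
        rw [norm_mul, Complex.norm_natCast]
        nlinarith
      set m1 := ‖betaFunctional b s ((X - C r) ^ q)‖ with hm1
      set m0 := ‖betaFunctional b s ((X - C r) ^ (q - 1))‖ with hm0
      set m2 := ‖betaFunctional b s ((X - C r) ^ (q + 1))‖ with hm2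
      have hm1' : 0 ≤ m1 := norm_nonneg _
      have hm0' : 0 ≤ m0 := norm_nonneg _
      have hm2' : 0 ≤ m2 := norm_nonneg _
      have h3 : Y * m2 ≤ (3 * q + ‖b - s * r‖) * m1 + 2 * q * m0 := by
        calc Y * m2 ≤ ‖s + q‖ * m2 := mul_le_mul_of_nonneg_right (hs q hqM) hm2'
          _ = _ := by rw [hm2, ← norm_mul]; exact hrec
          _ ≤ _ := norm_add_le _ _
          _ ≤ _ := by
            rw [norm_mul, norm_mul]
            exact add_le_add (mul_le_mul_of_nonneg_right h1 hm1')
              (mul_le_mul_of_nonneg_right h2 hm0')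
      have hk : (q + 1 + 1) / 2 = q / 2 + 1 := by omega
      have h4 : m1 * Y ^ (q / 2) ≤ T ^ q := by
        refine le_trans ?_ (ih q (Nat.lt_succ_self q) hqM.le)
        exact mul_le_mul_of_nonneg_left (pow_le_pow_right₀ hY (by omega)) hm1'
      have h5 : 2 * q * (m0 * Y ^ (q / 2)) ≤ 2 * q * T ^ q := by
        rcases Nat.eq_zero_or_pos q with h | h
        · simp [h]
        · refine mul_le_mul_of_nonneg_left ?_ (by positivity)
          have := ih (q - 1) (by omega) (by omega)
          rw [Nat.sub_add_cancel h] at this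
          exact this.trans (pow_le_pow_right₀ hT1 (by omega))
      have hYp : 0 ≤ Y ^ (q / 2) := by positivity
      have hTp : 0 ≤ T ^ q := by positivity
      rw [hk]
      calc m2 * Y ^ (q / 2 + 1) = Y * m2 * Y ^ (q / 2) := by ring
        _ ≤ ((3 * q + ‖b - s * r‖) * m1 + 2 * q * m0) * Y ^ (q / 2) :=
          mul_le_mul_of_nonneg_right h3 hYp
        _ = (3 * q + ‖b - s * r‖) * (m1 * Y ^ (q / 2)) + 2 * q * (m0 * Y ^ (q / 2)) := by ring
        _ ≤ (3 * q + ‖b - s * r‖) * T ^ q + 2 * q * T ^ q :=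
          add_le_add (mul_le_mul_of_nonneg_left h4 (by positivity)) h5
        _ = (5 * q + ‖b - s * r‖) * T ^ q := by ring
        _ ≤ T * T ^ q := mul_le_mul_of_nonneg_right (by linarith) hTp
        _ = T ^ (q + 1) := by ring

/-- The central moments are the Taylor coefficients `cCoeff` up to normalization. -/
theorem betaFunctional_sub_C_pow_eq {s₁ s₂ : ℂ} {n : ℕ} (hs : ∀ j < n, s₁ + s₂ + j ≠ 0)
    (h0 : s₁ + s₂ ≠ 0) : ∀ q ≤ n,
    betaFunctional s₂ (s₁ + s₂) ((X - C (s₂ / (s₁ + s₂))) ^ q) =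
      q.factorial * cCoeff s₁ s₂ q / (ascPochhammer ℂ q).eval (s₁ + s₂) := by
  intro q
  have hz : s₂ - (s₁ + s₂) * (s₂ / (s₁ + s₂)) = 0 := by field_simp; ring
  induction q using Nat.strong_induction_on with
  | _ q ih =>
    intro hq
    rcases q with _ | _ | q
    · simp [betaFunctional_one, cCoeff_zero]
    · have h := betaFunctional_sub_C_pow_succ (b := s₂) (s := s₁ + s₂) (s₂ / (s₁ + s₂)) (q := 0)
        fun j hj => hs j (lt_of_le_of_lt hj hq)
      rw [hz] at h
      simp only [CharP.cast_eq_zero, zero_mul, add_zero, zero_add] at h ⊢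
      rw [cCoeff_one h0, mul_zero, zero_div]
      exact (mul_eq_zero.1 h).resolve_left h0
    · have h := betaFunctional_sub_C_pow_succ (b := s₂) (s := s₁ + s₂) (s₂ / (s₁ + s₂)) (q := q + 1)
        fun j hj => hs j (lt_of_le_of_lt hj hq)
      have hc := cCoeff_recurrence h0 q
      rw [hz, Nat.add_sub_cancel, ih (q + 1) (by omega) (by omega), ih q (by omega) (by omega)] at h
      have n1 := hs (q + 1) (by omega)
      have n0 := hs q (by omega)
      have np : (ascPochhammer ℂ q).eval (s₁ + s₂) ≠ 0 := by
        rw [Ne, ascPochhammer_eval_eq_zero_iff]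
        rintro ⟨k, hk, hk'⟩
        exact hs k (by omega) (by rw [hk']; ring)
      refine mul_left_cancel₀ n1 (h.trans ?_)
      simp only [ascPochhammer_succ_eval, Nat.factorial_succ]
      generalize s₂ / (s₁ + s₂) = r at *
      generalize (ascPochhammer ℂ q).eval (s₁ + s₂) = p at *
      generalize s₁ + s₂ = s at *
      push_cast at *
      field_simp
      linear_combination (-(q.factorial : ℂ)) * hc

theorem X_mul_sum_choose_sub (r : ℂ) (M j : ℕ) :
    X * ∑ i ∈ Finset.range (M + 1), C (j.choose i * r ^ (j - i)) * (X - C r) ^ i -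
      ∑ i ∈ Finset.range (M + 1), C ((j + 1).choose i * r ^ (j + 1 - i)) * (X - C r) ^ i =
      C (j.choose M * r ^ (j - M)) * (X - C r) ^ (M + 1) := by
  induction M with
  | zero =>
    simp only [zero_add, Finset.sum_range_one, Nat.choose_zero_right, Nat.cast_one, one_mul,
      Nat.sub_zero, pow_zero, mul_one, pow_succ, map_mul, map_one]
    ring
  | succ M ih =>
    rw [Finset.sum_range_succ _ (M + 1), Finset.sum_range_succ _ (M + 1)]
    have e : ((j + 1).choose (M + 1) : ℂ) * r ^ (j + 1 - (M + 1)) =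
        j.choose M * r ^ (j - M) + r * (j.choose (M + 1) * r ^ (j - (M + 1))) := by
      rw [Nat.choose_succ_succ, Nat.add_sub_add_right]
      rcases lt_or_ge j (M + 1) with h | h
      · rw [Nat.choose_eq_zero_of_lt h]
        simp
      · have : j - M = j - (M + 1) + 1 := by omega
        rw [this, pow_succ]
        push_cast
        ring
    rw [e]
    simp only [map_add, map_mul] at ih ⊢
    linear_combination ih

/-- The Taylor remainder of X^j at r, kept as powers of X times (X-r)^(M+1) so that the functional
acts on it by a parameter shift. When l > j-1-M the binomial coefficient vanishes, so the truncated
exponent of r is never felt. -/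
theorem X_pow_sub_sum_choose (r : ℂ) (M j : ℕ) :
    (X : ℂ[X]) ^ j - ∑ i ∈ Finset.range (M + 1), C (j.choose i * r ^ (j - i)) * (X - C r) ^ i =
      ∑ l ∈ Finset.range j, C ((j - 1 - l).choose M * r ^ (j - (M + 1) - l)) *
        (X ^ l * (X - C r) ^ (M + 1)) := by
  induction j with
  | zero =>
    rw [Finset.sum_range_succ']
    simp
  | succ j ih =>
    rw [Finset.sum_range_succ' _ j]
    have e : ∀ l ∈ Finset.range j, C (((j + 1 - 1 - (l + 1)).choose M : ℂ) *
        r ^ (j + 1 - (M + 1) - (l + 1))) * (X ^ (l + 1) * (X - C r) ^ (M + 1)) =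
        X * (C ((j - 1 - l).choose M * r ^ (j - (M + 1) - l)) *
          (X ^ l * (X - C r) ^ (M + 1))) := by
      intro l _
      have h1 : j + 1 - 1 - (l + 1) = j - 1 - l := by omega
      have h2 : j + 1 - (M + 1) - (l + 1) = j - (M + 1) - l := by omega
      rw [h1, h2]
      ring
    rw [Finset.sum_congr rfl e, ← Finset.mul_sum, ← ih]
    simp only [Nat.add_sub_cancel, Nat.sub_zero, pow_zero, one_mul, Nat.add_sub_add_right]
    rw [← X_mul_sum_choose_sub]
    ring

theorem betaMoment_sub_sum_choose (b s r : ℂ) (M j : ℕ) :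
    betaMoment b s j - ∑ i ∈ Finset.range (M + 1),
        j.choose i * r ^ (j - i) * betaFunctional b s ((X - C r) ^ i) =
      ∑ l ∈ Finset.range j, (j - 1 - l).choose M * r ^ (j - (M + 1) - l) *
        (betaMoment b s l * betaFunctional (b + l) (s + l) ((X - C r) ^ (M + 1))) := by
  have h := congrArg (betaFunctional b s) (X_pow_sub_sum_choose r M j)
  simpa only [map_sub, map_sum, betaFunctional_C_mul, betaFunctional_X_pow,
    betaFunctional_X_pow_mul] using h

/-- The number (s-1)/(b-1) plays the role of the moment of order -1. This is the finite geometric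
expansion of 1/X about r, multiplied by X and evaluated with both parameters lowered by 1. -/
theorem inv_betaMoment_sub_sum {b s r : ℂ} (hb : b ≠ 1) (hs : s ≠ 1) (hr : r ≠ 0) (M : ℕ) :
    (s - 1) / (b - 1) - ∑ i ∈ Finset.range M,
        (-1) ^ i * r⁻¹ ^ (i + 1) * betaFunctional b s ((X - C r) ^ i) =
      (s - 1) / (b - 1) * ((-1) ^ M * r⁻¹ ^ M * betaFunctional (b - 1) (s - 1) ((X - C r) ^ M)) := by
  have e : X * ∑ i ∈ Finset.range M, C ((-1) ^ i * r⁻¹ ^ (i + 1)) * (X - C r) ^ i =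
      1 - C ((-1) ^ M * r⁻¹ ^ M) * (X - C r) ^ M := by
    have hC : C r * C r⁻¹ = 1 := by rw [← C_mul, mul_inv_cancel₀ hr, C_1]
    induction M with
    | zero => simp
    | succ M ih =>
      rw [Finset.sum_range_succ, mul_add, ih]
      simp only [map_mul, map_pow, map_neg, map_one]
      linear_combination ((-1) ^ M * C r⁻¹ ^ M * (X - C r) ^ M) * hC
  have h := congrArg (betaFunctional (b - 1) (s - 1)) e
  rw [betaFunctional_X_mul, sub_add_cancel, sub_add_cancel, map_sub, betaFunctional_one,
    betaFunctional_C_mul, map_sum] at h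
  simp only [betaFunctional_C_mul] at h
  have hb' := sub_ne_zero.2 hb
  have hs' := sub_ne_zero.2 hs
  have h' : (b - 1) / (s - 1) * ((s - 1) / (b - 1)) = 1 := by field_simp
  linear_combination (-(s - 1) / (b - 1)) * h + (∑ i ∈ Finset.range M,
        (-1) ^ i * r⁻¹ ^ (i + 1) * betaFunctional b s ((X - C r) ^ i)) * h'

end

/-! ### Taylor expansion of the cotangent -/

section

open Filter Topology

theorem norm_riemannZeta_le_zetaTwo {w : ℂ} (hw : 2 ≤ w.re) : ‖riemannZeta w‖ ≤ zetaTwo := by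
  rw [zeta_eq_tsum_one_div_nat_add_one_cpow (by linarith)]
  refine tsum_of_norm_bounded summable_inv_succ_sq.hasSum fun n => ?_
  have e : ((n : ℂ) + 1) = (((n : ℝ) + 1 : ℝ) : ℂ) := by push_cast; rfl
  have hn : (0 : ℝ) < (n : ℝ) + 1 := by positivity
  rw [norm_div, norm_one, e, Complex.norm_cpow_eq_rpow_re_of_pos hn]
  refine one_div_le_one_div_of_le (by positivity) ?_
  rw [← Real.rpow_two]
  exact Real.rpow_le_rpow_of_exponent_le (by linarith [(Nat.cast_nonneg n : (0 : ℝ) ≤ n)]) hw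

/-- The coefficients `ζ(j+1)`, `j` odd, of the Taylor expansion of the cotangent. -/
noncomputable def oddZeta (j : ℕ) : ℂ := if Odd j then riemannZeta (j + 1) else 0

theorem norm_oddZeta_le (j : ℕ) : ‖oddZeta j‖ ≤ zetaTwo := by
  rw [oddZeta]
  split_ifs with h
  · refine norm_riemannZeta_le_zetaTwo ?_
    have : (1 : ℝ) ≤ j := by exact_mod_cast h.pos
    simp
    linarith
  · simpa using zetaTwo_nonneg

theorem summable_choose_mul_pow_sub (i : ℕ) {R : ℝ} (h0 : 0 ≤ R) (h1 : R < 1) :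
    Summable fun j : ℕ => (j.choose i : ℝ) * R ^ (j - i) := by
  rw [← summable_nat_add_iff i]
  simpa using summable_choose_mul_geometric_of_norm_lt_one i
    (r := R) (by rwa [Real.norm_of_nonneg h0])

theorem summable_coeff_mul_choose {a : ℕ → ℂ} {A : ℝ} (ha : ∀ j, ‖a j‖ ≤ A) (i : ℕ) {z : ℂ}
    (hz : ‖z‖ < 1) : Summable fun j : ℕ => a j * (j.choose i * z ^ (j - i)) := by
  refine Summable.of_norm_bounded ((summable_choose_mul_pow_sub i (norm_nonneg z) hz).mul_left A)
    fun j => ?_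
  rw [norm_mul, norm_mul, norm_pow, Complex.norm_natCast]
  exact mul_le_mul_of_nonneg_right (ha j) (by positivity)

/-- Since (j-i)·C(j,i) = (i+1)·C(j,i+1), the family of divided derivatives of a power series is
stable under differentiation. -/
theorem hasDerivAt_tsum_choose {a : ℕ → ℂ} {A : ℝ} (ha : ∀ j, ‖a j‖ ≤ A) (i : ℕ) {z : ℂ}
    (hz : ‖z‖ < 1) : HasDerivAt (fun w => ∑' j : ℕ, a j * (j.choose i * w ^ (j - i)))
      ((i + 1) * ∑' j : ℕ, a j * (j.choose (i + 1) * z ^ (j - (i + 1)))) z := by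
  obtain ⟨R, hR1, hR2⟩ := exists_between hz
  have hR0 : 0 ≤ R := (norm_nonneg z).trans hR1.le
  have hA : 0 ≤ A := (norm_nonneg _).trans (ha 0)
  rw [← tsum_mul_left]
  refine hasDerivAt_tsum_of_isPreconnected (t := Metric.ball 0 R) (y₀ := z) (y := z)
    (g := fun (j : ℕ) (w : ℂ) => a j * (j.choose i * w ^ (j - i)))
    (g' := fun (j : ℕ) (w : ℂ) => (i + 1) * (a j * (j.choose (i + 1) * w ^ (j - (i + 1)))))
    (u := fun j => (i + 1) * (A * ((j.choose (i + 1) : ℝ) * R ^ (j - (i + 1)))))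
    (((summable_choose_mul_pow_sub (i + 1) hR0 hR2).mul_left A).mul_left _) Metric.isOpen_ball
    (convex_ball 0 R).isPreconnected ?_ ?_ (by simpa using hR1)
    (summable_coeff_mul_choose ha i hz) (by simpa using hR1)
  · intro j w _
    have h := (((hasDerivAt_pow (j - i) w).const_mul (j.choose i : ℂ)).const_mul (a j))
    refine h.congr_deriv ?_
    have h2 : (j.choose (i + 1) : ℂ) * (i + 1) = j.choose i * ((j - i : ℕ) : ℂ) := by
      exact_mod_cast Nat.choose_succ_right_eq j i
    rw [← Nat.sub_sub]
    linear_combination (-(a j * w ^ (j - i - 1))) * h2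
  · intro j w hw
    have hw' : ‖w‖ ≤ R := by simpa using (Metric.mem_ball.1 hw).le
    have : ‖(i : ℂ) + 1‖ = i + 1 := by
      rw [← Nat.cast_add_one, Complex.norm_natCast, Nat.cast_add_one]
    rw [norm_mul, norm_mul, norm_mul, norm_pow, Complex.norm_natCast, this]
    gcongr
    exact ha j

theorem iteratedDeriv_tsum_mul_pow {a : ℕ → ℂ} {A : ℝ} (ha : ∀ j, ‖a j‖ ≤ A) (i : ℕ) :
    ∀ z : ℂ, ‖z‖ < 1 → iteratedDeriv i (fun w => ∑' j : ℕ, a j * w ^ j) z =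
      i.factorial * ∑' j : ℕ, a j * (j.choose i * z ^ (j - i)) := by
  induction i with
  | zero => simp
  | succ i ih =>
    intro z hz
    have hev : iteratedDeriv i (fun w => ∑' j : ℕ, a j * w ^ j) =ᶠ[𝓝 z]
        fun w => i.factorial * ∑' j : ℕ, a j * (j.choose i * w ^ (j - i)) := by
      have : ∀ᶠ w in 𝓝 z, ‖w‖ < 1 := continuous_norm.continuousAt.eventually_lt
        continuousAt_const hz
      filter_upwards [this] with w hw
      exact ih w hw
    rw [iteratedDeriv_succ, hev.deriv_eq, ((hasDerivAt_tsum_choose ha i hz).const_mul _).deriv,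
      Nat.factorial_succ]
    push_cast
    ring

theorem iteratedDeriv_comp_const_mul_field (f : ℂ → ℂ) (c : ℂ) (i : ℕ) :
    iteratedDeriv i (fun z => f (c * z)) = fun z => c ^ i * iteratedDeriv i f (c * z) := by
  induction i with
  | zero => simp
  | succ i ih =>
    ext z
    rw [iteratedDeriv_succ, ih, iteratedDeriv_succ, deriv_const_mul_field,
      deriv_comp_mul_left c (iteratedDeriv i f) z, smul_eq_mul]
    ring

theorem mem_integerComplement_of_norm_lt_one {z : ℂ} (h0 : z ≠ 0) (h1 : ‖z‖ < 1) :
    z ∈ Complex.integerComplement := by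
  rintro ⟨n, rfl⟩
  rw [Complex.norm_intCast] at h1
  have : |n| < 1 := by exact_mod_cast h1
  exact h0 (by simp [Int.abs_lt_one_iff.1 this])

theorem oddZeta_two_mul_add_one (k : ℕ) :
    oddZeta (2 * k + 1) = ∑' n : ℕ, 1 / ((n : ℂ) + 1) ^ (2 * k + 2) := by
  rw [oddZeta, if_pos (odd_two_mul_add_one k)]
  have e : (((2 * k + 1 : ℕ) : ℂ) + 1) = ((2 * k + 2 : ℕ) : ℂ) := by push_cast; ring
  rw [e, zeta_eq_tsum_one_div_nat_add_one_cpow (by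
    rw [Complex.natCast_re]
    have : (0 : ℝ) ≤ k := Nat.cast_nonneg k
    push_cast
    linarith)]
  simp only [Complex.cpow_natCast]

theorem hasSum_cotTerm {z : ℂ} (h0 : z ≠ 0) (h1 : ‖z‖ < 1) (n : ℕ) :
    HasSum (fun k : ℕ => -2 * (1 / ((n : ℂ) + 1) ^ (2 * k + 2) * z ^ (2 * k + 1)))
      (1 / (z - (n + 1)) + 1 / (z + (n + 1))) := by
  have hz := mem_integerComplement_of_norm_lt_one h0 h1
  have hn : ((n : ℂ) + 1) ≠ 0 := Nat.cast_add_one_ne_zero n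
  have hq : ‖(z / (n + 1)) ^ 2‖ < 1 := by
    rw [norm_pow, norm_div]
    have : (1 : ℝ) ≤ ‖(n : ℂ) + 1‖ := by
      rw [← Nat.cast_add_one, Complex.norm_natCast]
      exact_mod_cast Nat.le_add_left 1 n
    have h2 : ‖z‖ / ‖(n : ℂ) + 1‖ < 1 := (div_le_self (norm_nonneg z) this).trans_lt h1
    exact pow_lt_one₀ (by positivity) h2 two_ne_zero
  have h := (hasSum_geometric_of_norm_lt_one hq).mul_left (-2 * (z / (n + 1) ^ 2))
  have m1 : z - (n + 1) ≠ 0 := by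
    intro h'
    apply hz
    exact ⟨(n : ℤ) + 1, by push_cast; linear_combination -h'⟩
  have m2 : z + (n + 1) ≠ 0 := by
    intro h'
    apply hz
    exact ⟨-((n : ℤ) + 1), by push_cast; linear_combination -h'⟩
  have e1 : (fun k : ℕ => -2 * (1 / ((n : ℂ) + 1) ^ (2 * k + 2) * z ^ (2 * k + 1))) =
      fun k : ℕ => -2 * (z / ((n : ℂ) + 1) ^ 2) * ((z / (n + 1)) ^ 2) ^ k := by
    funext k
    rw [← pow_mul, div_pow, pow_add _ (2 * k) 2]
    field_simp
    ring
  have e2 : 1 / (z - (n + 1)) + 1 / (z + (n + 1)) =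
      -2 * (z / ((n : ℂ) + 1) ^ 2) * (1 - (z / (n + 1)) ^ 2)⁻¹ := by
    have m3 : 1 - (z / (n + 1)) ^ 2 ≠ 0 := by
      intro h'
      have : (z - (n + 1)) * (z + (n + 1)) = 0 := by
        field_simp at h'
        linear_combination -h'
      exact (mul_ne_zero m1 m2) this
    have m4 : ((n : ℂ) + 1) ^ 2 - z ^ 2 ≠ 0 := by
      intro h'
      exact (mul_ne_zero m1 m2) (by linear_combination -h')
    have e : 1 - (z / (n + 1)) ^ 2 = (((n : ℂ) + 1) ^ 2 - z ^ 2) / (n + 1) ^ 2 := by field_simp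
    rw [e]
    field_simp
    ring
  rw [e1, e2]
  exact h

theorem summable_cotTerm_double {z : ℂ} (h1 : ‖z‖ < 1) :
    Summable (Function.uncurry fun (n k : ℕ) =>
      -2 * (1 / ((n : ℂ) + 1) ^ (2 * k + 2) * z ^ (2 * k + 1))) := by
  have hg : Summable fun k : ℕ => ‖z‖ ^ k := summable_geometric_of_lt_one (norm_nonneg z) h1
  have := (summable_inv_succ_sq.mul_of_nonneg hg (fun n => by positivity)
    (fun k => by positivity)).mul_left 2
  refine Summable.of_norm_bounded this fun ⟨n, k⟩ => ?_
  simp only [Function.uncurry_apply_pair]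
  have hn : (1 : ℝ) ≤ (n : ℝ) + 1 := by linarith [(Nat.cast_nonneg n : (0 : ℝ) ≤ n)]
  have e : ‖(n : ℂ) + 1‖ = n + 1 := by
    rw [← Nat.cast_add_one, Complex.norm_natCast, Nat.cast_add_one]
  rw [norm_mul, norm_mul, norm_div, norm_pow, norm_pow, e, norm_neg, norm_one, Complex.norm_ofNat]
  refine mul_le_mul_of_nonneg_left (mul_le_mul ?_ ?_ (by positivity) (by positivity)) two_pos.le
  · exact one_div_le_one_div_of_le (by positivity) (pow_le_pow_right₀ hn (by omega))
  · exact pow_le_pow_of_le_one (norm_nonneg z) h1.le (by omega)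

theorem tsum_cotTerm {z : ℂ} (h0 : z ≠ 0) (h1 : ‖z‖ < 1) :
    ∑' n : ℕ, (1 / (z - (n + 1)) + 1 / (z + (n + 1))) =
      -2 * ∑' k : ℕ, oddZeta (2 * k + 1) * z ^ (2 * k + 1) := by
  rw [tsum_congr fun n => (hasSum_cotTerm h0 h1 n).tsum_eq.symm, ← tsum_mul_left]
  have h := Summable.tsum_comm (f := fun (n k : ℕ) =>
      -2 * (1 / ((n : ℂ) + 1) ^ (2 * k + 2) * z ^ (2 * k + 1))) (summable_cotTerm_double h1)
  refine h.symm.trans (tsum_congr fun k => ?_)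
  rw [tsum_mul_left, tsum_mul_right, oddZeta_two_mul_add_one]

theorem tsum_oddZeta {z : ℂ} (h1 : ‖z‖ < 1) : ∑' j : ℕ, oddZeta j * z ^ j =
    ∑' k : ℕ, oddZeta (2 * k + 1) * z ^ (2 * k + 1) := by
  have h0 : ∀ k : ℕ, oddZeta (2 * k) * z ^ (2 * k) = 0 := fun k => by
    rw [oddZeta, if_neg (by simp), zero_mul]
  have hall : Summable fun j : ℕ => oddZeta j * z ^ j := by
    simpa using summable_coeff_mul_choose norm_oddZeta_le 0 h1
  have h3 : Summable fun k : ℕ => oddZeta (2 * k + 1) * z ^ (2 * k + 1) :=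
    hall.comp_injective (i := fun k : ℕ => 2 * k + 1) fun a b h => by simpa using h
  have h2 : Summable fun k : ℕ => oddZeta (2 * k) * z ^ (2 * k) :=
    hall.comp_injective (i := fun k : ℕ => 2 * k) fun a b h => by simpa using h
  have h := tsum_even_add_odd (f := fun j : ℕ => oddZeta j * z ^ j) h2 h3
  rw [tsum_congr h0, tsum_zero, zero_add] at h
  exact h.symm

theorem pi_mul_cot_eq {z : ℂ} (h0 : z ≠ 0) (h1 : ‖z‖ < 1) :
    Real.pi * Complex.cot (Real.pi * z) = z⁻¹ - 2 * ∑' j : ℕ, oddZeta j * z ^ j := by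
  have hc := (cot_series_rep' (mem_integerComplement_of_norm_lt_one h0 h1)).trans
    (tsum_cotTerm h0 h1)
  rw [tsum_oddZeta h1, inv_eq_one_div]
  linear_combination hc

/-- The bracket is the i-th Taylor coefficient of π cot(πw) at w = z. Its two parts pair with the
central moments separately: the pole part with the expansion of 1/X, the series with the expansions
of X^j. -/
theorem pi_pow_mul_iteratedDeriv_cot (i : ℕ) {z : ℂ} (h0 : z ≠ 0) (h1 : ‖z‖ < 1) :
    (Real.pi : ℂ) ^ (i + 1) * iteratedDeriv i Complex.cot (Real.pi * z) = i.factorial *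
      ((-1) ^ i * z⁻¹ ^ (i + 1) - 2 * ∑' j : ℕ, oddZeta j * (j.choose i * z ^ (j - i))) := by
  have hev : (fun w : ℂ => Real.pi * Complex.cot (Real.pi * w)) =ᶠ[𝓝 z]
      (fun w : ℂ => w⁻¹) - fun w => 2 * ∑' j : ℕ, oddZeta j * w ^ j := by
    have a1 : ∀ᶠ w in 𝓝 z, ‖w‖ < 1 := continuous_norm.continuousAt.eventually_lt
      continuousAt_const h1
    filter_upwards [a1, isOpen_ne.mem_nhds h0] with w hw hw0
    exact pi_mul_cot_eq hw0 hw
  have hF : ContDiffAt ℂ i (fun w : ℂ => 2 * ∑' j : ℕ, oddZeta j * w ^ j) z := by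
    refine contDiffAt_const.mul ?_
    have hd : DifferentiableOn ℂ (fun w : ℂ => ∑' j : ℕ, oddZeta j * w ^ j) (Metric.ball 0 1) := by
      intro w hw
      have := hasDerivAt_tsum_choose norm_oddZeta_le 0 (z := w) (by simpa using hw)
      simp only [Nat.choose_zero_right, Nat.cast_one, one_mul, Nat.sub_zero] at this
      exact this.differentiableAt.differentiableWithinAt
    exact (hd.analyticAt (Metric.isOpen_ball.mem_nhds (by simpa using h1))).contDiffAt
  have h := hev.iteratedDeriv_eq i
  rw [iteratedDeriv_sub (contDiffAt_inv ℂ h0) hF, iteratedDeriv_const_mul_field,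
    iteratedDeriv_const_mul_field, iteratedDeriv_tsum_mul_pow norm_oddZeta_le i z h1,
    iteratedDeriv_comp_const_mul_field, iteratedDeriv_eq_iterate (f := fun w : ℂ => w⁻¹)] at h
  have hi : deriv^[i] (fun w : ℂ => w⁻¹) z = (-1) ^ i * i.factorial * z⁻¹ ^ (i + 1) := by
    have := iter_deriv_inv i z
    have e : z ^ (-1 - i : ℤ) = z⁻¹ ^ (i + 1) := by
      rw [← zpow_natCast, inv_zpow, ← zpow_neg]
      congr 1
      push_cast
      ring
    rwa [e] at this
  rw [hi] at h
  linear_combination h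

end

/-! ### Functional equation and the exact formula for the quotient by f -/

section

theorem riemannZeta_eq_zetaFactor_mul {w : ℂ} (hw : w.re < 0) : riemannZeta w =
    zetaFactor w * Complex.sin (Real.pi / 2 * w) * riemannZeta (1 - w) := by
  have h1 : ∀ n : ℕ, 1 - w ≠ -n := fun n h => by
    have := congrArg Complex.re h
    simp at this
    linarith [(Nat.cast_nonneg n : (0 : ℝ) ≤ n)]
  have h2 : 1 - w ≠ 1 := fun h => by
    have := congrArg Complex.re h
    simp at this
    linarith
  have h := riemannZeta_one_sub h1 h2
  rw [sub_sub_cancel] at h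
  have e1 : Real.pi * (1 - w) / 2 = Real.pi / 2 - Real.pi / 2 * w := by ring
  have e2 : (2 : ℂ) * (2 * Real.pi) ^ (-(1 - w)) = 2 ^ w * (Real.pi : ℂ) ^ (w - 1) := by
    have := Complex.mul_cpow_ofReal_nonneg (a := 2) (b := Real.pi) (by norm_num)
      Real.pi_pos.le (w - 1)
    rw [Complex.ofReal_ofNat] at this
    rw [neg_sub, this, Complex.cpow_sub _ _ two_ne_zero, Complex.cpow_one]
    ring
  rw [h, e1, e2, Complex.cos_pi_div_two_sub, zetaFactor]

theorem zetaFactor_ne_zero {s : ℂ} (hs : s.re < 1) : zetaFactor s ≠ 0 := by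
  have hpi : (Real.pi : ℂ) ≠ 0 := Complex.ofReal_ne_zero.2 Real.pi_ne_zero
  refine mul_ne_zero (mul_ne_zero ?_ ?_) (Complex.Gamma_ne_zero_of_re_pos (by simpa using hs))
  · simp [Complex.cpow_eq_zero_iff]
  · simp [Complex.cpow_eq_zero_iff]

theorem mul_zetaFactor_add_one {s : ℂ} (hs : s ≠ 0) :
    s * zetaFactor (s + 1) = -(2 * Real.pi) * zetaFactor s := by
  have hpi : (Real.pi : ℂ) ≠ 0 := Complex.ofReal_ne_zero.2 Real.pi_ne_zero
  have h := Complex.Gamma_add_one (-s) (neg_ne_zero.2 hs)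
  have e1 : 1 - (s + 1) = -s := by ring
  have e2 : 1 - s = -s + 1 := by ring
  have e3 : s + 1 - 1 = (s - 1) + 1 := by ring
  rw [zetaFactor, zetaFactor, e1, e2, h, e3, Complex.cpow_add _ _ two_ne_zero,
    Complex.cpow_add _ _ hpi, Complex.cpow_one, Complex.cpow_one]
  ring

theorem ascPochhammer_mul_zetaFactor_add {s : ℂ} (k : ℕ) (hs : ∀ i < k, s + i ≠ 0) :
    (ascPochhammer ℂ k).eval s * zetaFactor (s + k) = (-(2 * Real.pi)) ^ k * zetaFactor s := by
  induction k with
  | zero => simp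
  | succ k ih =>
    have h := mul_zetaFactor_add_one (hs k (Nat.lt_succ_self k))
    have ih' := ih fun i hi => hs i (hi.trans (Nat.lt_succ_self k))
    rw [ascPochhammer_succ_eval]
    push_cast
    rw [← add_assoc]
    linear_combination (ascPochhammer ℂ k).eval s * h - (2 * Real.pi) * ih'

theorem sin_pi_div_two_mul_add_odd (s : ℂ) (i : ℕ) :
    Complex.sin (Real.pi / 2 * (s + (2 * i + 1 : ℕ))) =
      (-1) ^ i * Complex.cos (Real.pi / 2 * s) := by
  have e : Real.pi / 2 * (s + (2 * i + 1 : ℕ)) = Real.pi / 2 * s + Real.pi / 2 + i * Real.pi := by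
    push_cast
    ring
  rw [e, Complex.sin_antiperiodic.add_nat_mul_eq, Complex.sin_add_pi_div_two]

/-- The functional equation at s+k, k = 2i+1, produces f(s+k) = (-2π)^k f(s)/(s)_k. The powers of 2π
cancel against the Taylor coefficient up to one factor, and (s₂)_k/(s)_k is a Beta moment. -/
theorem bernCoeff_mul_riemannZeta_div {s₂ s : ℂ} {i : ℕ} (hs : s.re < -(2 * i + 1)) :
    bernCoeff i * (ascPochhammer ℂ (2 * i + 1)).eval s₂ * riemannZeta (s + (2 * i + 1 : ℕ)) /
      zetaFactor s = -(Complex.cos (Real.pi / 2 * s) / Real.pi) *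
        (oddZeta (2 * i + 1) * (betaMoment s₂ s (2 * i + 1) *
          riemannZeta (1 - s - (2 * i + 1 : ℕ)))) := by
  have hi0 : (0 : ℝ) ≤ i := Nat.cast_nonneg i
  have hpi : (Real.pi : ℂ) ≠ 0 := Complex.ofReal_ne_zero.2 Real.pi_ne_zero
  have hne : ∀ j < 2 * i + 1, s + j ≠ 0 := fun j hj h => by
    have h1 := congrArg Complex.re h
    have h2 : (j : ℝ) < 2 * i + 1 := by exact_mod_cast hj
    simp at h1
    linarith
  have hf := zetaFactor_ne_zero (s := s) (by linarith)
  have hP : (ascPochhammer ℂ (2 * i + 1)).eval s ≠ 0 := by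
    rw [Ne, ascPochhammer_eval_eq_zero_iff]
    rintro ⟨k, hk, hk'⟩
    exact hne k hk (by rw [hk']; ring)
  have h := ascPochhammer_mul_zetaFactor_add (2 * i + 1) hne
  have h' : zetaFactor (s + (2 * i + 1 : ℕ)) =
      (-(2 * Real.pi)) ^ (2 * i + 1) * zetaFactor s / (ascPochhammer ℂ (2 * i + 1)).eval s := by
    rw [eq_div_iff hP, ← h, mul_comm]
  rw [riemannZeta_eq_zetaFactor_mul (w := s + (2 * i + 1 : ℕ)) (by simp; linarith),
    sin_pi_div_two_mul_add_odd, ← sub_sub 1 s, h', ofReal_bernCoeff, oddZeta,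
    if_pos (odd_two_mul_add_one i), betaMoment]
  have hsgn : ((-1 : ℂ) ^ i) * (-1) ^ i = 1 := by rw [← mul_pow]; simp
  have hodd : (-(2 * Real.pi : ℂ)) ^ (2 * i + 1) = -(2 * Real.pi) ^ (2 * i + 1) :=
    (odd_two_mul_add_one i).neg_pow _
  have h2pi : (2 * Real.pi : ℂ) ≠ 0 := mul_ne_zero two_ne_zero hpi
  have hc : (2 * Real.pi : ℂ) ^ (2 * i + 2) = (2 * Real.pi) ^ (2 * i + 1) * (2 * Real.pi) :=
    pow_succ _ _
  rw [hodd, hc]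
  have hpp := pow_ne_zero (2 * i + 1) h2pi
  generalize (2 * Real.pi : ℂ) ^ (2 * i + 1) = q at *
  generalize (ascPochhammer ℂ (2 * i + 1)).eval s = u at *
  generalize (ascPochhammer ℂ (2 * i + 1)).eval s₂ = v at *
  generalize riemannZeta (1 - s - (2 * i + 1 : ℕ)) = z₁ at *
  generalize riemannZeta ((2 * i + 1 : ℕ) + 1) = z₂ at *
  generalize Complex.cos (Real.pi / 2 * s) = c at *
  field_simp
  linear_combination (-(z₂ * v * c * z₁)) * hsgn

theorem sum_range_two_mul_oddZeta (g : ℕ → ℂ) (p : ℕ) :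
    ∑ j ∈ Finset.range (2 * p), oddZeta j * g j =
      ∑ i ∈ Finset.range p, oddZeta (2 * i + 1) * g (2 * i + 1) := by
  induction p with
  | zero => simp
  | succ p ih =>
    have h0 : oddZeta (2 * p) = 0 := by rw [oddZeta, if_neg (by simp)]
    rw [mul_add, mul_one, Finset.sum_range_succ, Finset.sum_range_succ, ih,
      Finset.sum_range_succ _ p, h0, zero_mul, add_zero]

theorem inv_Gamma_eq {z : ℂ} (hz : z.re < 1) : (Complex.Gamma z)⁻¹ =
    Complex.Gamma (1 - z) * Complex.sin (Real.pi * z) / Real.pi := by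
  have h := congrArg (·⁻¹) (Complex.Gamma_mul_Gamma_one_sub z)
  have h1 : Complex.Gamma (1 - z) ≠ 0 := Complex.Gamma_ne_zero_of_re_pos (by simpa using hz)
  simp only [mul_inv, inv_div] at h
  rw [mul_div_assoc, ← h]
  field_simp

/-- An identity without error. Every zeta value in the first two terms now has argument of positive
real part, hence is close to 1 when that real part is large, and the third term is already the one
in the asymptotic formula. -/
theorem doubleZeta_div_zetaFactor {p : ℕ} (hp : 1 ≤ p) {s₁ s₂ : ℂ} (h2 : -(2 * p : ℝ) < s₂.re)
    (h2' : s₂.re < 1) (h1 : s₁.re < 0) (h : (s₁ + s₂).re < 1 - 2 * p)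
    (hs : ∀ k : ℤ, s₁ + s₂ ≠ 2 * (k : ℂ)) :
    doubleZeta s₁ s₂ / zetaFactor (s₁ + s₂) =
      -(1 / 2) * Complex.sin (Real.pi / 2 * (s₁ + s₂)) * riemannZeta (1 - (s₁ + s₂)) +
      Complex.cos (Real.pi / 2 * (s₁ + s₂)) / (2 * Real.pi) *
        ((s₁ + s₂ - 1) / (s₂ - 1) * riemannZeta (2 - (s₁ + s₂)) -
          2 * ∑ j ∈ Finset.range (2 * p), oddZeta j *
            (betaMoment s₂ (s₁ + s₂) j * riemannZeta (1 - (s₁ + s₂) - j))) +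
      Complex.sin (Real.pi * s₂) * Complex.Gamma (1 - s₁) * Complex.Gamma (1 - s₂)
        * riemannZeta (2 - s₁ - s₂) / (4 * Real.pi * Complex.Gamma (1 - s₁ - s₂)
          * Complex.sin (Real.pi / 2 * (s₁ + s₂))) +
      Complex.Gamma (1 - s₁) * (Complex.Gamma s₂)⁻¹ * freqInt p s₁ s₂ / zetaFactor (s₁ + s₂) := by
  have hp' : (1 : ℝ) ≤ p := by exact_mod_cast hp
  have hpi : (Real.pi : ℂ) ≠ 0 := Complex.ofReal_ne_zero.2 Real.pi_ne_zero
  have hs2 : s₂ ≠ 1 := fun h' => by rw [h'] at h2'; simp at h2'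
  rw [doubleZeta_eq_lipschitzZeta hp h2 hs2 h1 h hs, lipschitzZeta]
  have e1 : 2 - s₁ - s₂ = 2 - (s₁ + s₂) := by ring
  have e2 : 1 - s₁ - s₂ = 1 - (s₁ + s₂) := by ring
  rw [e1, e2]
  have hsin := sin_half_pi_mul_ne_zero hs
  generalize s₁ + s₂ = s at *
  have hre : s.re < 0 := by linarith
  have hf := zetaFactor_ne_zero (s := s) (by linarith)
  have hG : Complex.Gamma (1 - s) ≠ 0 := Complex.Gamma_ne_zero_of_re_pos (by simp; linarith)
  have t1 : riemannZeta (s - 1) / (s₂ - 1) / zetaFactor s =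
      Complex.cos (Real.pi / 2 * s) / (2 * Real.pi) *
        ((s - 1) / (s₂ - 1) * riemannZeta (2 - s)) := by
    have a1 := mul_zetaFactor_add_one (s := s - 1) (fun h' => by
      have := congrArg Complex.re h'
      simp at this
      linarith)
    rw [sub_add_cancel] at a1
    have a2 : Complex.sin (Real.pi / 2 * (s - 1)) = -Complex.cos (Real.pi / 2 * s) := by
      have : Real.pi / 2 * (s - 1) = Real.pi / 2 * s - Real.pi / 2 := by ring
      rw [this, Complex.sin_sub_pi_div_two]
    have a3 : 1 - (s - 1) = 2 - s := by ring
    have a4 : zetaFactor (s - 1) = -((s - 1) * zetaFactor s) / (2 * Real.pi) := by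
      rw [a1]
      field_simp
    rw [riemannZeta_eq_zetaFactor_mul (w := s - 1) (by simp; linarith), a2, a3, a4]
    have hs2' := sub_ne_zero.2 hs2
    field_simp
  have t2 : riemannZeta s / 2 / zetaFactor s =
      1 / 2 * Complex.sin (Real.pi / 2 * s) * riemannZeta (1 - s) := by
    rw [riemannZeta_eq_zetaFactor_mul hre]
    field_simp
  have t3 : (∑ i ∈ Finset.range p, bernCoeff i * (ascPochhammer ℂ (2 * i + 1)).eval s₂ *
      riemannZeta (s + (2 * i + 1 : ℕ))) / zetaFactor s = -(Complex.cos (Real.pi / 2 * s) / Real.pi) *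
        ∑ j ∈ Finset.range (2 * p), oddZeta j *
            (betaMoment s₂ s j * riemannZeta (1 - s - j)) := by
    rw [sum_range_two_mul_oddZeta, Finset.sum_div, Finset.mul_sum]
    refine Finset.sum_congr rfl fun i hi => bernCoeff_mul_riemannZeta_div ?_
    have : (i : ℝ) + 1 ≤ p := by exact_mod_cast Finset.mem_range.1 hi
    linarith
  have t4 : (Complex.Gamma s₂)⁻¹ * (Complex.Gamma (1 - s₁) *
      ((2 * Real.pi) ^ (s - 2) * Real.pi / Complex.sin (Real.pi / 2 * s) *
        riemannZeta (2 - s))) / zetaFactor s =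
      Complex.sin (Real.pi * s₂) * Complex.Gamma (1 - s₁) * Complex.Gamma (1 - s₂)
        * riemannZeta (2 - s) / (4 * Real.pi * Complex.Gamma (1 - s)
          * Complex.sin (Real.pi / 2 * s)) := by
    have e2 : (2 * Real.pi : ℂ) ^ (s - 2) = 2 ^ s * (Real.pi : ℂ) ^ (s - 1) / (4 * Real.pi) := by
      have := Complex.mul_cpow_ofReal_nonneg (a := 2) (b := Real.pi) (by norm_num)
        Real.pi_pos.le (s - 2)
      rw [Complex.ofReal_ofNat] at this
      have e3 : s - 1 = (s - 2) + 1 := by ring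
      rw [this, Complex.cpow_sub _ _ two_ne_zero, e3, Complex.cpow_add _ _ hpi, Complex.cpow_one,
        Complex.cpow_ofNat]
      field_simp
      norm_num
    have hc1 : (2 : ℂ) ^ s ≠ 0 := by simp [Complex.cpow_eq_zero_iff]
    have hc2 : (Real.pi : ℂ) ^ (s - 1) ≠ 0 := by simp [Complex.cpow_eq_zero_iff]
    rw [inv_Gamma_eq h2', e2, zetaFactor]
    field_simp
  rw [add_div, add_div, sub_div, t1, t2, t3, mul_add, mul_add, add_div, t4]
  ring

end

/-! ### Exponential smallness of the nonzero frequencies and of ζ - 1 -/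

section

open MeasureTheory Filter Topology Set

theorem integrableOn_min_one_rpow : IntegrableOn (fun x : ℝ => min 1 (x ^ (-2 : ℝ))) (Ioi 0) := by
  refine integrableOn_rpow_min (a := 0) (b := -2) (A := 1) (B := 1) (by norm_num) (by norm_num)
    (Measurable.aestronglyMeasurable (by fun_prop)) (fun x hx _ => ?_) (fun x hx => ?_)
  · rw [abs_of_nonneg (by positivity), Real.rpow_zero, one_mul]
    exact min_le_left _ _
  · have : 0 < x := by linarith
    rw [abs_of_nonneg (by positivity), one_mul]
    exact min_le_right _ _

/-- Since σ+2p lies in [0,2], the remainder contributes at most 1 near 0 and at most x² at infinity,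
and x^(-4) beats the latter. The dependence on p is confined to the power of 2π. -/
theorem freq_bound_le {p : ℕ} {σ x : ℝ} (hx : 0 < x) (h0 : -(2 * p : ℝ) ≤ σ) (h2 : σ ≤ 2 - 2 * p) :
    min 1 (x ^ (-4 : ℝ)) * (x ^ (σ - 1) * |bernTail p x|) ≤
      2 * zetaTwo / (2 * Real.pi) ^ (2 * p + 2) * min 1 (x ^ (-2 : ℝ)) := by
  have hz := zetaTwo_nonneg
  have h := abs_bernTail_le p x
  rw [abs_of_pos hx] at h
  have e : x ^ (σ - 1) * x ^ (2 * p + 1) = x ^ (σ + 2 * p) := by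
    rw [← Real.rpow_natCast, ← Real.rpow_add hx]
    congr 1
    push_cast
    ring
  have hm : min 1 (x ^ (-4 : ℝ)) * x ^ (σ + 2 * p) ≤ min 1 (x ^ (-2 : ℝ)) := by
    rcases le_total x 1 with h1 | h1
    · have a1 : x ^ (σ + 2 * p) ≤ 1 := Real.rpow_le_one hx.le h1 (by linarith)
      have a2 : min 1 (x ^ (-4 : ℝ)) ≤ 1 := min_le_left _ _
      have a3 : (1 : ℝ) ≤ x ^ (-2 : ℝ) := Real.one_le_rpow_of_pos_of_le_one_of_nonpos hx h1 (by norm_num)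
      rw [min_eq_left a3]
      exact mul_le_one₀ a2 (by positivity) a1
    · have a3 : x ^ (-2 : ℝ) ≤ 1 := Real.rpow_le_one_of_one_le_of_nonpos h1 (by norm_num)
      rw [min_eq_right a3]
      calc _ ≤ x ^ (-4 : ℝ) * x ^ (2 : ℝ) := by
            gcongr
            · exact min_le_right _ _
            linarith
        _ = x ^ (-2 : ℝ) := by rw [← Real.rpow_add hx]; norm_num
  calc _ ≤ min 1 (x ^ (-4 : ℝ)) * (x ^ (σ - 1) *
        (2 * zetaTwo / (2 * Real.pi) ^ (2 * p + 2) * x ^ (2 * p + 1))) := by gcongr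
    _ = 2 * zetaTwo / (2 * Real.pi) ^ (2 * p + 2) * (min 1 (x ^ (-4 : ℝ)) *
        (x ^ (σ - 1) * x ^ (2 * p + 1))) := by ring
    _ ≤ _ := by
      rw [e]
      gcongr

theorem two_pi_mul_abs_rpow_le {v : ℝ} (hv : 2 ≤ v) (n : ℤ) :
    (2 * Real.pi * |(n : ℝ)|) ^ (-v) ≤ (2 * Real.pi) ^ (-v) * |(n : ℝ)| ^ (-2 : ℝ) := by
  rw [Real.mul_rpow (by positivity) (abs_nonneg _)]
  refine mul_le_mul_of_nonneg_left ?_ (by positivity)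
  rcases eq_or_ne n 0 with rfl | hn
  · simp only [Int.cast_zero, abs_zero]
    rw [Real.zero_rpow (by linarith), Real.zero_rpow (by norm_num)]
  · have : (1 : ℝ) ≤ |(n : ℝ)| := by exact_mod_cast Int.one_le_abs hn
    exact Real.rpow_le_rpow_of_exponent_le this (by linarith)

/-- The constant must be uniform in p, which grows with -Re s₂; hence the powers of 2π are tracked
exactly, to be balanced later against the size of f. -/
theorem norm_freqInt_le : ∃ K : ℝ, 0 ≤ K ∧ ∀ (p : ℕ) (s₁ s₂ : ℂ), 1 ≤ p → -(2 * p : ℝ) < s₂.re →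
    s₂.re ≤ 2 - 2 * p → s₁.re ≤ -5 → (s₁ + s₂).re < 1 - 2 * p →
    ‖freqInt p s₁ s₂‖ ≤ K * Real.exp (Real.pi * |s₁.im|) * (2 * Real.pi) ^ (s₁.re - 2 * p) := by
  set K1 := ∑' n : ℤ, |(n : ℝ)| ^ (-2 : ℝ) with hK1
  set K2 := ∫ x in Ioi (0 : ℝ), min 1 (x ^ (-2 : ℝ)) with hK2
  have hK1s : HasSum (fun n : ℤ => |(n : ℝ)| ^ (-2 : ℝ)) K1 :=
    (Real.summable_abs_int_rpow one_lt_two).hasSum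
  have hK1' : 0 ≤ K1 := tsum_nonneg fun _ => by positivity
  have hK2' : 0 ≤ K2 := setIntegral_nonneg measurableSet_Ioi fun x hx => by
    have : 0 < x := hx
    positivity
  have hz := zetaTwo_nonneg
  refine ⟨2 * Real.pi * (2 * zetaTwo * K1 * K2), by positivity, ?_⟩
  intro p s₁ s₂ hp h0 h2 h1 h
  have hint := integrable_freqTerm hp h0 (by linarith) h
  rw [freqInt, integral_count_prod hint]
  -- With u = 4 this gives u+v = 1 - Re s₁, and Re s₁ ≤ -5 ensures v ≥ 2.
  set v := -s₁.re - 3 with hv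
  have hterm : ∀ n : ℤ, ‖∫ x in Ioi (0 : ℝ), freqTerm p s₁ s₂ n x‖ ≤
      Real.exp (Real.pi * |s₁.im|) * (2 * Real.pi) ^ (-v) *
        (2 * zetaTwo / (2 * Real.pi) ^ (2 * p + 2) * K2) * |(n : ℝ)| ^ (-2 : ℝ) := by
    intro n
    have hb : ∀ x ∈ Ioi (0 : ℝ), ‖freqTerm p s₁ s₂ n x‖ ≤
        Real.exp (Real.pi * |s₁.im|) * (2 * Real.pi) ^ (-v) * |(n : ℝ)| ^ (-2 : ℝ) *
        (2 * zetaTwo / (2 * Real.pi) ^ (2 * p + 2)) * min 1 (x ^ (-2 : ℝ)) := by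
      intro x hx
      have hx0 : 0 < x := hx
      refine (norm_freqTerm_le p (u := 4) (v := v) (by norm_num) (by linarith) (by linarith) n
        hx0).trans ?_
      calc _ ≤ Real.exp (Real.pi * |s₁.im|) * ((2 * Real.pi) ^ (-v) * |(n : ℝ)| ^ (-2 : ℝ)) *
            (2 * zetaTwo / (2 * Real.pi) ^ (2 * p + 2) * min 1 (x ^ (-2 : ℝ))) := by
            exact mul_le_mul (mul_le_mul_of_nonneg_left
              (two_pi_mul_abs_rpow_le (by linarith) n) (Real.exp_pos _).le)
              (freq_bound_le hx0 h0.le h2) (by positivity) (by positivity)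
        _ = _ := by ring
    refine (norm_integral_le_of_norm_le (integrableOn_min_one_rpow.const_mul _)
      ((ae_restrict_iff' measurableSet_Ioi).2 (ae_of_all _ hb))).trans (le_of_eq ?_)
    rw [integral_const_mul, ← hK2]
    ring
  refine (tsum_of_norm_bounded (hK1s.mul_left _) hterm).trans (le_of_eq ?_)
  have h2pi : 0 < 2 * Real.pi := by positivity
  have e : (2 * Real.pi) ^ (-v) / (2 * Real.pi) ^ (2 * p + 2) =
      2 * Real.pi * (2 * Real.pi) ^ (s₁.re - 2 * p) := by
    rw [← Real.rpow_natCast, ← Real.rpow_sub h2pi]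
    nth_rewrite 2 [← Real.rpow_one (2 * Real.pi)]
    rw [← Real.rpow_add h2pi]
    congr 1
    push_cast
    rw [hv]
    ring
  calc _ = (2 * zetaTwo * K1 * K2) * Real.exp (Real.pi * |s₁.im|) *
        ((2 * Real.pi) ^ (-v) / (2 * Real.pi) ^ (2 * p + 2)) := by ring
    _ = _ := by rw [e]; ring

theorem norm_zetaFactor (s : ℂ) :
    ‖zetaFactor s‖ = (2 * Real.pi) ^ s.re / Real.pi * ‖Complex.Gamma (1 - s)‖ := by
  have e : (2 : ℂ) = ((2 : ℝ) : ℂ) := by simp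
  rw [zetaFactor, norm_mul, norm_mul, e, Complex.norm_cpow_eq_rpow_re_of_pos two_pos,
    Complex.norm_cpow_eq_rpow_re_of_pos Real.pi_pos, Real.mul_rpow two_pos.le Real.pi_pos.le,
    Complex.sub_re, Complex.one_re, Real.rpow_sub Real.pi_pos, Real.rpow_one]
  ring

/-- The integrand is at most (x(1-x))^m, and x(1-x) ≤ 1/4 on the unit interval. This is the source
of the exponential gain. -/
theorem norm_betaIntegral_le {s₁ s₂ : ℂ} {m : ℝ} (hm : 0 ≤ m) (h1 : s₁.re ≤ -m) (h2 : s₂.re ≤ -m) :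
    ‖Complex.betaIntegral (1 - s₁) (1 - s₂)‖ ≤ (1 / 4) ^ m := by
  rw [Complex.betaIntegral]
  refine (intervalIntegral.norm_integral_le_of_norm_le_const_ae (C := (1 / 4 : ℝ) ^ m) ?_).trans
    (by simp)
  have hne : ∀ᵐ x : ℝ, x ≠ 1 := by simp [ae_iff]
  filter_upwards [hne] with x hx1 hx
  rw [uIoc_of_le zero_le_one] at hx
  have hx0 : 0 < x := hx.1
  have hx1' : 0 < 1 - x := sub_pos.2 (lt_of_le_of_ne hx.2 hx1)
  have e : (1 : ℂ) - x = ((1 - x : ℝ) : ℂ) := by push_cast; rfl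
  rw [norm_mul, e, Complex.norm_cpow_eq_rpow_re_of_pos hx0, Complex.norm_cpow_eq_rpow_re_of_pos hx1']
  calc _ ≤ x ^ m * (1 - x) ^ m := by
        refine mul_le_mul (Real.rpow_le_rpow_of_exponent_ge hx0 hx.2 (by simp; linarith))
          (Real.rpow_le_rpow_of_exponent_ge hx1' (by linarith) (by simp; linarith))
          (by positivity) (by positivity)
    _ = (x * (1 - x)) ^ m := (Real.mul_rpow hx0.le hx1'.le).symm
    _ ≤ (1 / 4) ^ m := Real.rpow_le_rpow (by positivity) (by nlinarith [sq_nonneg (x - 1 / 2)]) hm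

theorem norm_sin_le_exp (z : ℂ) : ‖Complex.sin z‖ ≤ Real.exp |z.im| := by
  have h : Complex.sin z = (Complex.exp (-z * Complex.I) - Complex.exp (z * Complex.I)) *
    Complex.I / 2 := rfl
  rw [h, norm_div, norm_mul, Complex.norm_I, mul_one, Complex.norm_ofNat]
  have h1 : ‖Complex.exp (-z * Complex.I)‖ ≤ Real.exp |z.im| := by
    rw [Complex.norm_exp]
    exact Real.exp_le_exp.2 (by simpa using le_abs_self z.im)
  have h2 : ‖Complex.exp (z * Complex.I)‖ ≤ Real.exp |z.im| := by
    rw [Complex.norm_exp]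
    exact Real.exp_le_exp.2 (by simpa using neg_le_abs z.im)
  linarith [norm_sub_le (Complex.exp (-z * Complex.I)) (Complex.exp (z * Complex.I))]

theorem norm_cos_le_exp (z : ℂ) : ‖Complex.cos z‖ ≤ Real.exp |z.im| := by
  have := norm_sin_le_exp (z + Real.pi / 2)
  rw [Complex.sin_add_pi_div_two] at this
  have e : (z + Real.pi / 2 : ℂ).im = z.im := by
    have : (Real.pi / 2 : ℂ) = ((Real.pi / 2 : ℝ) : ℂ) := by push_cast; rfl
    rw [this, Complex.add_im, Complex.ofReal_im, add_zero]
  rwa [e] at this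

/-- The contribution of the nonzero frequencies is exponentially small. -/
theorem norm_freqInt_div_zetaFactor_le : ∃ K : ℝ, 0 ≤ K ∧ ∀ (p : ℕ) (s₁ s₂ : ℂ) (m : ℝ), 1 ≤ p →
    -(2 * p : ℝ) < s₂.re → s₂.re ≤ 2 - 2 * p → s₁.re ≤ -5 → (s₁ + s₂).re < 1 - 2 * p →
    0 ≤ m → s₁.re ≤ -m → s₂.re ≤ -m →
    ‖Complex.Gamma (1 - s₁) * (Complex.Gamma s₂)⁻¹ * freqInt p s₁ s₂ / zetaFactor (s₁ + s₂)‖ ≤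
      K * Real.exp (Real.pi * (|s₁.im| + |s₂.im|)) * ‖1 - (s₁ + s₂)‖ * (1 / 4) ^ m := by
  obtain ⟨K, hK, hfreq⟩ := norm_freqInt_le
  refine ⟨K, hK, ?_⟩
  intro p s₁ s₂ m hp h0 h2 h1 h hm hm1 hm2
  have hF := hfreq p s₁ s₂ hp h0 h2 h1 h
  have hre : (s₁ + s₂).re = s₁.re + s₂.re := Complex.add_re _ _
  have hp' : (1 : ℝ) ≤ p := by exact_mod_cast hp
  have hG : Complex.Gamma (1 - (s₁ + s₂)) ≠ 0 :=
    Complex.Gamma_ne_zero_of_re_pos (by simp; linarith)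
  have hne : 1 - (s₁ + s₂) ≠ 0 := fun h' => by
    have := congrArg Complex.re h'
    simp at this
    linarith
  -- By reflection 1/Γ(s₂) becomes Γ(1-s₂) sin(πs₂)/π. The resulting Gamma product is a Beta
  -- integral times Γ(2-s), and Γ(2-s) = (1-s)Γ(1-s) cancels the Gamma factor of f(s).
  have hbeta : Complex.Gamma (1 - s₁) * Complex.Gamma (1 - s₂) = (1 - (s₁ + s₂)) *
      Complex.Gamma (1 - (s₁ + s₂)) * Complex.betaIntegral (1 - s₁) (1 - s₂) := by
    rw [Complex.Gamma_mul_Gamma_eq_betaIntegral (by simp; linarith) (by simp; linarith),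
      ← Complex.Gamma_add_one _ hne]
    congr 2
    ring
  have e1 : Complex.Gamma (1 - s₁) * (Complex.Gamma s₂)⁻¹ * freqInt p s₁ s₂ / zetaFactor (s₁ + s₂) =
      (1 - (s₁ + s₂)) * Complex.betaIntegral (1 - s₁) (1 - s₂) * Complex.sin (Real.pi * s₂) *
        (Complex.Gamma (1 - (s₁ + s₂)) / (Real.pi * zetaFactor (s₁ + s₂))) * freqInt p s₁ s₂ := by
    rw [inv_Gamma_eq (by linarith)]
    linear_combination (Complex.sin (Real.pi * s₂) / Real.pi * freqInt p s₁ s₂ /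
      zetaFactor (s₁ + s₂)) * hbeta
  have hpi := Real.pi_pos
  have h2pi : 0 < 2 * Real.pi := by positivity
  have e2 : ‖Complex.Gamma (1 - (s₁ + s₂)) / (Real.pi * zetaFactor (s₁ + s₂))‖ =
      (2 * Real.pi) ^ (-(s₁ + s₂).re) := by
    rw [norm_div, norm_mul, norm_zetaFactor, Complex.norm_real, Real.norm_of_nonneg hpi.le,
      Real.rpow_neg h2pi.le]
    have := norm_ne_zero_iff.2 hG
    have := (Real.rpow_pos_of_pos h2pi (s₁ + s₂).re).ne'
    field_simp
  have hsin : ‖Complex.sin (Real.pi * s₂)‖ ≤ Real.exp (Real.pi * |s₂.im|) := by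
    refine (norm_sin_le_exp _).trans (le_of_eq ?_)
    rw [Complex.im_ofReal_mul, abs_mul, abs_of_pos hpi]
  -- The exponents add up to -Re s₂ - 2p, which is negative by the choice of p.
  have hpow : (2 * Real.pi) ^ (-(s₁ + s₂).re) * (2 * Real.pi) ^ (s₁.re - 2 * p) ≤ 1 := by
    rw [← Real.rpow_add h2pi]
    refine Real.rpow_le_one_of_one_le_of_nonpos (by linarith [Real.pi_gt_three]) ?_
    linarith
  rw [e1, norm_mul, norm_mul, norm_mul, norm_mul, e2]
  have hb := norm_betaIntegral_le hm hm1 hm2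
  calc _ ≤ ‖1 - (s₁ + s₂)‖ * (1 / 4) ^ m * Real.exp (Real.pi * |s₂.im|) *
        (2 * Real.pi) ^ (-(s₁ + s₂).re) *
        (K * Real.exp (Real.pi * |s₁.im|) * (2 * Real.pi) ^ (s₁.re - 2 * p)) := by gcongr
    _ = K * Real.exp (Real.pi * (|s₁.im| + |s₂.im|)) * ‖1 - (s₁ + s₂)‖ * (1 / 4) ^ m *
        ((2 * Real.pi) ^ (-(s₁ + s₂).re) * (2 * Real.pi) ^ (s₁.re - 2 * p)) := by
      rw [mul_add, Real.exp_add]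
      ring
    _ ≤ _ := mul_le_of_le_one_right (by positivity) hpow

theorem norm_riemannZeta_sub_one_le {w : ℂ} (hw : 2 ≤ w.re) :
    ‖riemannZeta w - 1‖ ≤ 4 * zetaTwo * (1 / 2) ^ w.re := by
  have hw1 : 1 < w.re := by linarith
  have hs : Summable fun n : ℕ => 1 / ((n : ℂ) + 1) ^ w := by
    have := (summable_nat_add_iff 1).2 (Complex.summable_one_div_nat_cpow.2 hw1)
    simpa using this
  rw [zeta_eq_tsum_one_div_nat_add_one_cpow hw1, hs.tsum_eq_zero_add]
  simp only [CharP.cast_eq_zero, zero_add, Complex.one_cpow, div_one, add_sub_cancel_left]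
  have hg : HasSum (fun n : ℕ => 4 * (1 / 2 : ℝ) ^ w.re * (1 / ((n : ℝ) + 1) ^ 2))
      (4 * (1 / 2 : ℝ) ^ w.re * zetaTwo) := summable_inv_succ_sq.hasSum.mul_left _
  refine (tsum_of_norm_bounded hg fun n => ?_).trans (le_of_eq (by ring))
  have hn : (0 : ℝ) ≤ n := Nat.cast_nonneg n
  have e : (((n + 1 : ℕ) : ℂ) + 1) = (((n : ℝ) + 2 : ℝ) : ℂ) := by push_cast; ring
  have hn2 : (0 : ℝ) < (n : ℝ) + 2 := by linarith
  rw [norm_div, norm_one, e, Complex.norm_cpow_eq_rpow_re_of_pos hn2]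
  have e2 : ((n : ℝ) + 2) ^ w.re = ((n : ℝ) + 2) ^ 2 * ((n : ℝ) + 2) ^ (w.re - 2) := by
    rw [← Real.rpow_two, ← Real.rpow_add hn2]
    congr 1
    ring
  have e3 : (1 / 2 : ℝ) ^ w.re = 1 / (4 * 2 ^ (w.re - 2)) := by
    rw [one_div, Real.inv_rpow two_pos.le, Real.rpow_sub two_pos, one_div]
    norm_num
  rw [e2, e3]
  calc 1 / (((n : ℝ) + 2) ^ 2 * ((n : ℝ) + 2) ^ (w.re - 2))
      ≤ 1 / (((n : ℝ) + 1) ^ 2 * 2 ^ (w.re - 2)) := by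
        gcongr <;> linarith
    _ = _ := by
        have := (Real.rpow_pos_of_pos two_pos (w.re - 2)).ne'
        field_simp

end

/-! ### Uniform bounds for truncated moment expansions -/

section

open Filter Topology

theorem exists_pow_mul_pow_sub_le {ρ : ℝ} (h0 : 0 < ρ) (h1 : ρ < 1) (n M : ℕ) :
    ∃ K : ℝ, 0 ≤ K ∧ ∀ j : ℕ, ((j : ℝ) + 1) ^ n * ρ ^ (j - M) ≤ K * (1 / ((j : ℝ) + 1) ^ 2) := by
  have ht := tendsto_pow_const_mul_const_pow_of_abs_lt_one (n + 2) (r := ρ)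
    (by rwa [abs_of_pos h0])
  obtain ⟨B, hB⟩ := ht.bddAbove_range
  have hB' : ∀ j : ℕ, (j : ℝ) ^ (n + 2) * ρ ^ j ≤ B := fun j => hB ⟨j, rfl⟩
  have hB0 : 0 ≤ B := le_trans (by positivity) (hB' 0)
  refine ⟨B / ρ ^ (M + 1), by positivity, fun j => ?_⟩
  have hj : (0 : ℝ) < (j : ℝ) + 1 := by positivity
  have h := hB' (j + 1)
  push_cast at h
  rw [mul_one_div, le_div_iff₀ (by positivity), le_div_iff₀ (by positivity)]
  calc ((j : ℝ) + 1) ^ n * ρ ^ (j - M) * ((j : ℝ) + 1) ^ 2 * ρ ^ (M + 1)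
      = ((j : ℝ) + 1) ^ (n + 2) * ρ ^ (j - M + (M + 1)) := by ring
    _ ≤ ((j : ℝ) + 1) ^ (n + 2) * ρ ^ (j + 1) := by
      refine mul_le_mul_of_nonneg_left ?_ (by positivity)
      exact pow_le_pow_of_le_one h0.le h1.le (by omega)
    _ ≤ B := h

theorem exists_rpow_mul_pow_le {q : ℝ} (h0 : 0 < q) (h1 : q < 1) (n : ℕ) :
    ∃ K : ℝ, 0 ≤ K ∧ ∀ t : ℝ, 0 ≤ t → q ^ t * t ^ n ≤ K := by
  have hc : 0 < -Real.log q := neg_pos.2 (Real.log_neg h0 h1)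
  set c := -Real.log q with hcdef
  refine ⟨n.factorial / c ^ n, by positivity, fun t ht => ?_⟩
  have h := Real.pow_div_factorial_le_exp (c * t) (by positivity) n
  have hq : q ^ t = Real.exp (-(c * t)) := by
    rw [Real.rpow_def_of_pos h0, hcdef]
    congr 1
    ring
  rw [hq, Real.exp_neg, ← div_eq_inv_mul, div_le_div_iff₀ (Real.exp_pos _) (by positivity)]
  rw [div_le_iff₀ (by positivity)] at h
  rw [mul_pow] at h
  linarith

/-- The expansion of `betaMoment b s j` in central moments, truncated. -/
noncomputable def momentExpansion (b s r : ℂ) (M j : ℕ) : ℂ :=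
  ∑ i ∈ Finset.range M,
    j.choose i * r ^ (j - i) * betaFunctional b s ((Polynomial.X - Polynomial.C r) ^ i)

/-- After shifting both parameters by w, r is no longer the mean: the defect is w(1-r), so the
admissible T grows only linearly in ‖w‖. -/
theorem norm_betaFunctional_shift_le {b s r : ℂ} {Y : ℝ} {N : ℕ} (hY : 1 ≤ Y) (hrs : s * r = b)
    (hr : ‖r‖ ≤ 1) (w : ℂ) (hs : ∀ q < 2 * N + 1, Y ≤ ‖s + w + q‖) :
    ‖betaFunctional (b + w) (s + w) ((Polynomial.X - Polynomial.C r) ^ (2 * N + 1))‖ * Y ^ (N + 1) ≤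
      (5 * (2 * N + 1 : ℕ) + 2 * ‖w‖ + 1) ^ (2 * N + 1) := by
  have e : b + w - (s + w) * r = w * (1 - r) := by rw [← hrs]; ring
  have h1 : ‖w * (1 - r)‖ ≤ 2 * ‖w‖ := by
    rw [norm_mul]
    have : ‖1 - r‖ ≤ 2 := (norm_sub_le _ _).trans (by rw [norm_one]; linarith)
    nlinarith [norm_nonneg w]
  have h := norm_betaFunctional_sub_C_pow_le (b := b + w) (s := s + w) (r := r)
    (T := 5 * (2 * N + 1 : ℕ) + 2 * ‖w‖ + 1) (M := 2 * N + 1) hY hs hr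
    (by rw [e]; linarith) (2 * N + 1) le_rfl
  have e2 : (2 * N + 1 + 1) / 2 = N + 1 := by omega
  rwa [e2] at h

/-- In the explicit remainder, r^(j-(2N+1)-l) and the l-th moment combine to geometric decay in j
uniformly in l, while the shifted central moment of order 2N+1 supplies Y^(-N-1). All other factors
are polynomial in j. -/
theorem exists_norm_betaMoment_sub_le {ρ : ℝ} (h0 : 0 < ρ) (h1 : ρ < 1) (N : ℕ) :
    ∃ K : ℝ, 0 ≤ K ∧ ∀ (b s r : ℂ) (Y : ℝ) (m : ℕ), 1 ≤ Y → s * r = b → ‖r‖ ≤ ρ →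
      (∀ l < m, ∀ q < 2 * N + 1, Y ≤ ‖s + l + q‖) → (∀ l < m, ‖betaMoment b s l‖ ≤ ρ ^ l) →
      ∀ j < m, ‖betaMoment b s j - momentExpansion b s r (2 * N + 1) j‖ * Y ^ (N + 1) ≤
        K * (1 / ((j : ℝ) + 1) ^ 2) := by
  -- Powers of j+1: one from the number of values of l, 2N from the binomial coefficient, 2N+1 from
  -- the shifted central moment.
  obtain ⟨K, hK, hKj⟩ := exists_pow_mul_pow_sub_le h0 h1 (1 + 2 * N + (2 * N + 1)) (2 * N + 1)
  set D : ℝ := 5 * (2 * N + 1 : ℕ) + 2 + 1 with hD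
  have hD0 : 0 ≤ D := by positivity
  refine ⟨D ^ (2 * N + 1) * K, by positivity, ?_⟩
  intro b s r Y m hY hrs hr hs ha j hj
  have hY0 : 0 < Y := by linarith
  rw [momentExpansion, betaMoment_sub_sum_choose]
  have hterm : ∀ l ∈ Finset.range j, ‖((j - 1 - l).choose (2 * N) : ℂ) * r ^ (j - (2 * N + 1) - l) *
      (betaMoment b s l * betaFunctional (b + l) (s + l)
        ((Polynomial.X - Polynomial.C r) ^ (2 * N + 1)))‖ * Y ^ (N + 1) ≤
      ((j : ℝ) + 1) ^ (2 * N) * ρ ^ (j - (2 * N + 1)) * (D * ((j : ℝ) + 1)) ^ (2 * N + 1) := by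
    intro l hl
    have hlj := Finset.mem_range.1 hl
    have hlm : l < m := hlj.trans hj
    have hlj' : (l : ℝ) ≤ j := by exact_mod_cast hlj.le
    have hj0 : (0 : ℝ) ≤ j := Nat.cast_nonneg j
    have hc : ((j - 1 - l).choose (2 * N) : ℝ) ≤ ((j : ℝ) + 1) ^ (2 * N) := by
      calc ((j - 1 - l).choose (2 * N) : ℝ) ≤ ((j - 1 - l : ℕ) : ℝ) ^ (2 * N) := by
            exact_mod_cast Nat.choose_le_pow _ _
        _ ≤ _ := by
          refine pow_le_pow_left₀ (Nat.cast_nonneg _) ?_ _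
          exact_mod_cast (by omega : j - 1 - l ≤ j + 1)
    have hL := norm_betaFunctional_shift_le hY hrs (hr.trans h1.le) l (hs l hlm)
    rw [Complex.norm_natCast] at hL
    have hL' : (5 * ((2 * N + 1 : ℕ) : ℝ) + 2 * l + 1) ^ (2 * N + 1) ≤
        (D * ((j : ℝ) + 1)) ^ (2 * N + 1) := by
      refine pow_le_pow_left₀ (by positivity) ?_ _
      rw [hD]
      have hn0 : (0 : ℝ) ≤ ((2 * N + 1 : ℕ) : ℝ) := Nat.cast_nonneg _
      nlinarith [mul_nonneg hn0 hj0]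
    rw [norm_mul, norm_mul, norm_mul, norm_pow, Complex.norm_natCast]
    calc _ = ((j - 1 - l).choose (2 * N) : ℝ) * (‖r‖ ^ (j - (2 * N + 1) - l) * ‖betaMoment b s l‖) *
          (‖betaFunctional (b + l) (s + l) ((Polynomial.X - Polynomial.C r) ^ (2 * N + 1))‖ *
            Y ^ (N + 1)) := by ring
      _ ≤ ((j : ℝ) + 1) ^ (2 * N) * (ρ ^ (j - (2 * N + 1) - l) * ρ ^ l) *
          (D * ((j : ℝ) + 1)) ^ (2 * N + 1) := by
        have := ha l hlm
        gcongr
        exact hL.trans hL'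
      _ ≤ _ := by
        rw [← pow_add]
        gcongr ?_ * ?_ * ?_
        exact pow_le_pow_of_le_one h0.le h1.le (by omega)
  calc _ ≤ (∑ l ∈ Finset.range j, ‖((j - 1 - l).choose (2 * N) : ℂ) * r ^ (j - (2 * N + 1) - l) *
      (betaMoment b s l * betaFunctional (b + l) (s + l)
        ((Polynomial.X - Polynomial.C r) ^ (2 * N + 1)))‖) * Y ^ (N + 1) :=
        mul_le_mul_of_nonneg_right (norm_sum_le _ _) (by positivity)
    _ ≤ ∑ l ∈ Finset.range j, ((j : ℝ) + 1) ^ (2 * N) * ρ ^ (j - (2 * N + 1)) *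
        (D * ((j : ℝ) + 1)) ^ (2 * N + 1) := by
      rw [Finset.sum_mul]
      exact Finset.sum_le_sum hterm
    _ = j * (((j : ℝ) + 1) ^ (2 * N) * ρ ^ (j - (2 * N + 1)) *
        (D * ((j : ℝ) + 1)) ^ (2 * N + 1)) := by
      rw [Finset.sum_const, Finset.card_range, nsmul_eq_mul]
    _ ≤ ((j : ℝ) + 1) * (((j : ℝ) + 1) ^ (2 * N) * ρ ^ (j - (2 * N + 1)) *
        (D * ((j : ℝ) + 1)) ^ (2 * N + 1)) := by
      gcongr
      linarith
    _ = D ^ (2 * N + 1) * (((j : ℝ) + 1) ^ (1 + 2 * N + (2 * N + 1)) * ρ ^ (j - (2 * N + 1))) := by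
      rw [mul_pow, pow_add, pow_add, pow_one]
      ring
    _ ≤ D ^ (2 * N + 1) * (K * (1 / ((j : ℝ) + 1) ^ 2)) :=
      mul_le_mul_of_nonneg_left (hKj j) (by positivity)
    _ = _ := by ring

/-- For the tail j ≥ 2p of the cotangent series. There j+1 is at least Y, so the weight (j+1)^n
yields the required power of Y. -/
theorem exists_norm_momentExpansion_le {ρ : ℝ} (h0 : 0 < ρ) (h1 : ρ < 1) (n M : ℕ) :
    ∃ K : ℝ, 0 ≤ K ∧ ∀ (b s r : ℂ), s * r = b → ‖r‖ ≤ ρ → (∀ q < M, 1 ≤ ‖s + q‖) →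
      ∀ j, ‖momentExpansion b s r M j‖ * ((j : ℝ) + 1) ^ n ≤ K * (1 / ((j : ℝ) + 1) ^ 2) := by
  obtain ⟨K, hK, hKj⟩ := exists_pow_mul_pow_sub_le h0 h1 (M + n) M
  refine ⟨M * (5 * M + 1) ^ M * K, by positivity, ?_⟩
  intro b s r hrs hr hs j
  have hmu := norm_betaFunctional_sub_C_pow_le (b := b) (r := r) (T := 5 * M + 1) le_rfl hs
    (hr.trans h1.le) (by rw [hrs]; simp)
  have hj1 : (1 : ℝ) ≤ (j : ℝ) + 1 := by linarith [(Nat.cast_nonneg j : (0 : ℝ) ≤ j)]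
  have hM1 : (1 : ℝ) ≤ 5 * M + 1 := by linarith [(Nat.cast_nonneg M : (0 : ℝ) ≤ M)]
  have hterm : ∀ i ∈ Finset.range M, ‖(j.choose i : ℂ) * r ^ (j - i) *
      betaFunctional b s ((Polynomial.X - Polynomial.C r) ^ i)‖ ≤
      ((j : ℝ) + 1) ^ M * ρ ^ (j - M) * (5 * M + 1) ^ M := by
    intro i hi
    have hiM := Finset.mem_range.1 hi
    have h := hmu i hiM.le
    rw [one_pow, mul_one] at h
    rw [norm_mul, norm_mul, norm_pow, Complex.norm_natCast]
    have hc : (j.choose i : ℝ) ≤ ((j : ℝ) + 1) ^ M := by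
      calc (j.choose i : ℝ) ≤ (j : ℝ) ^ i := by exact_mod_cast Nat.choose_le_pow _ _
        _ ≤ ((j : ℝ) + 1) ^ i := pow_le_pow_left₀ (Nat.cast_nonneg _) (by linarith) _
        _ ≤ _ := pow_le_pow_right₀ hj1 hiM.le
    have hp : ‖r‖ ^ (j - i) ≤ ρ ^ (j - M) :=
      (pow_le_pow_left₀ (norm_nonneg _) hr _).trans (pow_le_pow_of_le_one h0.le h1.le (by omega))
    exact mul_le_mul (mul_le_mul hc hp (by positivity) (by positivity))
      (h.trans (pow_le_pow_right₀ hM1 hiM.le)) (norm_nonneg _) (by positivity)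
  calc _ ≤ (∑ i ∈ Finset.range M, ((j : ℝ) + 1) ^ M * ρ ^ (j - M) * (5 * M + 1) ^ M) *
        ((j : ℝ) + 1) ^ n := by
        refine mul_le_mul_of_nonneg_right ?_ (by positivity)
        exact (norm_sum_le _ _).trans (Finset.sum_le_sum hterm)
    _ = M * (5 * M + 1) ^ M * (((j : ℝ) + 1) ^ (M + n) * ρ ^ (j - M)) := by
      rw [Finset.sum_const, Finset.card_range, nsmul_eq_mul, pow_add]
      ring
    _ ≤ M * (5 * M + 1) ^ M * (K * (1 / ((j : ℝ) + 1) ^ 2)) :=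
      mul_le_mul_of_nonneg_left (hKj j) (by positivity)
    _ = _ := by ring

theorem sum_one_div_succ_sq_le (m : ℕ) :
    ∑ j ∈ Finset.range m, 1 / ((j : ℝ) + 1) ^ 2 ≤ zetaTwo :=
  summable_inv_succ_sq.sum_le_tsum _ fun _ _ => by positivity

theorem hasSum_oddZeta_mul_momentExpansion {b s r : ℂ} (M : ℕ) (hr : ‖r‖ < 1) :
    HasSum (fun j => oddZeta j * momentExpansion b s r M j)
      (∑ i ∈ Finset.range M, (∑' j, oddZeta j * (j.choose i * r ^ (j - i))) *
        betaFunctional b s ((Polynomial.X - Polynomial.C r) ^ i)) := by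
  have h := hasSum_sum (s := Finset.range M) fun i _ =>
    ((summable_coeff_mul_choose norm_oddZeta_le i hr).hasSum).mul_right
      (betaFunctional b s ((Polynomial.X - Polynomial.C r) ^ i))
  have e : (fun j => oddZeta j * momentExpansion b s r M j) = fun j => ∑ i ∈ Finset.range M,
      oddZeta j * (j.choose i * r ^ (j - i)) *
        betaFunctional b s ((Polynomial.X - Polynomial.C r) ^ i) := by
    ext j
    rw [momentExpansion, Finset.mul_sum]
    exact Finset.sum_congr rfl fun i _ => by ring
  rw [e]
  exact h

/-- The main term of the asymptotic formula in terms of Beta moments. -/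
theorem sum_cot_mul_cCoeff {s₁ s₂ : ℂ} {M : ℕ} (hs : ∀ j < M, s₁ + s₂ + j ≠ 0) (h0 : s₁ + s₂ ≠ 0)
    (hr0 : s₂ / (s₁ + s₂) ≠ 0) (hr : ‖s₂ / (s₁ + s₂)‖ < 1) :
    1 / 2 * ∑ j ∈ Finset.range M,
      (Real.pi : ℂ) ^ j * iteratedDeriv j Complex.cot (Real.pi * (s₂ / (s₁ + s₂)))
        / (ascPochhammer ℂ j).eval (s₁ + s₂) * cCoeff s₁ s₂ j =
    1 / (2 * Real.pi) * (∑ i ∈ Finset.range M, (-1) ^ i * (s₂ / (s₁ + s₂))⁻¹ ^ (i + 1) *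
      betaFunctional s₂ (s₁ + s₂) ((Polynomial.X - Polynomial.C (s₂ / (s₁ + s₂))) ^ i) -
      2 * ∑' j, oddZeta j * momentExpansion s₂ (s₁ + s₂) (s₂ / (s₁ + s₂)) M j) := by
  have hpi : (Real.pi : ℂ) ≠ 0 := Complex.ofReal_ne_zero.2 Real.pi_ne_zero
  rw [(hasSum_oddZeta_mul_momentExpansion M hr).tsum_eq, Finset.mul_sum, Finset.mul_sum,
    ← Finset.sum_sub_distrib, Finset.mul_sum]
  refine Finset.sum_congr rfl fun i hi => ?_
  have hiM := Finset.mem_range.1 hi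
  have h := pi_pow_mul_iteratedDeriv_cot i hr0 hr
  rw [betaFunctional_sub_C_pow_eq hs h0 i hiM.le]
  have hP : (ascPochhammer ℂ i).eval (s₁ + s₂) ≠ 0 := by
    rw [Ne, ascPochhammer_eval_eq_zero_iff]
    rintro ⟨k, hk, hk'⟩
    exact hs k (hk.trans hiM) (by rw [hk']; ring)
  rw [pow_succ] at h
  have hf : (i.factorial : ℂ) ≠ 0 := by exact_mod_cast Nat.factorial_ne_zero i
  generalize iteratedDeriv i Complex.cot (Real.pi * (s₂ / (s₁ + s₂))) = A at *
  generalize ∑' j, oddZeta j * (j.choose i * (s₂ / (s₁ + s₂)) ^ (j - i)) = B at *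
  generalize (s₂ / (s₁ + s₂))⁻¹ ^ (i + 1) = D at *
  generalize (ascPochhammer ℂ i).eval (s₁ + s₂) = P at *
  field_simp
  linear_combination (cCoeff s₁ s₂ i) * h

end

/-! ### Decomposition and estimate of the error -/

section

/-- The inequalities between the parameters under which the error terms are estimated. -/
structure AsymptoticRegime (N : ℕ) (ρ η H K Y : ℝ) (p : ℕ) (s₁ s₂ : ℂ) : Prop where
  one_le_p : 1 ≤ p
  two_le : 2 ≤ Y
  neg_lt_re : -(2 * p : ℝ) < s₂.re
  re_le : s₂.re ≤ 2 - 2 * p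
  re_le_neg_five : s₁.re ≤ -5
  add_re_lt : (s₁ + s₂).re < 1 - 2 * p
  re_le_neg₁ : s₁.re ≤ -Y
  re_le_neg₂ : s₂.re ≤ -Y
  le_norm_shift : ∀ l < 2 * p, ∀ q < 2 * N + 1, Y ≤ ‖s₁ + s₂ + l + q‖
  le_norm_shift_neg : ∀ q < 2 * N + 1, Y ≤ ‖s₁ + s₂ + (-1) + q‖
  le_re : ∀ j < 2 * p, Y ≤ (1 - (s₁ + s₂) - j).re
  norm_ratio_le : ‖s₂ / (s₁ + s₂)‖ ≤ ρ
  le_norm_ratio : η ≤ ‖s₂ / (s₁ + s₂)‖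
  norm_inv_le : ‖(s₁ + s₂ - 1) / (s₂ - 1)‖ ≤ η⁻¹
  norm_betaMoment_le : ∀ l < 2 * p, ‖betaMoment s₂ (s₁ + s₂) l‖ ≤ ρ ^ l
  im_le₁ : |s₁.im| ≤ H
  im_le₂ : |s₂.im| ≤ H
  le_two_p : Y ≤ 2 * p
  norm_one_sub_le : ‖1 - (s₁ + s₂)‖ ≤ K * Y

/-- The main term of the asymptotic formula. -/
noncomputable def doubleZetaMainTerm (N : ℕ) (s₁ s₂ : ℂ) : ℂ :=
  -(1 / 2) * Complex.sin (Real.pi / 2 * (s₁ + s₂))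
    + 1 / 2 * Complex.cos (Real.pi / 2 * (s₁ + s₂)) *
        ∑ j ∈ Finset.range (2 * N + 1),
          (Real.pi : ℂ) ^ j * iteratedDeriv j Complex.cot (Real.pi * (s₂ / (s₁ + s₂)))
            / (ascPochhammer ℂ j).eval (s₁ + s₂) * cCoeff s₁ s₂ j
    + Complex.sin (Real.pi * s₂) * Complex.Gamma (1 - s₁) * Complex.Gamma (1 - s₂)
        * riemannZeta (2 - s₁ - s₂)
      / (4 * Real.pi * Complex.Gamma (1 - s₁ - s₂)
        * Complex.sin (Real.pi / 2 * (s₁ + s₂)))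

/-- The main term involves the full cotangent series while the exact formula stops at 2p, so the
series is split there. What is left are the deviations of zeta values from 1, the Taylor remainders
of 1/X and of X^j, the tail of the series, and the nonzero frequencies. -/
theorem AsymptoticRegime.error_eq {N : ℕ} {ρ η H K Y : ℝ} {p : ℕ} {s₁ s₂ : ℂ}
    (hR : AsymptoticRegime N ρ η H K Y p s₁ s₂) (hρ : ρ < 1) (hη : 0 < η)
    (hs : ∀ k : ℤ, s₁ + s₂ ≠ 2 * (k : ℂ)) :
    doubleZeta s₁ s₂ / zetaFactor (s₁ + s₂) - doubleZetaMainTerm N s₁ s₂ =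
      -(1 / 2) * Complex.sin (Real.pi / 2 * (s₁ + s₂)) * (riemannZeta (1 - (s₁ + s₂)) - 1) +
      Complex.cos (Real.pi / 2 * (s₁ + s₂)) / (2 * Real.pi) *
        ((s₁ + s₂ - 1) / (s₂ - 1) * (riemannZeta (2 - (s₁ + s₂)) - 1) +
          (s₁ + s₂ - 1) / (s₂ - 1) * ((-1) ^ (2 * N + 1) * (s₂ / (s₁ + s₂))⁻¹ ^ (2 * N + 1) *
            betaFunctional (s₂ - 1) (s₁ + s₂ - 1)
              ((Polynomial.X - Polynomial.C (s₂ / (s₁ + s₂))) ^ (2 * N + 1))) -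
          2 * ∑ j ∈ Finset.range (2 * p), oddZeta j *
            (betaMoment s₂ (s₁ + s₂) j * (riemannZeta (1 - (s₁ + s₂) - j) - 1)) -
          2 * ∑ j ∈ Finset.range (2 * p), oddZeta j * (betaMoment s₂ (s₁ + s₂) j -
            momentExpansion s₂ (s₁ + s₂) (s₂ / (s₁ + s₂)) (2 * N + 1) j) +
          2 * ∑' j, oddZeta (j + 2 * p) *
            momentExpansion s₂ (s₁ + s₂) (s₂ / (s₁ + s₂)) (2 * N + 1) (j + 2 * p)) +
      Complex.Gamma (1 - s₁) * (Complex.Gamma s₂)⁻¹ * freqInt p s₁ s₂ / zetaFactor (s₁ + s₂) := by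
  have hY : 0 < Y := by linarith [hR.two_le]
  have hp : 0 < 2 * p := by linarith [hR.one_le_p]
  have hne : ∀ j < 2 * N + 1, s₁ + s₂ + j ≠ 0 := fun j hj h => by
    have := hR.le_norm_shift 0 hp j hj
    rw [Nat.cast_zero, add_zero, h, norm_zero] at this
    linarith
  have h0 : s₁ + s₂ ≠ 0 := by simpa using hne 0 (by omega)
  have hr0 : s₂ / (s₁ + s₂) ≠ 0 := fun h => by
    have := hR.le_norm_ratio
    rw [h, norm_zero] at this
    linarith
  have hr1 : ‖s₂ / (s₁ + s₂)‖ < 1 := hR.norm_ratio_le.trans_lt hρ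
  have hb : s₂ ≠ 1 := fun h => by
    have := hR.re_le_neg₂
    rw [h, Complex.one_re] at this
    linarith
  have hre : (s₁ + s₂).re = s₁.re + s₂.re := Complex.add_re _ _
  have hs1 : s₁ + s₂ ≠ 1 := fun h => by
    rw [h, Complex.one_re] at hre
    linarith [hR.re_le_neg₂, hR.re_le_neg₁]
  have hsum := (hasSum_oddZeta_mul_momentExpansion (b := s₂) (s := s₁ + s₂) (2 * N + 1) hr1).summable
  have hsplit := hsum.sum_add_tsum_nat_add (2 * p)
  have hmain := sum_cot_mul_cCoeff hne h0 hr0 hr1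
  rw [doubleZeta_div_zetaFactor hR.one_le_p hR.neg_lt_re (by linarith [hR.re_le_neg₂])
    (by linarith [hR.re_le_neg_five]) hR.add_re_lt hs, ← inv_betaMoment_sub_sum hb hs1 hr0,
    doubleZetaMainTerm]
  rw [← hsplit] at hmain
  simp only [mul_sub (oddZeta _), mul_sub (betaMoment _ _ _), mul_one, Finset.sum_sub_distrib]
  linear_combination (-Complex.cos (Real.pi / 2 * (s₁ + s₂))) * hmain

/-- The trigonometric factors are bounded because the imaginary parts are. The terms with ζ - 1 and
the nonzero frequencies are exponentially small in Y; the Taylor remainders and the tail are of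
order Y^(-N-1). -/
theorem AsymptoticRegime.exists_norm_error_le (N : ℕ) {ρ η H K : ℝ} (hρ0 : 0 < ρ) (hρ : ρ < 1)
    (hη : 0 < η) (hK : 0 ≤ K) : ∃ C : ℝ, 0 ≤ C ∧ ∀ (Y : ℝ) (p : ℕ) (s₁ s₂ : ℂ),
    AsymptoticRegime N ρ η H K Y p s₁ s₂ → (∀ k : ℤ, s₁ + s₂ ≠ 2 * (k : ℂ)) →
    ‖doubleZeta s₁ s₂ / zetaFactor (s₁ + s₂) - doubleZetaMainTerm N s₁ s₂‖ * Y ^ (N + 1) ≤ C := by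
  obtain ⟨A, hA0, hA⟩ := exists_rpow_mul_pow_le (q := 1 / 2) (by norm_num) (by norm_num) (N + 1)
  -- One power more than in the previous line, because the frequency bound carries the factor ‖1-s‖
  -- ≤ KY.
  obtain ⟨B, hB0, hB⟩ := exists_rpow_mul_pow_le (q := 1 / 4) (by norm_num) (by norm_num) (N + 2)
  obtain ⟨F, hF0, hF⟩ := norm_freqInt_div_zetaFactor_le
  obtain ⟨D, hD0, hD⟩ := exists_norm_betaMoment_sub_le hρ0 hρ N
  obtain ⟨G, hG0, hG⟩ := exists_norm_momentExpansion_le hρ0 hρ (N + 1) (2 * N + 1)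
  have hz := zetaTwo_nonneg
  set U := Real.exp (Real.pi * H) with hU
  set Z := 4 * zetaTwo * A with hZ
  have hZ0 : 0 ≤ Z := by positivity
  set C2 := η⁻¹ * Z with hC2
  set C3 := η⁻¹ * (η⁻¹ ^ (2 * N + 1) * (5 * (2 * N + 1 : ℕ) + 2 * 1 + 1) ^ (2 * N + 1)) with hC3
  set C4 := zetaTwo * Z * (1 - ρ)⁻¹ with hC4
  set C5 := zetaTwo * D * zetaTwo with hC5
  set C6 := zetaTwo * G * zetaTwo with hC6
  set C7 := F * Real.exp (Real.pi * (H + H)) * K * B with hC7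
  have hρ1 : 0 < 1 - ρ := by linarith
  refine ⟨1 / 2 * U * Z + U / (2 * Real.pi) * (C2 + C3 + 2 * C4 + 2 * C5 + 2 * C6) + C7,
    by positivity, ?_⟩
  intro Y p s₁ s₂ hR hs
  have hY2 := hR.two_le
  have hY : 0 < Y := by linarith
  have hW : 0 ≤ Y ^ (N + 1) := by positivity
  have h0lt : 0 < 2 * p := by linarith [hR.one_le_p]
  have hne : s₁ + s₂ ≠ 0 := fun h => by
    have := hR.le_norm_shift 0 h0lt 0 (by omega)
    rw [h] at this
    simp at this
    linarith
  have hrs : (s₁ + s₂) * (s₂ / (s₁ + s₂)) = s₂ := by field_simp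
  have hzeta : ∀ w : ℂ, Y ≤ w.re → ‖riemannZeta w - 1‖ * Y ^ (N + 1) ≤ Z := by
    intro w hw
    calc _ ≤ 4 * zetaTwo * (1 / 2) ^ w.re * Y ^ (N + 1) :=
          mul_le_mul_of_nonneg_right (norm_riemannZeta_sub_one_le (by linarith)) hW
      _ ≤ 4 * zetaTwo * (1 / 2) ^ Y * Y ^ (N + 1) := by
        refine mul_le_mul_of_nonneg_right (mul_le_mul_of_nonneg_left ?_ (by positivity)) hW
        exact Real.rpow_le_rpow_of_exponent_ge (by norm_num) (by norm_num) hw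
      _ = 4 * zetaTwo * ((1 / 2) ^ Y * Y ^ (N + 1)) := by ring
      _ ≤ _ := mul_le_mul_of_nonneg_left (hA Y hY.le) (by positivity)
  have him : |(Real.pi / 2 * (s₁ + s₂)).im| ≤ Real.pi * H := by
    have e : (Real.pi / 2 * (s₁ + s₂) : ℂ) = ((Real.pi / 2 : ℝ) : ℂ) * (s₁ + s₂) := by push_cast; rfl
    rw [e, Complex.im_ofReal_mul, abs_mul, abs_of_pos (by positivity), Complex.add_im]
    have := abs_add_le s₁.im s₂.im
    have := hR.im_le₁
    have := hR.im_le₂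
    have hpi := Real.pi_pos
    nlinarith
  have hsin : ‖Complex.sin (Real.pi / 2 * (s₁ + s₂))‖ ≤ U :=
    (norm_sin_le_exp _).trans (Real.exp_le_exp.2 him)
  have hcos : ‖Complex.cos (Real.pi / 2 * (s₁ + s₂))‖ ≤ U :=
    (norm_cos_le_exp _).trans (Real.exp_le_exp.2 him)
  have b1 : ‖-(1 / 2) * Complex.sin (Real.pi / 2 * (s₁ + s₂)) * (riemannZeta (1 - (s₁ + s₂)) - 1)‖ *
      Y ^ (N + 1) ≤ 1 / 2 * U * Z := by
    have h := hzeta (1 - (s₁ + s₂)) (by simpa using hR.le_re 0 h0lt)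
    rw [norm_mul, norm_mul, norm_neg, mul_assoc]
    have : ‖(1 / 2 : ℂ)‖ = 1 / 2 := by simp
    rw [this]
    gcongr
  have b2 : ‖(s₁ + s₂ - 1) / (s₂ - 1) * (riemannZeta (2 - (s₁ + s₂)) - 1)‖ * Y ^ (N + 1) ≤ C2 := by
    have h := hzeta (2 - (s₁ + s₂)) (by
      have := hR.le_re 0 h0lt
      simp at this ⊢
      linarith)
    rw [norm_mul, mul_assoc]
    exact mul_le_mul hR.norm_inv_le h (by positivity) (by positivity)
  have b3 : ‖(s₁ + s₂ - 1) / (s₂ - 1) * ((-1) ^ (2 * N + 1) * (s₂ / (s₁ + s₂))⁻¹ ^ (2 * N + 1) *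
      betaFunctional (s₂ - 1) (s₁ + s₂ - 1)
        ((Polynomial.X - Polynomial.C (s₂ / (s₁ + s₂))) ^ (2 * N + 1)))‖ * Y ^ (N + 1) ≤ C3 := by
    have h := norm_betaFunctional_shift_le (by linarith) hrs (hR.norm_ratio_le.trans hρ.le) (-1)
      hR.le_norm_shift_neg
    rw [norm_neg, norm_one, ← sub_eq_add_neg, ← sub_eq_add_neg] at h
    rw [norm_mul, norm_mul, norm_mul, norm_pow, norm_pow, norm_neg, norm_one, one_pow, one_mul,
      norm_inv, mul_assoc, mul_assoc]
    have hi : ‖s₂ / (s₁ + s₂)‖⁻¹ ≤ η⁻¹ := inv_anti₀ hη hR.le_norm_ratio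
    exact mul_le_mul hR.norm_inv_le (mul_le_mul (pow_le_pow_left₀ (by positivity) hi _) h
      (by positivity) (by positivity)) (by positivity) (by positivity)
  have b4 : ‖∑ j ∈ Finset.range (2 * p), oddZeta j * (betaMoment s₂ (s₁ + s₂) j *
      (riemannZeta (1 - (s₁ + s₂) - j) - 1))‖ * Y ^ (N + 1) ≤ C4 := by
    calc _ ≤ (∑ j ∈ Finset.range (2 * p), ‖oddZeta j * (betaMoment s₂ (s₁ + s₂) j *
          (riemannZeta (1 - (s₁ + s₂) - j) - 1))‖) * Y ^ (N + 1) :=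
          mul_le_mul_of_nonneg_right (norm_sum_le _ _) hW
      _ ≤ ∑ j ∈ Finset.range (2 * p), zetaTwo * Z * ρ ^ j := by
        rw [Finset.sum_mul]
        refine Finset.sum_le_sum fun j hj => ?_
        have hj' := Finset.mem_range.1 hj
        have h := hzeta _ (hR.le_re j hj')
        rw [norm_mul, norm_mul, mul_assoc, mul_assoc]
        calc _ ≤ zetaTwo * (ρ ^ j * Z) :=
              mul_le_mul (norm_oddZeta_le j) (mul_le_mul (hR.norm_betaMoment_le j hj') h
                (by positivity) (by positivity)) (by positivity) hz
          _ = _ := by ring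
      _ ≤ C4 := by
        rw [← Finset.mul_sum, hC4, ← tsum_geometric_of_lt_one hρ0.le hρ]
        exact mul_le_mul_of_nonneg_left ((summable_geometric_of_lt_one hρ0.le hρ).sum_le_tsum _
          fun _ _ => by positivity) (by positivity)
  have b5 : ‖∑ j ∈ Finset.range (2 * p), oddZeta j * (betaMoment s₂ (s₁ + s₂) j -
      momentExpansion s₂ (s₁ + s₂) (s₂ / (s₁ + s₂)) (2 * N + 1) j)‖ * Y ^ (N + 1) ≤ C5 := by
    have hd := hD s₂ (s₁ + s₂) (s₂ / (s₁ + s₂)) Y (2 * p) (by linarith) hrs hR.norm_ratio_le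
      hR.le_norm_shift hR.norm_betaMoment_le
    calc _ ≤ (∑ j ∈ Finset.range (2 * p), ‖oddZeta j * (betaMoment s₂ (s₁ + s₂) j -
          momentExpansion s₂ (s₁ + s₂) (s₂ / (s₁ + s₂)) (2 * N + 1) j)‖) * Y ^ (N + 1) :=
          mul_le_mul_of_nonneg_right (norm_sum_le _ _) hW
      _ ≤ ∑ j ∈ Finset.range (2 * p), zetaTwo * D * (1 / ((j : ℝ) + 1) ^ 2) := by
        rw [Finset.sum_mul]
        refine Finset.sum_le_sum fun j hj => ?_
        rw [norm_mul, mul_assoc, mul_assoc]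
        exact mul_le_mul (norm_oddZeta_le j) (hd j (Finset.mem_range.1 hj)) (by positivity) hz
      _ ≤ C5 := by
        rw [← Finset.mul_sum]
        exact mul_le_mul_of_nonneg_left (sum_one_div_succ_sq_le _) (by positivity)
  have b6 : ‖∑' j, oddZeta (j + 2 * p) *
      momentExpansion s₂ (s₁ + s₂) (s₂ / (s₁ + s₂)) (2 * N + 1) (j + 2 * p)‖ * Y ^ (N + 1) ≤ C6 := by
    have hg := hG s₂ (s₁ + s₂) (s₂ / (s₁ + s₂)) hrs hR.norm_ratio_le (fun q hq => by
      have := hR.le_norm_shift 0 h0lt q hq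
      rw [Nat.cast_zero, add_zero] at this
      linarith)
    have hW' : 0 < Y ^ (N + 1) := by positivity
    rw [← le_div_iff₀ hW', hC6, mul_div_right_comm]
    refine tsum_of_norm_bounded (summable_inv_succ_sq.hasSum.mul_left (zetaTwo * G / Y ^ (N + 1)))
      fun j => ?_
    rw [div_mul_eq_mul_div, le_div_iff₀ hW', norm_mul, mul_assoc, mul_assoc]
    refine mul_le_mul (norm_oddZeta_le _) ?_ (by positivity) hz
    have hj : Y ≤ ((j + 2 * p : ℕ) : ℝ) + 1 := by
      have := hR.le_two_p
      have hj0 : (0 : ℝ) ≤ j := Nat.cast_nonneg j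
      push_cast
      linarith
    calc _ ≤ ‖momentExpansion s₂ (s₁ + s₂) (s₂ / (s₁ + s₂)) (2 * N + 1) (j + 2 * p)‖ *
          (((j + 2 * p : ℕ) : ℝ) + 1) ^ (N + 1) := by gcongr
      _ ≤ G * (1 / (((j + 2 * p : ℕ) : ℝ) + 1) ^ 2) := hg _
      _ ≤ G * (1 / ((j : ℝ) + 1) ^ 2) := by
        gcongr
        omega
  have b7 : ‖Complex.Gamma (1 - s₁) * (Complex.Gamma s₂)⁻¹ * freqInt p s₁ s₂ /
      zetaFactor (s₁ + s₂)‖ * Y ^ (N + 1) ≤ C7 := by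
    have h := hF p s₁ s₂ Y hR.one_le_p hR.neg_lt_re hR.re_le hR.re_le_neg_five hR.add_re_lt hY.le
      hR.re_le_neg₁ hR.re_le_neg₂
    calc _ ≤ F * Real.exp (Real.pi * (H + H)) * (K * Y) * (1 / 4) ^ Y * Y ^ (N + 1) := by
          refine mul_le_mul_of_nonneg_right (h.trans ?_) hW
          have := hR.im_le₁
          have := hR.im_le₂
          have := hR.norm_one_sub_le
          gcongr
      _ = F * Real.exp (Real.pi * (H + H)) * K * ((1 / 4) ^ Y * Y ^ (N + 2)) := by ring
      _ ≤ _ := mul_le_mul_of_nonneg_left (hB Y hY.le) (by positivity)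
  rw [hR.error_eq hρ hη hs]
  have hc2 : ‖Complex.cos (Real.pi / 2 * (s₁ + s₂)) / (2 * Real.pi)‖ ≤ U / (2 * Real.pi) := by
    have e : (2 * Real.pi : ℂ) = ((2 * Real.pi : ℝ) : ℂ) := by push_cast; rfl
    rw [norm_div, e, Complex.norm_real, Real.norm_of_nonneg (by positivity)]
    gcongr
  generalize (s₁ + s₂ - 1) / (s₂ - 1) * (riemannZeta (2 - (s₁ + s₂)) - 1) = e2 at *
  generalize (s₁ + s₂ - 1) / (s₂ - 1) * ((-1) ^ (2 * N + 1) * (s₂ / (s₁ + s₂))⁻¹ ^ (2 * N + 1) *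
      betaFunctional (s₂ - 1) (s₁ + s₂ - 1)
        ((Polynomial.X - Polynomial.C (s₂ / (s₁ + s₂))) ^ (2 * N + 1))) = e3 at *
  generalize ∑ j ∈ Finset.range (2 * p), oddZeta j * (betaMoment s₂ (s₁ + s₂) j *
      (riemannZeta (1 - (s₁ + s₂) - j) - 1)) = e4 at *
  generalize ∑ j ∈ Finset.range (2 * p), oddZeta j * (betaMoment s₂ (s₁ + s₂) j -
      momentExpansion s₂ (s₁ + s₂) (s₂ / (s₁ + s₂)) (2 * N + 1) j) = e5 at *
  generalize ∑' j, oddZeta (j + 2 * p) *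
      momentExpansion s₂ (s₁ + s₂) (s₂ / (s₁ + s₂)) (2 * N + 1) (j + 2 * p) = e6 at *
  have hin : ‖e2 + e3 - 2 * e4 - 2 * e5 + 2 * e6‖ ≤
      ‖e2‖ + ‖e3‖ + 2 * ‖e4‖ + 2 * ‖e5‖ + 2 * ‖e6‖ := by
    have e : ∀ z : ℂ, ‖2 * z‖ = 2 * ‖z‖ := fun z => by rw [norm_mul, Complex.norm_ofNat]
    rw [← e e4, ← e e5, ← e e6]
    refine (norm_add_le _ _).trans (add_le_add_left ?_ _)
    refine (norm_sub_le _ _).trans (add_le_add_left ?_ _)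
    refine (norm_sub_le _ _).trans (add_le_add_left ?_ _)
    exact norm_add_le _ _
  have hin' : ‖e2 + e3 - 2 * e4 - 2 * e5 + 2 * e6‖ * Y ^ (N + 1) ≤
      C2 + C3 + 2 * C4 + 2 * C5 + 2 * C6 := by
    refine (mul_le_mul_of_nonneg_right hin hW).trans ?_
    linarith
  refine (mul_le_mul_of_nonneg_right (norm_add₃_le) hW).trans ?_
  rw [add_mul, add_mul]
  refine add_le_add (add_le_add b1 ?_) b7
  rw [norm_mul, mul_assoc]
  exact mul_le_mul hc2 hin' (by positivity) (by positivity)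

end

/-! ### Verification of the regime and conclusion -/

set_option maxHeartbeats 1000000 in
-- The choice of p is forced by -2p < Re s₂ ≤ 2-2p. With S = -Re(s₁+s₂), both -Re s₁ and -Re s₂
-- exceed εS = 2Y. The halves in 1-ε/2, ε/2 and Y are slack for the bounded imaginary parts and for
-- the shifts by 2N+1.
theorem asymptoticRegime_of_lt {ε : ℝ} (hε : 0 < ε) (N : ℕ) {s₁ s₂ : ℂ}
    (i1 : |s₁.im| < 1 / ε) (i2 : |s₂.im| < 1 / ε)
    (l1 : ε < s₁.re / (s₁ + s₂).re) (l2 : s₁.re / (s₁ + s₂).re < 1 - ε)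
    (r1 : s₁.re < -(6 + (2 * N + 4) * (2 / ε) + 2 / ε * (1 / ε)))
    (r2 : s₂.re < -(6 + (2 * N + 4) * (2 / ε) + 2 / ε * (1 / ε))) :
    ‖s₁ + s₂‖ ≤ 4 / ε * (ε * (-(s₁ + s₂).re) / 2) ∧
    AsymptoticRegime N (1 - ε / 2) (ε / 2) (1 / ε) (4 / ε) (ε * (-(s₁ + s₂).re) / 2)
      (⌊-s₂.re / 2⌋₊ + 1) s₁ s₂ := by
  have hN : (0 : ℝ) ≤ N := Nat.cast_nonneg N
  set H := 1 / ε with hH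
  have hH0 : 0 < H := by positivity
  have hε2 : ε < 1 / 2 := by linarith
  have hH2 : ε * H = 1 := by rw [hH]; field_simp
  have hHe : 2 / ε = 2 * H := by rw [hH]; ring
  rw [hHe] at r1 r2
  have hre : (s₁ + s₂).re = s₁.re + s₂.re := Complex.add_re _ _
  rw [hre] at l1 l2 ⊢
  obtain ⟨A, hA⟩ : ∃ A, A = -s₁.re := ⟨_, rfl⟩
  obtain ⟨B, hB⟩ : ∃ B, B = -s₂.re := ⟨_, rfl⟩
  have e1 : s₁.re = -A := by linarith
  have e2 : s₂.re = -B := by linarith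
  have hNH : 0 ≤ (N : ℝ) * H := by positivity
  have hHH : 0 ≤ H * H := by positivity
  rw [e1] at r1
  rw [e2] at r2
  have hA0 : 0 < A := by linarith
  have hB0 : 0 < B := by linarith
  set S := A + B with hS
  have hS0 : 0 < S := by positivity
  have hdiv : s₁.re / (s₁.re + s₂.re) = A / S := by
    rw [e1, e2, hS, ← neg_add, neg_div_neg_eq]
  rw [hdiv] at l1 l2
  have hAS : ε * S < A := (lt_div_iff₀ hS0).1 l1
  have hAS' : A < (1 - ε) * S := (div_lt_iff₀ hS0).1 l2
  have hBS : ε * S < B := by linarith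
  have hBS' : B < (1 - ε) * S := by linarith
  have hSbig : 2 * (6 + (2 * N + 4) * (2 * H) + 2 * H * H) < S := by linarith
  -- The bound on the real parts was chosen for this inequality: εS dominates both the order 2N and
  -- the bound H on the imaginary parts.
  have hεS : (2 * N + 4) * 4 + 4 * H < ε * S := by
    have h := mul_lt_mul_of_pos_left hSbig hε
    have : ε * (2 * (6 + (2 * N + 4) * (2 * H) + 2 * H * H)) =
        12 * ε + (2 * N + 4) * 4 * (ε * H) + 4 * H * (ε * H) := by ring
    rw [this, hH2] at h
    linarith
  have hS1 : 1 + 2 * H ≤ S := by linarith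
  have hSre : s₁.re + s₂.re = -S := by rw [e1, e2, hS]; ring
  have hsre : (s₁ + s₂).re = -S := by rw [hre, hSre]
  have him : |(s₁ + s₂).im| ≤ 2 * H := by
    rw [Complex.add_im]
    linarith [abs_add_le s₁.im s₂.im]
  have hnorm : ‖s₁ + s₂‖ ≤ S + 2 * H := by
    refine (Complex.norm_le_abs_re_add_abs_im _).trans ?_
    rw [hsre, abs_neg, abs_of_pos hS0]
    linarith
  have hnorm' : S ≤ ‖s₁ + s₂‖ := by
    have := Complex.abs_re_le_norm (s₁ + s₂)
    rwa [hsre, abs_neg, abs_of_pos hS0] at this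
  have hnorm2' : B ≤ ‖s₂‖ := by
    have := Complex.abs_re_le_norm s₂
    rwa [e2, abs_neg, abs_of_pos hB0] at this
  have hcancel : 4 / ε * (ε * S / 2) = 2 * S := by field_simp; norm_num
  rw [hSre, neg_neg]
  have hp1 : B / 2 < ((⌊-s₂.re / 2⌋₊ + 1 : ℕ) : ℝ) := by
    rw [← hB]
    exact_mod_cast Nat.lt_floor_add_one (B / 2)
  have hp2 : ((⌊-s₂.re / 2⌋₊ + 1 : ℕ) : ℝ) ≤ B / 2 + 1 := by
    rw [← hB]
    push_cast
    linarith [Nat.floor_le (a := B / 2) (by positivity)]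
  have hp3 : 1 ≤ ⌊-s₂.re / 2⌋₊ + 1 := Nat.le_add_left 1 _
  generalize ⌊-s₂.re / 2⌋₊ + 1 = p at *
  have hlt : ∀ {l : ℕ}, l < 2 * p → (l : ℝ) + 1 ≤ B + 2 := fun {l} hl => by
    have : (l : ℝ) + 1 ≤ 2 * p := by exact_mod_cast hl
    linarith
  have hratio : B + H ≤ (1 - ε / 2) * S := by linarith
  -- The ratio of consecutive moments. As long as k ≤ -Re s₂, numerator and denominator are bounded
  -- through -Re s₂ - k + H and S - k, and lowering both by k only improves a ratio below 1. This
  -- limits the usable range to j < 2p.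
  have hstep : ∀ k : ℕ, k + 1 < 2 * p → ‖(s₂ + k) / (s₁ + s₂ + k)‖ ≤ 1 - ε / 2 := by
    intro k hk
    have hkB := hlt hk
    push_cast at hkB
    have hk0 : (0 : ℝ) ≤ k := Nat.cast_nonneg k
    have n1 : ‖s₂ + k‖ ≤ B - k + H := by
      refine (Complex.norm_le_abs_re_add_abs_im _).trans ?_
      rw [Complex.add_re, Complex.add_im, Complex.natCast_re, Complex.natCast_im, add_zero, e2,
        abs_of_nonpos (by linarith)]
      linarith
    have n2 : S - k ≤ ‖s₁ + s₂ + k‖ := by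
      have := Complex.abs_re_le_norm (s₁ + s₂ + k)
      rw [Complex.add_re, Complex.natCast_re, hsre, abs_of_nonpos (by linarith)] at this
      linarith
    rw [norm_div, div_le_iff₀ (by linarith)]
    calc _ ≤ B - k + H := n1
      _ ≤ (1 - ε / 2) * (S - k) := by linarith [mul_nonneg hε.le hk0]
      _ ≤ _ := mul_le_mul_of_nonneg_left n2 (by linarith)
  refine ⟨by rw [hcancel]; linarith, ?_⟩
  constructor
  case one_le_p => exact hp3
  case two_le => linarith
  case neg_lt_re => rw [e2]; linarith
  case re_le => rw [e2]; linarith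
  case re_le_neg_five => rw [e1]; linarith
  case add_re_lt => rw [hsre]; linarith
  case re_le_neg₁ => rw [e1]; linarith
  case re_le_neg₂ => rw [e2]; linarith
  case le_norm_shift =>
    intro l hl q hq
    have h1 := hlt hl
    have h2 : (q : ℝ) + 1 ≤ 2 * N + 1 := by exact_mod_cast hq
    have := Complex.abs_re_le_norm (s₁ + s₂ + l + q)
    rw [Complex.add_re, Complex.add_re, Complex.natCast_re, Complex.natCast_re, hsre,
      abs_of_nonpos (by linarith)] at this
    linarith
  case le_norm_shift_neg =>
    intro q hq
    have h2 : (q : ℝ) + 1 ≤ 2 * N + 1 := by exact_mod_cast hq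
    have := Complex.abs_re_le_norm (s₁ + s₂ + (-1) + q)
    rw [Complex.add_re, Complex.add_re, Complex.natCast_re, Complex.neg_re, Complex.one_re, hsre,
      abs_of_nonpos (by linarith)] at this
    linarith
  case le_re =>
    intro j hj
    have h1 := hlt hj
    rw [Complex.sub_re, Complex.sub_re, Complex.one_re, hsre, Complex.natCast_re]
    linarith
  case norm_ratio_le =>
    rw [norm_div, div_le_iff₀ (by linarith)]
    refine le_trans ?_ (mul_le_mul_of_nonneg_left hnorm' (by linarith))
    refine (Complex.norm_le_abs_re_add_abs_im _).trans ?_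
    rw [e2, abs_neg, abs_of_pos hB0]
    linarith
  case le_norm_ratio =>
    rw [norm_div, le_div_iff₀ (by linarith)]
    calc ε / 2 * ‖s₁ + s₂‖ ≤ ε / 2 * (2 * S) := by
          refine mul_le_mul_of_nonneg_left ?_ (by positivity)
          linarith
      _ ≤ _ := by linarith
  case norm_inv_le =>
    have n1 : ‖s₁ + s₂ - 1‖ ≤ 2 * S := by
      refine (norm_sub_le _ _).trans ?_
      rw [norm_one]
      linarith
    have n2 : ε * S ≤ ‖s₂ - 1‖ := by
      have := Complex.abs_re_le_norm (s₂ - 1)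
      rw [Complex.sub_re, Complex.one_re, e2, abs_of_nonpos (by linarith)] at this
      linarith
    have hεS0 : 0 < ε * S := by positivity
    rw [norm_div, inv_div, div_le_div_iff₀ (by linarith) hε]
    linarith [mul_le_mul_of_nonneg_right n1 hε.le]
  case norm_betaMoment_le =>
    intro l
    induction l with
    | zero => intro _; simp [betaMoment_zero]
    | succ k ih =>
      intro hk
      rw [betaMoment_succ, norm_mul, pow_succ]
      exact mul_le_mul (ih (by omega)) (hstep k hk) (norm_nonneg _)
        (pow_nonneg (by linarith) _)
  case im_le₁ => exact i1.le
  case im_le₂ => exact i2.le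
  case le_two_p => linarith
  case norm_one_sub_le =>
    rw [hcancel]
    refine (norm_sub_le _ _).trans ?_
    rw [norm_one]
    linarith

theorem doubleZeta_asymptotic {ε : ℝ} (hε : 0 < ε) (N : ℕ) : ∃ C R : ℝ, ∀ s₁ s₂ : ℂ,
    |s₁.im| < 1 / ε → |s₂.im| < 1 / ε →
    ε < s₁.re / (s₁ + s₂).re → s₁.re / (s₁ + s₂).re < 1 - ε →
    (∀ k : ℤ, s₁ + s₂ ≠ 2 * (k : ℂ)) → s₁.re < -R → s₂.re < -R →
    ‖doubleZeta s₁ s₂ / zetaFactor (s₁ + s₂) - doubleZetaMainTerm N s₁ s₂‖ ≤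
      C * ‖s₁ + s₂‖ ^ (-(N : ℤ) - 1) := by
  rcases le_or_gt (1 / 2) ε with h2 | h2
  -- For ε ≥ 1/2 no ratio lies strictly between ε and 1-ε.
  · exact ⟨0, 0, fun s₁ s₂ _ _ l1 l2 => by linarith⟩
  obtain ⟨C, hC0, hC⟩ := AsymptoticRegime.exists_norm_error_le N (ρ := 1 - ε / 2) (η := ε / 2)
    (H := 1 / ε) (K := 4 / ε) (by linarith) (by linarith) (by linarith) (by positivity)
  refine ⟨C * (4 / ε) ^ (N + 1), 6 + (2 * N + 4) * (2 / ε) + 2 / ε * (1 / ε), ?_⟩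
  intro s₁ s₂ i1 i2 l1 l2 hs r1 r2
  obtain ⟨hn, hR⟩ := asymptoticRegime_of_lt hε N i1 i2 l1 l2 r1 r2
  have h := hC _ _ s₁ s₂ hR hs
  have hY := hR.two_le
  set Y := ε * (-(s₁ + s₂).re) / 2
  have hY0 : 0 < Y := by linarith
  have hne : 0 < ‖s₁ + s₂‖ := norm_pos_iff.2 (by simpa using hs 0)
  have e : ‖s₁ + s₂‖ ^ (-(N : ℤ) - 1) = (‖s₁ + s₂‖ ^ (N + 1))⁻¹ := by
    rw [← zpow_natCast, ← zpow_neg]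
    congr 1
    push_cast
    ring
  rw [e, ← div_eq_mul_inv, le_div_iff₀ (by positivity)]
  calc _ ≤ ‖doubleZeta s₁ s₂ / zetaFactor (s₁ + s₂) - doubleZetaMainTerm N s₁ s₂‖ *
        (4 / ε * Y) ^ (N + 1) := by gcongr
    _ = ‖doubleZeta s₁ s₂ / zetaFactor (s₁ + s₂) - doubleZetaMainTerm N s₁ s₂‖ * Y ^ (N + 1) *
        (4 / ε) ^ (N + 1) := by rw [mul_pow]; ring
    _ ≤ _ := mul_le_mul_of_nonneg_right h (by positivity)

theorem theorem2p3 (ε : ℝ) (hε : 0 < ε) (N : ℕ) :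
    -- the double series has its analytic continuation `doubleZeta`
    IsDoubleZeta (fun s => doubleZeta s.1 s.2) ∧
    -- the asymptotic formula
    (∃ C R : ℝ, ∀ s₁ s₂ : ℂ,
      |s₁.im| < 1 / ε → |s₂.im| < 1 / ε →
      ε < s₁.re / (s₁ + s₂).re → s₁.re / (s₁ + s₂).re < 1 - ε →
      (∀ k : ℤ, s₁ + s₂ ≠ 2 * (k : ℂ)) →
      s₁.re < -R → s₂.re < -R →
      ‖doubleZeta s₁ s₂ / zetaFactor (s₁ + s₂) -
        (-(1 / 2) * Complex.sin (Real.pi / 2 * (s₁ + s₂))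
          + 1 / 2 * Complex.cos (Real.pi / 2 * (s₁ + s₂)) *
              ∑ j ∈ Finset.range (2 * N + 1),
                (Real.pi : ℂ) ^ j * iteratedDeriv j Complex.cot (Real.pi * (s₂ / (s₁ + s₂)))
                  / (ascPochhammer ℂ j).eval (s₁ + s₂) * cCoeff s₁ s₂ j
          + Complex.sin (Real.pi * s₂) * Complex.Gamma (1 - s₁) * Complex.Gamma (1 - s₂)
              * riemannZeta (2 - s₁ - s₂)
            / (4 * Real.pi * Complex.Gamma (1 - s₁ - s₂)
              * Complex.sin (Real.pi / 2 * (s₁ + s₂))))‖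
        ≤ C * ‖s₁ + s₂‖ ^ (-(N : ℤ) - 1)) ∧
    -- the explicit formula for the coefficients
    (∀ s₁ s₂ : ℂ, s₁ + s₂ ≠ 0 → ∀ j : ℕ,
      cCoeff s₁ s₂ j =
        ∑ l ∈ weightedFamilies j, (s₁ + s₂) ^ (∑ k, l k) *
          ∏ k : Finset.Icc 2 j, 1 / ((l k).factorial : ℂ) *
            ((s₁ / (s₁ + s₂) * (-(s₂ / (s₁ + s₂))) ^ (k : ℕ)
              + s₂ / (s₁ + s₂) * (s₁ / (s₁ + s₂)) ^ (k : ℕ)) / (k : ℕ)) ^ (l k)) := by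
  exact ⟨isDoubleZeta_doubleZeta, doubleZeta_asymptotic hε N, fun s₁ s₂ hs j => cCoeff_eq_sum hs j⟩
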